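/- Let $M$ be a connected $3$-manifold without boundary (Hausdorff, second countable, not necessarily compact or orientable), and let $h : S^0\times D^3\hookrightarrow M$ be a framed embedding, that is, $h$ extends to an open embedding of a neighbourhood of each of the two copies of $D^3$ and the two closed balls are disjoint. Let $$\chi(M)=\overline{M\setminus h(S^0\times D^3)}\;\cup_{h|_{S^0\times S^2}}\;(D^1\times S^2)$$ be the result of the $3$-dimensional $0$-surgery along $h$, where $(s,x)\in S^0\times S^2=\partial D^1\times S^2$ is identified with $h(s,x)$. For embedded closed $3$-balls $i:D^3\hookrightarrow M$ and $j:D^3\hookrightarrow S^1\times S^2$ (which extend to open embeddings of a neighbourhood of $D^3$) let $M\#_{i,j}(S^1\times S^2)$ be the connected sum obtained from the closures of the complements of the two balls by identifying $i(x)$ with $j(x)$ for $x\in S^2$. 1. Suppose that $M$ and $h$ are smooth and that $h$ respects orientations: if $M$ is orientable, then, for an orientation of $M$, one of $h|_{\{1\}\times D^3}$, $h|_{\{-1\}\times D^3}$ preserves and the other reverses orientation (no condition on $h$ if $M$ is non-orientable). Then $\chi(M)$ is homeomorphic to $M\#_{i,j}(S^1\times S^2)$ for all smooth embeddings $i,j$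 of $D^3$. 2. For every framed embedding $h$ and all base points, $\pi_1(\chi(M))\cong\pi_1(M)*\mathbb{Z}$, the free product of $\pi_1(M)$ with $\mathbb Z$. 3. For every framed embedding $h$, all $i,j$ as above and all base points, $$\pi_1(\chi(M))\cong\pi_1(M\#_{i,j}(S^1\times S^2))\cong\pi_1(M)*\pi_1(S^1\times S^2)\cong\pi_1(M)*(\pi_1(S^1)\times\pi_1(S^2)).$$ -/

import Mathlib

open scoped Manifold ContDiff

noncomputable section

namespace Surgery

/-- Euclidean 3-space. -/
abbrev E3 : Type := EuclideanSpace ℝ (Fin 3)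

/-- The closed ball `D³`, as a subset of `ℝ³`. -/
abbrev ball3 : Set E3 := Metric.closedBall 0 1

/-- The sphere `S⁰ = {1, -1} ⊆ ℝ`. -/
abbrev S0 : Type := Metric.sphere (0 : ℝ) 1

/-- The interval `D¹ = [-1, 1] ⊆ ℝ`, whose boundary is `S⁰`. -/
abbrev D1 : Type := Metric.closedBall (0 : ℝ) 1

/-- The sphere `S² = ∂D³`. -/
abbrev S2 : Type := Metric.sphere (0 : E3) 1

/-- The 3-manifold `S¹ × S²`. -/
abbrev S1xS2 : Type := Circle × S2

/-- The standard smooth structure on `S¹ × S²`. -/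
abbrev modelS1xS2 : ModelWithCorners ℝ
    (EuclideanSpace ℝ (Fin 1) × EuclideanSpace ℝ (Fin 2))
    (ModelProd (EuclideanSpace ℝ (Fin 1)) (EuclideanSpace ℝ (Fin 2))) :=
  (𝓡 1).prod (𝓡 2)

section Gluing

variable {X Y : Type*} [TopologicalSpace X] [TopologicalSpace Y]

/-- The relation on `X ⊔ Y` that generates the identifications `x ∼ y` for `R x y`. -/
def glueRel (R : X → Y → Prop) (a b : X ⊕ Y) : Prop :=
  ∃ x y, a = Sum.inl x ∧ b = Sum.inr y ∧ R x y

/-- The quotient space of `X ⊔ Y` by the equivalence relation generated by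
`x ∼ y` whenever `R x y`, with the quotient topology. -/
def Glue (R : X → Y → Prop) : Type _ := Quot (glueRel R)

instance (R : X → Y → Prop) : TopologicalSpace (Glue R) :=
  inferInstanceAs (TopologicalSpace (Quot (glueRel R)))

end Gluing

section Discs

/- A parametrized disc in `N` is recorded as a function `f : ℝ³ → N`, of which only the
values on (a neighbourhood of) the closed unit ball `D³` matter. -/

/-- `f` restricts to a thickened (that is, locally flat) topological embedding of `D³`:
it is an open embedding on some open neighbourhood of `D³`. -/
def IsTameDisc {N : Type*} [TopologicalSpace N] (f : E3 → N) : Prop :=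
  ∃ U : Set E3, IsOpen U ∧ ball3 ⊆ U ∧ Topology.IsOpenEmbedding (U.domRestrict f)

/-- `f` restricts to a smooth embedding of `D³`: it is smooth on some open neighbourhood of `D³`,
and on `D³` it is injective with injective differential. -/
def IsSmoothDisc {E H : Type*} [NormedAddCommGroup E] [NormedSpace ℝ E] [TopologicalSpace H]
    (J : ModelWithCorners ℝ E H) {N : Type*} [TopologicalSpace N] [ChartedSpace H N]
    (f : E3 → N) : Prop :=
  (∃ U : Set E3, IsOpen U ∧ ball3 ⊆ U ∧ ContMDiffOn 𝓘(ℝ, E3) J ∞ f U) ∧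
  Set.InjOn f ball3 ∧
  ∀ x ∈ ball3, Function.Injective (mfderiv 𝓘(ℝ, E3) J f x)

end Discs

section ZeroSurgery

variable {M : Type*} [TopologicalSpace M]

/-- `h` is a framed embedding `S⁰ × D³ ↪ M`: each of the two discs is a thickened embedding, and
the two discs are disjoint. -/
structure IsFramedEmbedding (h : S0 → E3 → M) : Prop where
  tame : ∀ s, IsTameDisc (h s)
  disjoint : ∀ s t, s ≠ t → Disjoint (h s '' ball3) (h t '' ball3)

/-- The image `h(S⁰ × D³)`. -/
def removed (h : S0 → E3 → M) : Set M := ⋃ s, h s '' ball3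

/-- The result `χ(M)` of 3-dimensional 0-surgery: the closure of `M \ h(S⁰ × D³)` glued with
`D¹ × S²` by identifying `(s, x) ∈ S⁰ × S² ⊆ D¹ × S²` with `h(s, x)`. -/
abbrev ZeroSurgery (h : S0 → E3 → M) : Type _ :=
  Glue (X := closure (Set.univ \ removed h)) (Y := D1 × S2)
    fun p q => ∃ s : S0, (s : ℝ) = q.1 ∧ (p : M) = h s q.2

/-- The connected sum of `M` and `N` along the discs `i` in `M` and `j` in `N`: the closures of
the complements of the discs, glued by identifying `i x` with `j x` for `x ∈ S²`. -/
abbrev ConnectedSum {N : Type*} [TopologicalSpace N] (i : E3 → M) (j : E3 → N) : Type _ :=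
  Glue (X := closure (Set.univ \ i '' ball3)) (Y := closure (Set.univ \ j '' ball3))
    fun p q => ∃ x : S2, (p : M) = i x ∧ (q : N) = j x

variable [ChartedSpace E3 M]

/-- `A` is an oriented smooth atlas of `M`, that is, an orientation of `M`: a set of charts of the
smooth structure that cover `M` and whose transition maps have positive Jacobian. -/
structure IsOrientedAtlas (A : Set (OpenPartialHomeomorph M E3)) : Prop where
  smooth : A ⊆ IsManifold.maximalAtlas 𝓘(ℝ, E3) ∞ M
  cover : ∀ x : M, ∃ φ ∈ A, x ∈ φ.source
  pos : ∀ φ ∈ A, ∀ ψ ∈ A, ∀ y ∈ (φ.symm.trans ψ).source,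
    0 < (fderiv ℝ (φ.symm.trans ψ) y).det

/-- The embedding `h` of `S⁰ × D³` respects orientations, where `S⁰` is oriented as the boundary
of `D¹`: with respect to every orientation of `M`, one of the two discs preserves and the other
one reverses orientation. There is no condition on `h` if `M` is not orientable. -/
def RespectsOrientation (h : S0 → E3 → M) : Prop :=
  ∀ A : Set (OpenPartialHomeomorph M E3), IsOrientedAtlas A →
    ∀ φ ∈ A, ∀ ψ ∈ A, ∀ s t : S0, s ≠ t → h s 0 ∈ φ.source → h t 0 ∈ ψ.source →
      (fderiv ℝ (φ ∘ h s) 0).det * (fderiv ℝ (ψ ∘ h t) 0).det < 0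

end ZeroSurgery

end Surgery

end

open scoped Manifold ContDiff

noncomputable section

namespace Surgery

open Set Topology Filter
open scoped unitInterval

/-! ### Gluing functors on paths over an open cover -/

section VanKampenCore

variable {X : Type*} [TopologicalSpace X] {G : Type*} [Group G]
variable {E : Type*} [NormedAddCommGroup E] [NormedSpace ℝ E]

/-! Fundamental groups. A disc without its centre is a collar `S² × (0, 1]` of its boundary sphere.
Hence `M` without the centres of the removed discs is an open subset `U` of the glued space: the
punctured discs run into a collar of the other piece (`exists_collar_embedding`). Together with `V`,
the other piece without the gluing spheres, it covers everything, and `U ∩ V` is a disjoint union of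
simply connected shells `S² × (0, 1)`, one for each disc. The Seifert–van Kampen theorem for this
situation (`nonempty_fundamentalGroup_mulEquiv_coprod`) gives `π₁(U) * π₁(V) * F`, where `F` is free
on all shells but one. The same theorem shows that removing points or balls does not affect `π₁`, so
`π₁(U) = π₁(M)`. For the surgery, `V = (-1, 1) × S²` is simply connected and there are two shells,
which yields `π₁(M) * ℤ`. For the connected sum there is one shell and `V` is the second summand
without a ball, which yields `π₁(M) * π₁(S¹ × S²)`, and `π₁(S¹ × S²) = ℤ`. Neither smoothness nor
orientations matter here.

Normal form of the discs. A disc can be shrunk radially by an ambient homeomorphism, so only its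
germ at the centre counts. A smooth germ can be deformed, by homeomorphisms of small support, first
to its linear part and then, according to the sign of the determinant, to the identity or to a fixed
reflection `rho`. Sliding germs through charts shows that in a connected set any two regular germs
are equivalent up to `rho` (`germEquiv_or_germEquiv_comp_rho`). The homeomorphisms are kept equal to
the identity near a closed set `C`, so that the two discs of `h` can be moved one at a time. To
determine the sign, suppose that the germ of the first disc is not equivalent to its reflection.
Then the charts all of whose germs are equivalent to it form an oriented atlas, and the hypothesis
on orientations applies to this atlas (`germEquiv_of_respectsOrientation`). As a result `h` may be
replaced by `F ∘ discPos` and `F ∘ discNeg`, where `F` is the second disc and `discPos`, `discNeg`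
are two standard discs in the unit ball with opposite orientations.

The model. `S¹ × S²` is the quotient of `ℝ³ \ {0}` by the dilation with factor `exp (2π)`. The
annulus `R⁻¹ ≤ ‖v‖ ≤ R` with `R = exp (π / 2)` covers one half of it, and a tube `D¹ × S²` the other
half. Remove the ball of radius `1 / 2` around a unit vector `q`. The inversion at `q` carries the
rest of the annulus to the unit ball without two discs, namely the images of the ball `‖v‖ < R⁻¹`
and of the exterior `‖v‖ > R` with infinity added. So `S¹ × S²` without a ball is this region with a
handle attached, and gluing in `M \ F(D³)` along the outer sphere gives the surgery on `F ∘
discPos`, `F ∘ discNeg` (`zeroSurgery_modelDisc`). Finally, a reflection of `S²` fixes `q` and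
carries the removed ball to its reflected copy, so the connected sum does not depend on the discs
(`connectedSum_modelBall`). -/

/-- The image under `f` of the straight segment from `p` to `q`. -/
def segPath (f : C(E, X)) (p q : E) : Path (f p) (f q) where
  toFun t := f (AffineMap.lineMap p q (t : ℝ))
  continuous_toFun := by
    refine f.continuous.comp ?_
    exact (AffineMap.lineMap_continuous (R := ℝ)).comp continuous_subtype_val
  source' := by simp
  target' := by simp

theorem segPath_apply (f : C(E, X)) (p q : E) (t : I) :
    segPath f p q t = f (AffineMap.lineMap p q (t : ℝ)) := rfl

/-- `Φ` restricts on the paths in `U` to a functor to the group `G` (with the order of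
multiplication used for fundamental groups). -/
structure IsPathFunctionalOn (Φ : C(I, X) → G) (U : Set X) : Prop where
  map_trans : ∀ {a b c : X} (γ : Path a b) (γ' : Path b c), (∀ t, γ t ∈ U) → (∀ t, γ' t ∈ U) →
    Φ (γ.trans γ').toContinuousMap = Φ γ'.toContinuousMap * Φ γ.toContinuousMap
  map_homotopy : ∀ {a b : X} {γ γ' : Path a b} (F : γ.Homotopy γ'), (∀ p, F p ∈ U) →
    Φ γ.toContinuousMap = Φ γ'.toContinuousMap

/-- The homotopy between the two ways around a triangle. -/
def triangleHomotopy (f : C(E, X)) (p q r : E) :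
    ((segPath f p q).trans (segPath f q r)).Homotopy (segPath f p r) where
  toFun x := f (AffineMap.lineMap
    (((Path.segment p q).trans (Path.segment q r)) x.2) (Path.segment p r x.2) (x.1 : ℝ))
  continuous_toFun := by
    refine f.continuous.comp ?_
    simp only [AffineMap.lineMap_apply_module]
    fun_prop
  map_zero_left t := by
    simp only [Path.trans_apply, Path.coe_toContinuousMap, segPath_apply, Path.segment_apply]
    split_ifs <;> simp
  map_one_left t := by simp [segPath_apply]
  prop' s t ht := by
    rcases ht with rfl | ht
    · simp
    · rw [mem_singleton_iff] at ht; subst ht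
      simp

/-- The homotopy sweeps out the triangle, which lies in the convex set `B` and so is mapped into
`U`. -/
theorem IsPathFunctionalOn.triangle {Φ : C(I, X) → G} {U : Set X} (h : IsPathFunctionalOn Φ U)
    (f : C(E, X)) {B : Set E} (hB : Convex ℝ B) (hU : MapsTo f B U) {p q r : E}
    (hp : p ∈ B) (hq : q ∈ B) (hr : r ∈ B) :
    Φ (segPath f p r).toContinuousMap =
      Φ (segPath f q r).toContinuousMap * Φ (segPath f p q).toContinuousMap := by
  have hseg : ∀ {p q : E}, p ∈ B → q ∈ B → ∀ t : I, AffineMap.lineMap p q (t : ℝ) ∈ B :=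
    fun hp hq t => hB.lineMap_mem hp hq t.2
  rw [← h.map_trans _ _ (fun t => hU (hseg hp hq t)) (fun t => hU (hseg hq hr t))]
  refine (h.map_homotopy (triangleHomotopy f p q r) fun x => hU ?_).symm
  refine hB.lineMap_mem ?_ (hseg hp hr _) x.1.2
  rw [Path.trans_apply]
  split_ifs
  · exact hseg hp hq _
  · exact hseg hq hr _

/-- `c` is a primitive of `Φ` along `f` on `K`. -/
def IsPrimitive (Φ : C(I, X) → G) (f : C(E, X)) (K : Set E) (c : E → G) : Prop :=
  ∃ δ > 0, ∀ p ∈ K, ∀ q ∈ K, dist p q < δ → c q = Φ (segPath f p q).toContinuousMap * c p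

/-- The primitive at `q` is the product of the values of `Φ` along a fine subdivision of the ray
from `o` to `q`. The cocycle identity for triangles below a Lebesgue number compares neighbouring
rays. -/
theorem exists_isPrimitive {ι : Type*} {U : ι → Set X} (hU : ∀ i, IsOpen (U i))
    (hcov : ⋃ i, U i = univ) {Φ : C(I, X) → G} (hΦ : ∀ i, IsPathFunctionalOn Φ (U i))
    (f : C(E, X)) {K : Set E} (hK : IsCompact K) (hconv : Convex ℝ K) {o : E} (ho : o ∈ K) :
    ∃ c, IsPrimitive Φ f K c := by
  obtain ⟨δ, hδ, hleb⟩ := lebesgue_number_lemma_of_metric hK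
    (fun i => (hU i).preimage f.continuous)
    (fun x _ => by
      have : f x ∈ ⋃ i, U i := hcov ▸ mem_univ _
      simpa using this)
  have htri : ∀ x ∈ K, ∀ p q r : E, dist p x < δ → dist q x < δ → dist r x < δ →
      Φ (segPath f p r).toContinuousMap =
      Φ (segPath f q r).toContinuousMap * Φ (segPath f p q).toContinuousMap := by
    intro x hx p q r hp hq hr
    obtain ⟨i, hi⟩ := hleb x hx
    exact (hΦ i).triangle f (convex_ball x δ) hi hp hq hr
  obtain ⟨D, hD⟩ := hK.isBounded.exists_norm_le
  -- Distances from `o` in `K` are at most `2 D`, so with `n` steps each one is shorter than `δ /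
  -- 2`.
  obtain ⟨n, hn⟩ := exists_nat_gt (2 * (D + D) / δ)
  have hD0 : 0 ≤ D := (norm_nonneg _).trans (hD o ho)
  have hn0 : (0 : ℝ) < n := lt_of_le_of_lt (by positivity) hn
  set P : ℕ → E → E := fun k q => AffineMap.lineMap o q ((k : ℝ) / n) with hP
  have hPK : ∀ k ≤ n, ∀ q ∈ K, P k q ∈ K := fun k hk q hq =>
    hconv.lineMap_mem ho hq ⟨by positivity, by
      rw [div_le_one hn0]; exact_mod_cast hk⟩
  have hstep : ∀ k, ∀ q ∈ K, dist (P (k + 1) q) (P k q) < δ / 2 := by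
    intro k q hq
    rw [hP]
    simp only [dist_lineMap_lineMap]
    have h1 : dist o q ≤ D + D := by
      rw [dist_eq_norm]; exact (norm_sub_le _ _).trans (add_le_add (hD o ho) (hD q hq))
    have h2 : dist (((k + 1 : ℕ) : ℝ) / n) ((k : ℝ) / n) = 1 / n := by
      rw [Real.dist_eq, ← sub_div, Nat.cast_add, Nat.cast_one, add_sub_cancel_left,
        abs_of_pos (by positivity)]
    rw [h2, one_div, inv_mul_lt_iff₀ hn0]
    rw [div_lt_iff₀ hδ] at hn
    linarith
  have hpar : ∀ k ≤ n, ∀ q q' : E, dist q q' < δ / 2 → dist (P k q) (P k q') < δ / 2 := by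
    intro k hk q q' hqq
    refine lt_of_le_of_lt ?_ hqq
    have : P k q - P k q' = ((k : ℝ) / n) • (q - q') := by
      simp only [hP, AffineMap.lineMap_apply_module]; module
    rw [dist_eq_norm, this, norm_smul, dist_eq_norm, Real.norm_of_nonneg (by positivity)]
    exact mul_le_of_le_one_left (norm_nonneg _) (by rw [div_le_one hn0]; exact_mod_cast hk)
  let c : ℕ → E → G := fun k q => Nat.rec 1
    (fun k g => Φ (segPath f (P k q) (P (k + 1) q)).toContinuousMap * g) k
  have hc0 : ∀ q, c 0 q = 1 := fun _ => rfl
  have hcs : ∀ k q, c (k + 1) q =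
    Φ (segPath f (P k q) (P (k + 1) q)).toContinuousMap * c k q := fun _ _ => rfl
  have key : ∀ k ≤ n, ∀ q ∈ K, ∀ q' ∈ K, dist q q' < δ / 2 →
      c k q' = Φ (segPath f (P k q) (P k q')).toContinuousMap * c k q := by
    intro k
    induction k with
    | zero =>
      intro _ q _ q' _ _
      have h1 : P 0 q = o := by simp [hP]
      have h2 : P 0 q' = o := by simp [hP]
      -- The value of a constant segment is idempotent, hence `1`.
      have := htri o ho o o o (by simpa) (by simpa) (by simpa)
      rw [hc0, hc0, h1, h2, mul_one]
      exact (mul_eq_left.1 this.symm).symm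
    | succ k ih =>
      intro hk q hq q' hq' hqq
      have hk' : k ≤ n := (Nat.le_succ k).trans hk
      have a1 := hstep k q hq
      have a2 := hstep k q' hq'
      have a3 := hpar k hk' q q' hqq
      have a4 : dist (P (k + 1) q') (P k q) < δ := by
        have := dist_triangle (P (k + 1) q') (P k q') (P k q)
        rw [dist_comm (P k q')] at this
        linarith
      have hz : dist (P k q) (P k q) < δ := by simpa
      -- The quadrilateral between the two rays is cut along the diagonal from `P k q` to `P (k + 1)
      -- q'`; all four vertices are within `δ` of `P k q`.
      have b1 := htri (P k q) (hPK k hk' q hq) (P k q) (P (k + 1) q) (P (k + 1) q') hz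
        (by linarith) a4
      have b2 := htri (P k q) (hPK k hk' q hq) (P k q) (P k q') (P (k + 1) q') hz
        (by rw [dist_comm]; linarith) a4
      rw [hcs, hcs, ih hk' q hq q' hq' hqq, ← mul_assoc, ← mul_assoc, ← b1, ← b2]
  refine ⟨c n, δ / 2, by positivity, fun p hp q hq hpq => ?_⟩
  have h1 : ∀ q, P n q = q := fun q => by simp [hP, div_self hn0.ne']
  have := key n le_rfl p hp q hq hpq
  rwa [h1, h1] at this

/-- Along a short segment both primitives acquire the same left factor, so `(c p)⁻¹ * c' p` is
locally constant. -/
theorem IsPrimitive.eq_of_isPreconnected {Φ : C(I, X) → G} {f : C(E, X)} {K : Set E}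
    (hK : IsPreconnected K) {c c' : E → G} (h : IsPrimitive Φ f K c) (h' : IsPrimitive Φ f K c')
    {p q : E} (hp : p ∈ K) (hq : q ∈ K) : c q * (c p)⁻¹ = c' q * (c' p)⁻¹ := by
  obtain ⟨δ, hδ, h⟩ := h
  obtain ⟨δ', hδ', h'⟩ := h'
  have key : (c p)⁻¹ * c' p = (c q)⁻¹ * c' q := by
    refine hK.induction₂ (fun p q => (c p)⁻¹ * c' p = (c q)⁻¹ * c' q) (fun x hx => ?_)
      (fun _ _ _ _ _ _ h1 h2 => h1.trans h2) (fun _ _ _ _ h => h.symm) hp hq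
    filter_upwards [self_mem_nhdsWithin,
      mem_nhdsWithin_of_mem_nhds (Metric.ball_mem_nhds x (lt_min hδ hδ'))] with y hy hxy
    rw [Metric.mem_ball, dist_comm, lt_min_iff] at hxy
    rw [h x hx y hy hxy.1, h' x hx y hy hxy.2]
    group
  calc c q * (c p)⁻¹ = c q * ((c p)⁻¹ * c' p) * (c' p)⁻¹ := by group
    _ = c' q * (c' p)⁻¹ := by rw [key]; group

theorem IsPrimitive.comp_lineMap {Φ : C(I, X) → G} {f : C(E, X)} {K : Set E} {c : E → G}
    (h : IsPrimitive Φ f K c) (hK : Convex ℝ K) {a b : E} (ha : a ∈ K) (hb : b ∈ K) {g : C(ℝ, X)}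
    (hg : ∀ t ∈ Icc (0 : ℝ) 1, f (AffineMap.lineMap a b t) = g t) :
    IsPrimitive Φ g (Icc (0 : ℝ) 1) fun t => c (AffineMap.lineMap a b t) := by
  obtain ⟨δ, hδ, h⟩ := h
  -- The added `1` covers the degenerate case `a = b`.
  refine ⟨δ / (dist a b + 1), by positivity, fun s hs t ht hst => ?_⟩
  have hd : dist (AffineMap.lineMap a b s : E) (AffineMap.lineMap a b t) < δ := by
    rw [dist_lineMap_lineMap]
    rw [lt_div_iff₀ (by positivity)] at hst
    nlinarith [dist_nonneg (x := s) (y := t)]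
  simp only
  rw [h _ (hK.lineMap_mem ha hb hs) _ (hK.lineMap_mem ha hb ht) hd]
  congr 2
  ext u
  simp only [Path.coe_toContinuousMap, segPath_apply]
  rw [← hg _ ((convex_Icc (0 : ℝ) 1).lineMap_mem hs ht u.2)]
  congr 1
  simp only [AffineMap.lineMap_apply_module, smul_eq_mul]
  module

/-- A path, extended to the real line by constants. -/
def extendPath {a b : X} (γ : Path a b) : C(ℝ, X) := ⟨γ.extend, γ.continuous_extend⟩

theorem extendPath_coe {a b : X} (γ : Path a b) (t : I) : extendPath γ (t : ℝ) = γ t := by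
  simp [extendPath]

theorem extendPath_of_mem {a b : X} (γ : Path a b) {t : ℝ} (ht : t ∈ I) :
    extendPath γ t = γ ⟨t, ht⟩ := extendPath_coe γ ⟨t, ht⟩

theorem segPath_extendPath {a b : X} (γ : Path a b) :
    (segPath (extendPath γ) 0 1).toContinuousMap = γ.toContinuousMap := by
  ext t
  have : AffineMap.lineMap (0 : ℝ) 1 (t : ℝ) = t := by simp [AffineMap.lineMap_apply_module]
  simp only [Path.coe_toContinuousMap, segPath_apply]
  rw [this, extendPath_coe]

/-- The van Kampen principle: compatible functors on the path groupoids of the members of an open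
cover glue to a functor on the fundamental groupoid. -/
theorem exists_functional_of_cover {ι : Type*} {U : ι → Set X} (hU : ∀ i, IsOpen (U i))
    (hcov : ⋃ i, U i = univ) {Φ : C(I, X) → G} (hΦ : ∀ i, IsPathFunctionalOn Φ (U i)) :
    ∃ Ψ : ∀ a b : X, Path.Homotopic.Quotient a b → G,
      (∀ a b c (γ : Path.Homotopic.Quotient a b) (γ' : Path.Homotopic.Quotient b c),
        Ψ a c (γ.trans γ') = Ψ b c γ' * Ψ a b γ) ∧
      ∀ a b (γ : Path a b) i, (∀ t, γ t ∈ U i) →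
        Ψ a b (Path.Homotopic.Quotient.mk γ) = Φ γ.toContinuousMap := by
  have hex : ∀ {a b : X} (γ : Path a b), ∃ c, IsPrimitive Φ (extendPath γ) (Icc (0 : ℝ) 1) c :=
    fun γ => exists_isPrimitive hU hcov hΦ _ isCompact_Icc (convex_Icc 0 1)
      (left_mem_Icc.2 zero_le_one)
  choose C hC using @hex
  -- The value on a path is the increment of a primitive along it, which does not depend on the
  -- primitive.
  let Ψ₀ : ∀ {a b : X}, Path a b → G := fun γ => C γ 1 * (C γ 0)⁻¹
  have h0 : (0 : ℝ) ∈ Icc (0 : ℝ) 1 := left_mem_Icc.2 zero_le_one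
  have h1 : (1 : ℝ) ∈ Icc (0 : ℝ) 1 := right_mem_Icc.2 zero_le_one
  have hΨ₀ : ∀ {a b : X} (γ : Path a b) (c : ℝ → G),
      IsPrimitive Φ (extendPath γ) (Icc (0 : ℝ) 1) c → Ψ₀ γ = c 1 * (c 0)⁻¹ := fun γ c hc =>
    (hC γ).eq_of_isPreconnected isPreconnected_Icc hc h0 h1
  have hloc : ∀ {a b : X} (γ : Path a b) i, (∀ t, γ t ∈ U i) → Ψ₀ γ = Φ γ.toContinuousMap := by
    intro a b γ i hγ
    have hm : ∀ t, extendPath γ t ∈ U i := fun t => hγ _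
    have htri := fun p q r : ℝ => (hΦ i).triangle (extendPath γ) convex_univ
      (fun t _ => hm t) (mem_univ p) (mem_univ q) (mem_univ r)
    rw [hΨ₀ γ (fun t => Φ (segPath (extendPath γ) 0 t).toContinuousMap)
      ⟨1, one_pos, fun p _ q _ _ => htri _ _ _⟩, segPath_extendPath]
    have := htri 0 0 0
    rw [mul_eq_left.1 this.symm, inv_one, mul_one]
  have htrans : ∀ {a b c : X} (γ : Path a b) (γ' : Path b c),
      Ψ₀ (γ.trans γ') = Ψ₀ γ' * Ψ₀ γ := by
    intro a b c γ γ'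
    have hh : (1 / 2 : ℝ) ∈ Icc (0 : ℝ) 1 := by constructor <;> norm_num
    have p1 := (hC (γ.trans γ')).comp_lineMap (convex_Icc 0 1) h0 hh (g := extendPath γ) (by
      intro t ht
      have : AffineMap.lineMap (0 : ℝ) (1 / 2) t = t / 2 := by
        simp [AffineMap.lineMap_apply_module]; ring
      rw [this, extendPath_of_mem _ ht,
        extendPath_of_mem _ (t := t / 2) ⟨by linarith [ht.1], by linarith [ht.2]⟩, Path.trans_apply,
        dif_pos (by simp; linarith [ht.2])]
      congr 2; simp; ring)
    have p2 := (hC (γ.trans γ')).comp_lineMap (convex_Icc 0 1) hh h1 (g := extendPath γ') (by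
      intro t ht
      have : AffineMap.lineMap (1 / 2 : ℝ) 1 t = (t + 1) / 2 := by
        simp [AffineMap.lineMap_apply_module]; ring
      rw [this, extendPath_of_mem _ ht, extendPath_of_mem _ (t := (t + 1) / 2)
        ⟨by linarith [ht.1], by linarith [ht.2]⟩, Path.trans_apply]
      split_ifs with hle
      · have : t = 0 := le_antisymm (by simp at hle; linarith) ht.1
        subst this
        have e1 : γ' ⟨0, ht⟩ = b := γ'.source
        rw [e1]
        convert γ.target using 2
        apply Subtype.ext; simp
      · congr 2; simp; ring)
    rw [hΨ₀ γ _ p1, hΨ₀ γ' _ p2]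
    simp only [AffineMap.lineMap_apply_one, AffineMap.lineMap_apply_zero]
    show C _ 1 * (C _ 0)⁻¹ = _
    group
  -- Needed for the sides of a homotopy square on which an end point is held fixed.
  have hconst : ∀ (x : X) (g : C(ℝ, X)) (c : ℝ → G), (∀ t ∈ Icc (0 : ℝ) 1, g t = x) →
      IsPrimitive Φ g (Icc (0 : ℝ) 1) c → c 0 = c 1 := by
    intro x g c hg hc
    obtain ⟨i, hi⟩ : ∃ i, x ∈ U i := by
      have : x ∈ ⋃ i, U i := hcov ▸ mem_univ _
      simpa using this
    have := hc.eq_of_isPreconnected isPreconnected_Icc (c' := fun _ => 1) ⟨1, one_pos, ?_⟩ h0 h1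
    · rw [inv_one, mul_one, mul_inv_eq_one] at this
      exact this.symm
    · intro p hp q hq _
      have := (hΦ i).triangle g (convex_Icc (0 : ℝ) 1) (fun t ht => (hg t ht).symm ▸ hi) hp hp hq
      have e : (segPath g p q).toContinuousMap = (segPath g p p).toContinuousMap := by
        ext t
        simp only [Path.coe_toContinuousMap, segPath_apply]
        rw [hg _ ((convex_Icc (0 : ℝ) 1).lineMap_mem hp hq t.2),
          hg _ ((convex_Icc (0 : ℝ) 1).lineMap_mem hp hp t.2)]
      rw [mul_one]
      exact (mul_eq_left.1 this.symm).symm.trans (by rw [e])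
  have hhom : ∀ {a b : X} (γ γ' : Path a b), γ.Homotopic γ' → Ψ₀ γ = Ψ₀ γ' := by
    rintro a b γ γ' ⟨F⟩
    let f : C(ℝ × ℝ, X) := ⟨fun p => F (projIcc 0 1 zero_le_one p.1, projIcc 0 1 zero_le_one p.2),
      by fun_prop⟩
    have hf : ∀ s (hs : s ∈ I) t (ht : t ∈ I), f (s, t) = F (⟨s, hs⟩, ⟨t, ht⟩) := by
      intro s hs t ht
      simp [f, projIcc_of_mem zero_le_one hs, projIcc_of_mem zero_le_one ht]
    set K : Set (ℝ × ℝ) := Icc (0 : ℝ) 1 ×ˢ Icc (0 : ℝ) 1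
    have hKc : Convex ℝ K := (convex_Icc _ _).prod (convex_Icc _ _)
    -- One primitive on the whole square restricts to primitives along all four sides; two of them
    -- are constant paths, so the increments along `γ` and `γ'` agree.
    obtain ⟨c, hc⟩ := exists_isPrimitive hU hcov hΦ f (isCompact_Icc.prod isCompact_Icc) hKc
      (o := (0, 0)) ⟨h0, h0⟩
    have hl : ∀ (a b : ℝ × ℝ) (t : ℝ), AffineMap.lineMap a b t =
        ((1 - t) * a.1 + t * b.1, (1 - t) * a.2 + t * b.2) := by
      intro a b t; rw [AffineMap.lineMap_apply_module]; rfl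
    have q1 := hc.comp_lineMap hKc (a := (0, 0)) (b := (0, 1)) ⟨h0, h0⟩ ⟨h0, h1⟩
      (g := extendPath γ) (by
        intro t ht
        rw [hl, extendPath_of_mem _ ht]
        have := hf 0 h0 t ht
        simp only [mul_zero, zero_add, add_zero, mul_one]
        rw [this]
        exact F.apply_zero _)
    have q2 := hc.comp_lineMap hKc (a := (1, 0)) (b := (1, 1)) ⟨h1, h0⟩ ⟨h1, h1⟩
      (g := extendPath γ') (by
        intro t ht
        rw [hl, extendPath_of_mem _ ht]
        have := hf 1 h1 t ht
        simp only [mul_zero, zero_add, mul_one, sub_add_cancel]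
        rw [this]
        exact F.apply_one _)
    have q3 := hconst a (f.comp ⟨fun t => (t, 0), by fun_prop⟩) _ (by
        intro t ht
        show f (t, 0) = a
        rw [hf t ht 0 h0]; exact F.source _)
      (hc.comp_lineMap hKc (a := (0, 0)) (b := (1, 0)) ⟨h0, h0⟩ ⟨h1, h0⟩ (by
        intro t ht; rw [hl]; simp))
    have q4 := hconst b (f.comp ⟨fun t => (t, 1), by fun_prop⟩) _ (by
        intro t ht
        show f (t, 1) = b
        rw [hf t ht 1 h1]; exact F.target _)
      (hc.comp_lineMap hKc (a := (0, 1)) (b := (1, 1)) ⟨h0, h1⟩ ⟨h1, h1⟩ (by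
        intro t ht; rw [hl]; simp))
    rw [hΨ₀ γ _ q1, hΨ₀ γ' _ q2]
    simp only [AffineMap.lineMap_apply_one, AffineMap.lineMap_apply_zero] at q3 q4 ⊢
    rw [q3, q4]
  refine ⟨fun a b => Quotient.lift Ψ₀ hhom, ?_, ?_⟩
  · intro a b c γ γ'
    induction γ using Path.Homotopic.Quotient.ind with | _ γ
    induction γ' using Path.Homotopic.Quotient.ind with | _ γ'
    exact htrans γ γ'
  · intro a b γ i hγ
    exact hloc γ i hγ

/-- Induction over the path classes of a space with an open cover. -/
theorem pathClass_induction {ι : Type*} {U : ι → Set X} (hU : ∀ i, IsOpen (U i))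
    (hcov : ⋃ i, U i = univ) (P : ∀ a b : X, Path.Homotopic.Quotient a b → Prop)
    (htrans : ∀ a b c (γ : Path.Homotopic.Quotient a b) (γ' : Path.Homotopic.Quotient b c),
      P a b γ → P b c γ' → P a c (γ.trans γ'))
    (hloc : ∀ a b (γ : Path a b) i, (∀ t, γ t ∈ U i) → P a b (Path.Homotopic.Quotient.mk γ))
    {a b : X} (γ : Path.Homotopic.Quotient a b) : P a b γ := by
  induction γ using Path.Homotopic.Quotient.ind with | _ γ
  -- For subpaths from `s` to `t` the property holds when `t` is near `s` and is transitive, so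
  -- connectedness of the interval gives it for the whole path.
  have key : P _ _ (Path.Homotopic.Quotient.mk (γ.subpath 0 1)) := by
    refine isPreconnected_univ.induction₂'
      (fun s t => P _ _ (Path.Homotopic.Quotient.mk (γ.subpath s t))) (fun x _ => ?_)
      (fun r s t _ _ _ h1 h2 => ?_) (mem_univ 0) (mem_univ 1)
    · obtain ⟨i, hi⟩ : ∃ i, γ x ∈ U i := by
        have : γ x ∈ ⋃ i, U i := hcov ▸ mem_univ _
        simpa using this
      have hV : γ ⁻¹' U i ∈ 𝓝 x := γ.continuous.continuousAt ((hU i).mem_nhds hi)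
      have ht : Tendsto (fun y => uIcc x y) (𝓝 x) (𝓝 x).smallSets :=
        tendsto_const_nhds.uIcc tendsto_id
      rw [nhdsWithin_univ]
      filter_upwards [ht.eventually (eventually_smallSets.2 ⟨_, hV, fun t ht => ht⟩)] with y hy
      have hy' : ∀ s t, uIcc s t = uIcc x y → ∀ r, γ.subpath s t r ∈ U i := fun s t h r => by
        have : γ.subpath s t r ∈ range (γ.subpath s t) := mem_range_self r
        rw [Path.range_subpath, h] at this
        obtain ⟨u, hu, hur⟩ := this
        rw [← hur]; exact hy hu
      exact ⟨hloc _ _ _ i (hy' x y rfl), hloc _ _ _ i (hy' y x (uIcc_comm _ _))⟩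
    · have := htrans _ _ _ _ _ h1 h2
      rw [← Path.Homotopic.Quotient.mk_trans] at this
      rwa [Path.Homotopic.Quotient.eq.2 ⟨Path.Homotopy.subpathTransSubpath γ r s t⟩] at this
  rw [Path.subpath_zero_one] at key
  have e0 := γ.source
  have e1 := γ.target
  revert key
  have : ∀ (a' b' : X) (h0 : a' = a) (h1 : b' = b),
      P a' b' (Path.Homotopic.Quotient.mk (γ.cast h0 h1)) →
      P a b (Path.Homotopic.Quotient.mk γ) := by
    rintro _ _ rfl rfl h; exact h
  exact this _ _ e0 e1

end VanKampenCore

/-! ### Covers by two open embeddings -/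

section VanKampen

variable {X Y : Type*} [TopologicalSpace X] [TopologicalSpace Y] {G : Type*}

/-- Homotopy classes of paths with fixed end points. -/
abbrev PathClass (a b : X) : Type _ := Path.Homotopic.Quotient a b

/-- The image of a path class under a continuous map, with prescribed end points. -/
def mapClass (f : C(Y, X)) {a b : Y} (γ : PathClass a b) {x y : X} (hx : f a = x) (hy : f b = y) :
    PathClass x y :=
  (γ.map f).cast hx.symm hy.symm

theorem mapClass_trans (f : C(Y, X)) {a b c : Y} (γ : PathClass a b) (γ' : PathClass b c) {x y z : X}
    (hx : f a = x) (hy : f b = y) (hz : f c = z) :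
    mapClass f (γ.trans γ') hx hz = (mapClass f γ hx hy).trans (mapClass f γ' hy hz) := by
  subst hx hy hz
  induction γ using Path.Homotopic.Quotient.ind with | _ γ
  induction γ' using Path.Homotopic.Quotient.ind with | _ γ'
  simp only [mapClass, Path.Homotopic.Quotient.cast_rfl_rfl]
  rw [← Path.Homotopic.Quotient.mk_trans, ← Path.Homotopic.Quotient.mk_map,
    ← Path.Homotopic.Quotient.mk_map, ← Path.Homotopic.Quotient.mk_map,
    ← Path.Homotopic.Quotient.mk_trans, Path.map_trans]

theorem mapClass_refl (f : C(Y, X)) (a : Y) {x : X} (hx : f a = x) :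
    mapClass f (.refl a) hx hx = .refl x := by
  subst hx; rfl

theorem mapClass_symm (f : C(Y, X)) {a b : Y} (γ : PathClass a b) {x y : X}
    (hx : f a = x) (hy : f b = y) :
    mapClass f γ.symm hy hx = (mapClass f γ hx hy).symm := by
  subst hx hy
  induction γ using Path.Homotopic.Quotient.ind with | _ γ
  rfl

theorem mapClass_id {a b : X} (γ : PathClass a b) : mapClass (.id X) γ rfl rfl = γ := by
  induction γ using Path.Homotopic.Quotient.ind with | _ γ
  rfl

theorem mapClass_comp {Z : Type*} [TopologicalSpace Z] (g : C(X, Z)) (f : C(Y, X)) {a b : Y}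
    (γ : PathClass a b) {x y : X} (hx : f a = x) (hy : f b = y) {z w : Z} (hz : g x = z)
    (hw : g y = w) :
    mapClass g (mapClass f γ hx hy) hz hw =
      mapClass (g.comp f) γ (by simp [hx, hz]) (by simp [hy, hw]) := by
  subst hx hy hz hw
  induction γ using Path.Homotopic.Quotient.ind with | _ γ
  rfl

/-- The value of a function of path classes on an unbundled path. -/
def onMaps (θ : ∀ a b : Y, PathClass a b → G) (γ : C(I, Y)) : G :=
  θ (γ 0) (γ 1) (.mk ⟨γ, rfl, rfl⟩)

theorem onMaps_path (θ : ∀ a b : Y, PathClass a b → G) {a b : Y} (γ : Path a b) :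
    onMaps θ γ.toContinuousMap = θ a b (.mk γ) := by
  have : ∀ (f : C(I, Y)) (a b : Y) (h0 : f 0 = a) (h1 : f 1 = b),
      θ (f 0) (f 1) (.mk ⟨f, rfl, rfl⟩) = θ a b (.mk ⟨f, h0, h1⟩) := by
    rintro f _ _ rfl rfl; rfl
  exact this _ _ _ γ.source γ.target

theorem _root_.Topology.IsOpenEmbedding.exists_lift {Z : Type*} [TopologicalSpace Z] {i : Y → X}
    (hi : IsOpenEmbedding i) (f : C(Z, X)) (hf : ∀ z, f z ∈ range i) :
    ∃ g : C(Z, Y), ∀ z, i (g z) = f z := by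
  choose g hg using hf
  refine ⟨⟨g, ?_⟩, hg⟩
  rw [hi.isInducing.continuous_iff]
  convert f.continuous
  exact funext hg

/-- Paths and homotopies with values in the open image lift uniquely to `Y`, where `θ` is already a
functor on path classes. -/
theorem isPathFunctionalOn_range [Group G] {i : C(Y, X)} (hi : IsOpenEmbedding i)
    {θ : ∀ a b : Y, PathClass a b → G}
    (hθ : ∀ a b c (γ : PathClass a b) (γ' : PathClass b c), θ a c (γ.trans γ') = θ b c γ' * θ a b γ)
    {Φ : C(I, X) → G} (hΦ : ∀ γ : C(I, Y), Φ (i.comp γ) = onMaps θ γ) :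
    IsPathFunctionalOn Φ (range i) := by
  have hlift : ∀ {a b : X} (γ : Path a b), (∀ t, γ t ∈ range i) → ∃ (a' b' : Y) (γ' : Path a' b'),
      i a' = a ∧ i b' = b ∧ ∀ t, i (γ' t) = γ t := by
    intro a b γ hγ
    obtain ⟨g, hg⟩ := hi.exists_lift γ.toContinuousMap hγ
    exact ⟨g 0, g 1, ⟨g, rfl, rfl⟩, (hg 0).trans γ.source, (hg 1).trans γ.target, hg⟩
  have hval : ∀ {a b : X} (γ : Path a b) {a' b' : Y} (γ' : Path a' b'), (∀ t, i (γ' t) = γ t) →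
      Φ γ.toContinuousMap = θ a' b' (.mk γ') := by
    intro a b γ a' b' γ' h
    have : γ.toContinuousMap = i.comp γ'.toContinuousMap := by ext t; exact (h t).symm
    rw [this, hΦ, onMaps_path]
  constructor
  · intro a b c γ γ' hγ hγ'
    obtain ⟨a', b', δ, rfl, rfl, h⟩ := hlift γ hγ
    obtain ⟨b'', c', δ', hb, rfl, h'⟩ := hlift γ' hγ'
    obtain rfl := hi.injective hb
    rw [hval γ δ h, hval γ' δ' h', hval _ (δ.trans δ'), Path.Homotopic.Quotient.mk_trans, hθ]
    intro t
    simp only [Path.trans_apply]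
    split_ifs
    · exact h _
    · exact h' _
  · intro a b γ γ' F hF
    obtain ⟨g, hg⟩ := hi.exists_lift F.toContinuousMap hF
    have hg0 : ∀ t, i (g (0, t)) = γ t := fun t => (hg _).trans (F.apply_zero t)
    have hg1 : ∀ t, i (g (1, t)) = γ' t := fun t => (hg _).trans (F.apply_one t)
    -- The lifted homotopy still fixes the end points, because `i` is injective.
    have hs : ∀ t, g (t, 0) = g (0, 0) := fun t => hi.injective <| by
      rw [hg, hg]; exact (F.source t).trans (F.source 0).symm
    have ht : ∀ t, g (t, 1) = g (0, 1) := fun t => hi.injective <| by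
      rw [hg, hg]; exact (F.target t).trans (F.target 0).symm
    let δ : Path (g (0, 0)) (g (0, 1)) := ⟨⟨fun t => g (0, t), by fun_prop⟩, rfl, rfl⟩
    let δ' : Path (g (0, 0)) (g (0, 1)) := ⟨⟨fun t => g (1, t), by fun_prop⟩, hs 1, ht 1⟩
    rw [hval γ δ hg0, hval γ' δ' hg1]
    congr 1
    refine Path.Homotopic.Quotient.eq.2 ⟨⟨⟨g, fun t => rfl, fun t => rfl⟩, ?_⟩⟩
    rintro t x (rfl | hx)
    · exact hs t
    · rw [mem_singleton_iff.1 hx]; exact ht t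

variable {U V : Type*} [TopologicalSpace U] [TopologicalSpace V]

/-- The van Kampen principle for two open pieces: the only thing to check is that the two functors
agree on paths lying in both. -/
theorem exists_functional_of_openEmbedding [Group G] {iU : C(U, X)} {iV : C(V, X)} (hU : IsOpenEmbedding iU)
    (hV : IsOpenEmbedding iV) (hcov : range iU ∪ range iV = univ)
    (θU : ∀ a b : U, PathClass a b → G) (θV : ∀ a b : V, PathClass a b → G)
    (hθU : ∀ a b c (γ : PathClass a b) (γ' : PathClass b c),
      θU a c (γ.trans γ') = θU b c γ' * θU a b γ)
    (hθV : ∀ a b c (γ : PathClass a b) (γ' : PathClass b c),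
      θV a c (γ.trans γ') = θV b c γ' * θV a b γ)
    (hagree : ∀ {a b : U} {c d : V} (γ : Path a b) (γ' : Path c d), (∀ t, iU (γ t) = iV (γ' t)) →
      θU a b (.mk γ) = θV c d (.mk γ')) :
    ∃ Ψ : ∀ a b : X, PathClass a b → G,
      (∀ a b c (γ : PathClass a b) (γ' : PathClass b c), Ψ a c (γ.trans γ') = Ψ b c γ' * Ψ a b γ) ∧
      (∀ a b (γ : PathClass a b) x y (hx : iU a = x) (hy : iU b = y),
        Ψ x y (mapClass iU γ hx hy) = θU a b γ) ∧
      (∀ a b (γ : PathClass a b) x y (hx : iV a = x) (hy : iV b = y),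
        Ψ x y (mapClass iV γ hx hy) = θV a b γ) := by
  classical
  -- A path in both images is evaluated in `U`, which is harmless by `hagree`; a path in neither
  -- gets the irrelevant value `1`.
  let Φ : C(I, X) → G := fun γ =>
    if h : ∃ γ' : C(I, U), iU.comp γ' = γ then onMaps θU h.choose
    else if h : ∃ γ' : C(I, V), iV.comp γ' = γ then onMaps θV h.choose else 1
  have injU : ∀ γ γ' : C(I, U), iU.comp γ = iU.comp γ' → γ = γ' := fun γ γ' h => by
    ext t; exact hU.injective (DFunLike.congr_fun h t)
  have injV : ∀ γ γ' : C(I, V), iV.comp γ = iV.comp γ' → γ = γ' := fun γ γ' h => by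
    ext t; exact hV.injective (DFunLike.congr_fun h t)
  have hΦU : ∀ γ, Φ (iU.comp γ) = onMaps θU γ := by
    intro γ
    have h : ∃ γ' : C(I, U), iU.comp γ' = iU.comp γ := ⟨γ, rfl⟩
    simp only [Φ, dif_pos h]
    rw [injU _ _ h.choose_spec]
  have hΦV : ∀ γ, Φ (iV.comp γ) = onMaps θV γ := by
    intro γ
    by_cases h : ∃ γ' : C(I, U), iU.comp γ' = iV.comp γ
    · obtain ⟨γ', h⟩ := h
      rw [← h, hΦU]
      exact hagree _ _ fun t => DFunLike.congr_fun h t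
    · have h' : ∃ γ' : C(I, V), iV.comp γ' = iV.comp γ := ⟨γ, rfl⟩
      simp only [Φ, dif_neg h, dif_pos h']
      rw [injV _ _ h'.choose_spec]
  obtain ⟨Ψ, hΨ, hloc⟩ := exists_functional_of_cover (Φ := Φ)
    (U := fun b : Bool => cond b (range iU) (range iV))
    (by rintro (_ | _); exacts [hV.isOpen_range, hU.isOpen_range])
    (by rw [← hcov, ← union_eq_iUnion])
    (by rintro (_ | _)
        exacts [isPathFunctionalOn_range hV hθV hΦV, isPathFunctionalOn_range hU hθU hΦU])
  refine ⟨Ψ, hΨ, ?_, ?_⟩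
  · rintro a b γ _ _ rfl rfl
    induction γ using Path.Homotopic.Quotient.ind with | _ γ
    refine (hloc _ _ (γ.map iU.continuous) true fun t => mem_range_self _).trans ?_
    rw [← onMaps_path θU, ← hΦU]
    rfl
  · rintro a b γ _ _ rfl rfl
    induction γ using Path.Homotopic.Quotient.ind with | _ γ
    refine (hloc _ _ (γ.map iV.continuous) false fun t => mem_range_self _).trans ?_
    rw [← onMaps_path θV, ← hΦV]
    rfl

theorem pathClass_induction_of_openEmbedding {iU : C(U, X)} {iV : C(V, X)}
    (hU : IsOpenEmbedding iU) (hV : IsOpenEmbedding iV) (hcov : range iU ∪ range iV = univ)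
    (P : ∀ a b : X, PathClass a b → Prop)
    (htrans : ∀ a b c (γ : PathClass a b) (γ' : PathClass b c),
      P a b γ → P b c γ' → P a c (γ.trans γ'))
    (hPU : ∀ a b (γ : PathClass a b), P _ _ (mapClass iU γ rfl rfl))
    (hPV : ∀ a b (γ : PathClass a b), P _ _ (mapClass iV γ rfl rfl))
    {a b : X} (γ : PathClass a b) : P a b γ := by
  refine pathClass_induction (U := fun b : Bool => cond b (range iU) (range iV))
    (by rintro (_ | _); exacts [hV.isOpen_range, hU.isOpen_range])
    (by rw [← hcov, ← union_eq_iUnion]) P htrans ?_ γ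
  rintro a b γ (_ | _) hγ
  · obtain ⟨g, hg⟩ := hV.exists_lift γ.toContinuousMap hγ
    obtain rfl : iV (g 0) = a := (hg 0).trans γ.source
    obtain rfl : iV (g 1) = b := (hg 1).trans γ.target
    have : γ = (⟨g, rfl, rfl⟩ : Path (g 0) (g 1)).map iV.continuous := by
      ext t; exact (hg t).symm
    rw [this]
    exact hPV _ _ (.mk ⟨g, rfl, rfl⟩)
  · obtain ⟨g, hg⟩ := hU.exists_lift γ.toContinuousMap hγ
    obtain rfl : iU (g 0) = a := (hg 0).trans γ.source
    obtain rfl : iU (g 1) = b := (hg 1).trans γ.target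
    have : γ = (⟨g, rfl, rfl⟩ : Path (g 0) (g 1)).map iU.continuous := by
      ext t; exact (hg t).symm
    rw [this]
    exact hPU _ _ (.mk ⟨g, rfl, rfl⟩)

end VanKampen

/-! ### The Seifert–van Kampen theorem with simply connected overlaps -/

section VanKampenTheorem

variable {X U V K S : Type*} [TopologicalSpace X] [TopologicalSpace U] [TopologicalSpace V]
  [TopologicalSpace K] [TopologicalSpace S]

/-- The restriction of a map on `K × S` to the slice `{k} × S`. -/
def slice (α : C(K × S, U)) (k : K) : C(S, U) := α.comp ⟨fun s => (k, s), by fun_prop⟩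

theorem slice_apply (α : C(K × S, U)) (k : K) (s : S) : slice α k s = α (k, s) := rfl

/-- A choice of path classes from a base point to all points of `U`, adapted to `α`. -/
structure AdaptedClasses (α : C(K × S, U)) (k₀ : K) (s₀ : S) (u₀ : U) where
  /-- the path class from the base point to a point -/
  cls : ∀ u, PathClass u₀ u
  /-- the path class from the base point to the base point of a slice -/
  base : ∀ k, PathClass u₀ (α (k, s₀))
  base_point : α (k₀, s₀) = u₀
  cls_base_point : cls u₀ = .refl u₀
  base_zero : base k₀ = (Path.Homotopic.Quotient.refl u₀).cast rfl base_point
  cls_base : ∀ k, cls (α (k, s₀)) = base k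
  cls_slice : ∀ k s (η : PathClass s₀ s), cls (α (k, s)) =
    (base k).trans (mapClass (slice α k) η (slice_apply α k s₀) (slice_apply α k s))

/-- A point of the overlap is reached through the base point of its slice and then inside the slice.
Injectivity of `α` makes the slice unique and simple connectivity of `S` makes the second part
unique, so the prescription is consistent; the remaining points get arbitrary classes. -/
theorem nonempty_adaptedClasses [SimplyConnectedSpace S] [PathConnectedSpace U] (α : C(K × S, U))
    (hα : Function.Injective α) (k₀ : K) (s₀ : S) {u₀ : U} (hu₀ : α (k₀, s₀) = u₀) :
    Nonempty (AdaptedClasses α k₀ s₀ u₀) := by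
  classical
  obtain ⟨p, hp⟩ : ∃ p : ∀ k, PathClass u₀ (α (k, s₀)),
      p k₀ = (Path.Homotopic.Quotient.refl u₀).cast rfl hu₀ :=
    ⟨Function.update (fun k => .mk (PathConnectedSpace.somePath _ _)) k₀
      ((Path.Homotopic.Quotient.refl u₀).cast rfl hu₀), by simp⟩
  have : ∀ u, ∃ r : PathClass u₀ u, ∀ k s (η : PathClass s₀ s) (h : α (k, s) = u),
      r = (p k).trans (mapClass (slice α k) η (slice_apply α k s₀)
        ((slice_apply α k s).trans h)) := by
    intro u
    by_cases h : ∃ x, α x = u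
    · obtain ⟨⟨k, s⟩, rfl⟩ := h
      refine ⟨(p k).trans (mapClass (slice α k) (.mk (PathConnectedSpace.somePath s₀ s))
        (slice_apply α k s₀) (slice_apply α k s)), fun k' s' η h => ?_⟩
      obtain ⟨rfl, rfl⟩ := Prod.ext_iff.1 (hα h)
      congr 2
      exact Subsingleton.elim _ _
    · exact ⟨.mk (PathConnectedSpace.somePath _ _), fun k s _ h' => (h ⟨_, h'⟩).elim⟩
  choose P hP using this
  have hPs : ∀ k, P (α (k, s₀)) = p k := fun k => by
    rw [hP _ k s₀ (.refl _) rfl, mapClass_refl]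
    exact Path.Homotopic.Quotient.trans_refl _
  refine ⟨⟨P, p, hu₀, ?_, hp, hPs, fun k s η => hP _ k s η rfl⟩⟩
  subst hu₀
  rw [hPs, hp, Path.Homotopic.Quotient.cast_rfl_rfl]

namespace AdaptedClasses

variable {α : C(K × S, U)} {k₀ : K} {s₀ : S} {u₀ : U}

/-- The loop obtained from a path class by joining its end points to the base point. -/
def loop (D : AdaptedClasses α k₀ s₀ u₀) {a b : U} (γ : PathClass a b) : FundamentalGroup U u₀ :=
  FundamentalGroup.fromPath (((D.cls a).trans γ).trans (D.cls b).symm)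

theorem loop_trans (D : AdaptedClasses α k₀ s₀ u₀) {a b c : U} (γ : PathClass a b)
    (γ' : PathClass b c) : D.loop (γ.trans γ') = D.loop γ' * D.loop γ := by
  rw [FundamentalGroup.mul_def]
  show ((D.cls a).trans (γ.trans γ')).trans (D.cls c).symm =
    (((D.cls a).trans γ).trans (D.cls b).symm).trans (((D.cls b).trans γ').trans (D.cls c).symm)
  grind

/-- The adapted classes of the end points absorb a path inside a slice. This is what makes the
functors on the two pieces agree on the overlap. -/
theorem loop_slice [SimplyConnectedSpace S] (D : AdaptedClasses α k₀ s₀ u₀) (k : K) {s s' : S}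
    (η : PathClass s s') :
    D.loop (mapClass (slice α k) η (slice_apply α k s) (slice_apply α k s')) = 1 := by
  let ζ : PathClass s₀ s := .mk (PathConnectedSpace.somePath s₀ s)
  show ((D.cls _).trans _).trans (D.cls _).symm = _
  rw [D.cls_slice k s ζ, D.cls_slice k s' (ζ.trans η),
    mapClass_trans (slice α k) ζ η _ (slice_apply α k s), FundamentalGroup.one_def,
    Path.Homotopic.Quotient.trans_assoc (D.base k)]
  exact Path.Homotopic.Quotient.trans_symm _

theorem loop_base_point (D : AdaptedClasses α k₀ s₀ u₀) (g : FundamentalGroup U u₀) :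
    D.loop (a := u₀) (b := u₀) g = g := by
  show ((D.cls u₀).trans g).trans (D.cls u₀).symm = g
  have e : (Path.Homotopic.Quotient.refl u₀).symm = .refl u₀ := rfl
  rw [D.cls_base_point, e, Path.Homotopic.Quotient.refl_trans, Path.Homotopic.Quotient.trans_refl]

theorem loop_base (D : AdaptedClasses α k₀ s₀ u₀) (k : K) : D.loop (D.base k) = 1 := by
  show ((D.cls u₀).trans (D.base k)).trans (D.cls _).symm = _
  rw [D.cls_base_point, D.cls_base, Path.Homotopic.Quotient.refl_trans]
  exact Path.Homotopic.Quotient.trans_symm _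

end AdaptedClasses

/-- The homomorphism of fundamental groups induced by a map with a prescribed image of the base
point. -/
def mapLoop (f : C(U, X)) {u₀ : U} {x₀ : X} (h : f u₀ = x₀) :
    FundamentalGroup U u₀ →* FundamentalGroup X x₀ where
  toFun γ := mapClass f γ h h
  map_one' := mapClass_refl _ _ _
  map_mul' γ γ' := mapClass_trans f (c := u₀) γ' γ h h h

variable {iU : C(U, X)} {iV : C(V, X)} {α : C(K × S, U)} {β : C(K × S, V)} {k₀ : K} {s₀ : S}
  {u₀ : U} {v₀ : V} {x₀ : X}

/-- The loop that runs through `V` to the `k`-th component of the intersection and returns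
through `U`. -/
def crossLoop (hαβ : ∀ x, iU (α x) = iV (β x)) (hu : iU u₀ = x₀) (hv : iV v₀ = x₀)
    (D : AdaptedClasses α k₀ s₀ u₀) (D' : AdaptedClasses β k₀ s₀ v₀) (k : K) :
    FundamentalGroup X x₀ :=
  (mapClass iV (D'.base k) hv rfl).trans (mapClass iU (D.base k) hu (hαβ (k, s₀))).symm

theorem crossLoop_zero (hαβ : ∀ x, iU (α x) = iV (β x)) (hu : iU u₀ = x₀) (hv : iV v₀ = x₀)
    (D : AdaptedClasses α k₀ s₀ u₀) (D' : AdaptedClasses β k₀ s₀ v₀) :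
    crossLoop hαβ hu hv D D' k₀ = 1 := by
  rw [crossLoop, D.base_zero, D'.base_zero]
  have : ∀ (u' : U) (v' : V) (h1 : u' = u₀) (h2 : v' = v₀) (h3 : iU u' = iV v'),
      (mapClass iV ((Path.Homotopic.Quotient.refl v₀).cast rfl h2) hv rfl).trans
        (mapClass iU ((Path.Homotopic.Quotient.refl u₀).cast rfl h1) hu h3).symm =
          Path.Homotopic.Quotient.refl x₀ := by
    rintro _ _ rfl rfl h3
    subst hv
    rw [Path.Homotopic.Quotient.cast_rfl_rfl, Path.Homotopic.Quotient.cast_rfl_rfl, mapClass_refl,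
      mapClass_refl]
    exact Path.Homotopic.Quotient.trans_symm _
  exact this _ _ D.base_point D'.base_point (hαβ _)

/-- Homomorphisms on the two pieces and values on the cross loops extend to the fundamental group
of the union. -/
theorem exists_hom_of_openEmbedding [DiscreteTopology K] [SimplyConnectedSpace S]
    (hU : IsOpenEmbedding iU) (hV : IsOpenEmbedding iV)
    (hcov : range iU ∪ range iV = univ)
    (hα : IsOpenEmbedding α) (hαβ : ∀ x, iU (α x) = iV (β x))
    (hmeet : ∀ u v, iU u = iV v → ∃ x, α x = u) (hu : iU u₀ = x₀) (hv : iV v₀ = x₀)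
    (D : AdaptedClasses α k₀ s₀ u₀) (D' : AdaptedClasses β k₀ s₀ v₀)
    {A : Type*} [Group A] (jU : FundamentalGroup U u₀ →* A) (jV : FundamentalGroup V v₀ →* A)
    (τ : K → A) (hτ₀ : τ k₀ = 1) :
    ∃ F : FundamentalGroup X x₀ →* A, (∀ g, F (mapLoop iU hu g) = jU g) ∧
      (∀ g, F (mapLoop iV hv g) = jV g) ∧ ∀ k, F (crossLoop hαβ hu hv D D' k) = τ k := by
  have hβ : Function.Injective β := fun x y h => hα.injective <| hU.injective <| by
    rw [hαβ, hαβ, h]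
  -- A change of base points on `V`, by `τ k` on the `k`-th overlap component and by `1` elsewhere.
  -- The factors cancel along paths inside one component, but they record the component through
  -- which a path from `v₀` leaves `V`.
  have hlam : ∀ v, ∃ g : A, ∀ k s, β (k, s) = v → g = τ k := by
    intro v
    by_cases h : ∃ x, β x = v
    · obtain ⟨⟨k, s⟩, rfl⟩ := h
      exact ⟨τ k, fun k' s' h => by obtain ⟨rfl, rfl⟩ := Prod.ext_iff.1 (hβ h); rfl⟩
    · exact ⟨1, fun k s h' => (h ⟨_, h'⟩).elim⟩
  choose lam hlam using hlam
  have hlamk : ∀ k s, lam (β (k, s)) = τ k := fun k s => hlam _ k s rfl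
  have hlam₀ : lam v₀ = 1 := by rw [← D'.base_point, hlamk, hτ₀]
  obtain ⟨Ψ, hΨ, hΨU, hΨV⟩ := exists_functional_of_openEmbedding (G := A) hU hV hcov
    (fun a b γ => jU (D.loop γ)) (fun a b γ => lam b * jV (D'.loop γ) * (lam a)⁻¹)
    (fun a b c γ γ' => by rw [D.loop_trans, map_mul])
    (fun a b c γ γ' => by rw [D'.loop_trans, map_mul]; group)
    (by
      intro a b c d γ γ' h
      obtain ⟨η, hη⟩ := hα.exists_lift γ.toContinuousMap fun t => hmeet _ _ (h t)
      -- A path in the overlap stays in one slice because `K` is discrete.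
      obtain ⟨k, hk⟩ : ∃ k, ∀ t, (η t).1 = k := ⟨(η 0).1, fun t =>
        isPreconnected_univ.constant (continuous_fst.comp η.continuous).continuousOn
          (mem_univ t) (mem_univ 0)⟩
      let ζ : Path (η 0).2 (η 1).2 := ⟨⟨fun t => (η t).2, by fun_prop⟩, rfl, rfl⟩
      have hζ : ∀ t, η t = (k, ζ t) := fun t => Prod.ext (hk t) rfl
      have e1 : ∀ t, α (k, ζ t) = γ t := fun t => by rw [← hζ]; exact hη t
      have e2 : ∀ t, β (k, ζ t) = γ' t := fun t => hV.injective <| by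
        rw [← hαβ, e1, h]
      obtain rfl : α (k, (η 0).2) = a := by have := e1 0; rwa [ζ.source, γ.source] at this
      obtain rfl : α (k, (η 1).2) = b := by have := e1 1; rwa [ζ.target, γ.target] at this
      obtain rfl : β (k, (η 0).2) = c := by have := e2 0; rwa [ζ.source, γ'.source] at this
      obtain rfl : β (k, (η 1).2) = d := by have := e2 1; rwa [ζ.target, γ'.target] at this
      have f1 : Path.Homotopic.Quotient.mk γ = mapClass (slice α k) (.mk ζ)
          (slice_apply _ _ _) (slice_apply _ _ _) := by
        have : γ = ζ.map (slice α k).continuous := by ext t; exact (e1 t).symm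
        rw [this]; rfl
      have f2 : Path.Homotopic.Quotient.mk γ' = mapClass (slice β k) (.mk ζ)
          (slice_apply _ _ _) (slice_apply _ _ _) := by
        have : γ' = ζ.map (slice β k).continuous := by ext t; exact (e2 t).symm
        rw [this]; rfl
      rw [f1, f2, D.loop_slice, D'.loop_slice, hlamk, hlamk]
      simp only [map_one, mul_one, mul_inv_cancel])
  have hΨ1 : ∀ x, Ψ x x (.refl x) = 1 := fun x => by
    have := hΨ x x x (.refl x) (.refl x)
    rw [Path.Homotopic.Quotient.refl_trans] at this
    exact mul_eq_left.1 this.symm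
  have hΨsymm : ∀ x y (γ : PathClass x y), Ψ y x γ.symm = (Ψ x y γ)⁻¹ := fun x y γ => by
    have := hΨ x y x γ γ.symm
    rw [Path.Homotopic.Quotient.trans_symm, hΨ1] at this
    exact eq_inv_of_mul_eq_one_left this.symm
  refine ⟨{ toFun := fun γ => Ψ x₀ x₀ γ
            map_one' := hΨ1 x₀
            map_mul' := fun γ γ' => hΨ _ _ _ γ' γ }, fun g => ?_, fun g => ?_, fun k => ?_⟩
  · refine (hΨU _ _ g _ _ hu hu).trans (congrArg jU (D.loop_base_point g))
  · refine (hΨV _ _ g _ _ hv hv).trans ?_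
    have := D'.loop_base_point g
    rw [this, hlam₀]
    simp
  · show Ψ _ _ ((mapClass iV (D'.base k) hv rfl).trans
      (mapClass iU (D.base k) hu (hαβ (k, s₀))).symm) = τ k
    rw [hΨ, hΨsymm, hΨU, hΨV, hlamk, hlam₀, D.loop_base, D'.loop_base]
    simp only [map_one, mul_one, inv_one, one_mul]

/-- The fundamental group of the union is generated by those of the two pieces and the cross
loops. -/
theorem mem_of_openEmbedding [PathConnectedSpace S] (hU : IsOpenEmbedding iU)
    (hV : IsOpenEmbedding iV)
    (hcov : range iU ∪ range iV = univ) (hαβ : ∀ x, iU (α x) = iV (β x))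
    (hmeet : ∀ u v, iU u = iV v → ∃ x, α x = u) (hu : iU u₀ = x₀) (hv : iV v₀ = x₀)
    (D : AdaptedClasses α k₀ s₀ u₀) (D' : AdaptedClasses β k₀ s₀ v₀)
    (H : Subgroup (FundamentalGroup X x₀)) (hHU : ∀ g, mapLoop iU hu g ∈ H)
    (hHV : ∀ g, mapLoop iV hv g ∈ H) (hHk : ∀ k, crossLoop hαβ hu hv D D' k ∈ H)
    (γ : FundamentalGroup X x₀) : γ ∈ H := by
  -- `T x r` says that `r` is an element of `H` followed by the adapted class of `x` in `U` or in
  -- `V`. On the overlap the two forms differ by a cross loop, which lies in `H`; therefore every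
  -- path class preserves `T`.
  let T : ∀ x, PathClass x₀ x → Prop := fun x r =>
    (∃ u, ∃ hx : iU u = x, ∃ g ∈ H, r = Path.Homotopic.Quotient.trans g
      (mapClass iU (D.cls u) hu hx)) ∨
    (∃ v, ∃ hx : iV v = x, ∃ g ∈ H, r = Path.Homotopic.Quotient.trans g
      (mapClass iV (D'.cls v) hv hx))
  have hconv : ∀ k s x (hx : iU (α (k, s)) = x) (hx' : iV (β (k, s)) = x),
      mapClass iV (D'.cls (β (k, s))) hv hx' =
        Path.Homotopic.Quotient.trans (crossLoop hαβ hu hv D D' k)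
          (mapClass iU (D.cls (α (k, s))) hu hx) := by
    rintro k s x hx rfl
    let ζ : PathClass s₀ s := .mk (PathConnectedSpace.somePath s₀ s)
    rw [D.cls_slice k s ζ, D'.cls_slice k s ζ, mapClass_trans iV (y := iV (β (k, s₀))) _ _ _ rfl,
      mapClass_trans iU (y := iV (β (k, s₀))) _ _ _ (hαβ _), mapClass_comp, mapClass_comp]
    have e : ∀ (f g : C(S, X)) (_ : f = g) (y z : X) h1 h2 h3 h4,
      mapClass f ζ (x := y) (y := z) h1 h2 = mapClass g ζ h3 h4 := by
      rintro f _ rfl y z _ _ _ _; rfl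
    rw [e (iV.comp (slice β k)) (iU.comp (slice α k)) (by ext s; exact (hαβ _).symm) _ _ _ _
      (hαβ _) hx]
    show _ = Path.Homotopic.Quotient.trans (Path.Homotopic.Quotient.trans _
      (Path.Homotopic.Quotient.symm _)) _
    generalize mapClass iU (D.base k) hu _ = B
    rw [Path.Homotopic.Quotient.trans_assoc,
      ← Path.Homotopic.Quotient.trans_assoc (Path.Homotopic.Quotient.symm B),
      Path.Homotopic.Quotient.symm_trans, Path.Homotopic.Quotient.refl_trans]
  have hTU : ∀ u r, T (iU u) r → ∃ g ∈ H, r = Path.Homotopic.Quotient.trans g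
      (mapClass iU (D.cls u) hu rfl) := by
    rintro u r (⟨u', hx, g, hg, hr⟩ | ⟨v, hx, g, hg, hr⟩)
    · obtain rfl := hU.injective hx
      exact ⟨g, hg, hr⟩
    · obtain ⟨⟨k, s⟩, rfl⟩ := hmeet u v hx.symm
      obtain rfl : v = β (k, s) := hV.injective (hx.trans (hαβ _))
      refine ⟨crossLoop hαβ hu hv D D' k * g, H.mul_mem (hHk k) hg, ?_⟩
      rw [hr, hconv k s _ rfl hx, FundamentalGroup.mul_def]
      exact (Path.Homotopic.Quotient.trans_assoc _ _ _).symm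
  have hTV : ∀ v r, T (iV v) r → ∃ g ∈ H, r = Path.Homotopic.Quotient.trans g
      (mapClass iV (D'.cls v) hv rfl) := by
    rintro v r (⟨u, hx, g, hg, hr⟩ | ⟨v', hx, g, hg, hr⟩)
    · obtain ⟨⟨k, s⟩, rfl⟩ := hmeet u v hx
      obtain rfl : v = β (k, s) := hV.injective (hx.symm.trans (hαβ _))
      refine ⟨(crossLoop hαβ hu hv D D' k)⁻¹ * g, H.mul_mem (H.inv_mem (hHk k)) hg, ?_⟩
      rw [hr, hconv k s _ hx rfl]
      generalize crossLoop hαβ hu hv D D' k = L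
      show Path.Homotopic.Quotient.trans _ _ = Path.Homotopic.Quotient.trans
        (Path.Homotopic.Quotient.trans g (Path.Homotopic.Quotient.symm L))
        (Path.Homotopic.Quotient.trans L _)
      rw [Path.Homotopic.Quotient.trans_assoc,
        ← Path.Homotopic.Quotient.trans_assoc (Path.Homotopic.Quotient.symm L),
        Path.Homotopic.Quotient.symm_trans, Path.Homotopic.Quotient.refl_trans]
    · obtain rfl := hV.injective hx
      exact ⟨g, hg, hr⟩
  have hall : ∀ {x y} (γ : PathClass x y), ∀ r, T x r → T y (r.trans γ) := by
    refine pathClass_induction_of_openEmbedding hU hV hcov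
      (fun x y γ => ∀ r, T x r → T y (r.trans γ)) ?_ ?_ ?_
    · intro a b c γ γ' h h' r hr
      rw [← Path.Homotopic.Quotient.trans_assoc]
      exact h' _ (h _ hr)
    · intro a b γ r hr
      obtain ⟨g, hg, rfl⟩ := hTU _ _ hr
      refine Or.inl ⟨b, rfl, mapLoop iU hu (D.loop γ) * g, H.mul_mem (hHU _) hg, ?_⟩
      show _ = Path.Homotopic.Quotient.trans (Path.Homotopic.Quotient.trans g
        (mapClass iU (((D.cls a).trans γ).trans (D.cls b).symm) hu hu)) _
      rw [mapClass_trans iU _ _ hu rfl hu, mapClass_trans iU _ _ hu rfl rfl,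
        mapClass_symm iU _ hu rfl]
      grind
    · intro a b γ r hr
      obtain ⟨g, hg, rfl⟩ := hTV _ _ hr
      refine Or.inr ⟨b, rfl, mapLoop iV hv (D'.loop γ) * g, H.mul_mem (hHV _) hg, ?_⟩
      show _ = Path.Homotopic.Quotient.trans (Path.Homotopic.Quotient.trans g
        (mapClass iV (((D'.cls a).trans γ).trans (D'.cls b).symm) hv hv)) _
      rw [mapClass_trans iV _ _ hv rfl hv, mapClass_trans iV _ _ hv rfl rfl,
        mapClass_symm iV _ hv rfl]
      grind
  subst hu
  have h0 : T (iU u₀) (.refl (iU u₀)) := Or.inl ⟨u₀, rfl, 1, H.one_mem, by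
    rw [D.cls_base_point, mapClass_refl]
    exact (Path.Homotopic.Quotient.refl_trans _).symm⟩
  have h1 := hall (x := iU u₀) (y := iU u₀) γ _ h0
  rw [Path.Homotopic.Quotient.refl_trans] at h1
  obtain ⟨g, hg, hγ⟩ := hTU u₀ _ h1
  rw [D.cls_base_point, mapClass_refl, Path.Homotopic.Quotient.trans_refl] at hγ
  rwa [hγ]

/-- The **Seifert–van Kampen theorem** for two path connected open sets whose intersection has
simply connected components, indexed by `K`. -/
theorem nonempty_fundamentalGroup_mulEquiv_coprod [DiscreteTopology K] [SimplyConnectedSpace S]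
    [PathConnectedSpace U] [PathConnectedSpace V]
    (hU : IsOpenEmbedding iU) (hV : IsOpenEmbedding iV)
    (hcov : range iU ∪ range iV = univ)
    (hα : IsOpenEmbedding α) (hαβ : ∀ x, iU (α x) = iV (β x))
    (hmeet : ∀ u v, iU u = iV v → ∃ x, α x = u) (k₀ : K) (x : X) (u : U) (v : V) :
    Nonempty (FundamentalGroup X x ≃*
      Monoid.Coprod (Monoid.Coprod (FundamentalGroup U u) (FundamentalGroup V v))
        (FreeGroup {k // k ≠ k₀})) := by
  classical
  obtain ⟨s₀⟩ : Nonempty S := inferInstance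
  have hβ : Function.Injective β := fun x y h => hα.injective <| hU.injective <| by
    rw [hαβ, hαβ, h]
  obtain ⟨D⟩ := nonempty_adaptedClasses α hα.injective k₀ s₀ rfl
  obtain ⟨D'⟩ := nonempty_adaptedClasses β hβ k₀ s₀ rfl
  have hv : iV (β (k₀, s₀)) = iU (α (k₀, s₀)) := (hαβ _).symm
  have : PathConnectedSpace X := by
    rw [pathConnectedSpace_iff_univ, ← hcov]
    exact (isPathConnected_range iU.continuous).union (isPathConnected_range iV.continuous)
      ⟨_, mem_range_self _, _, hv⟩
  suffices Nonempty (FundamentalGroup X (iU (α (k₀, s₀))) ≃*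
      Monoid.Coprod (Monoid.Coprod (FundamentalGroup U (α (k₀, s₀)))
        (FundamentalGroup V (β (k₀, s₀)))) (FreeGroup {k // k ≠ k₀})) by
    obtain ⟨e⟩ := this
    exact ⟨(FundamentalGroup.fundamentalGroupMulEquivOfPathConnected _ _).trans <| e.trans <|
      MulEquiv.coprodCongr (MulEquiv.coprodCongr
        (FundamentalGroup.fundamentalGroupMulEquivOfPathConnected _ _)
        (FundamentalGroup.fundamentalGroupMulEquivOfPathConnected _ _)) (MulEquiv.refl _)⟩
  -- The cross loop of `k₀` is trivial, so only the other components contribute free generators.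
  let τ : K → Monoid.Coprod (Monoid.Coprod (FundamentalGroup U (α (k₀, s₀)))
      (FundamentalGroup V (β (k₀, s₀)))) (FreeGroup {k // k ≠ k₀}) := fun k =>
    if h : k = k₀ then 1 else Monoid.Coprod.inr (FreeGroup.of ⟨k, h⟩)
  obtain ⟨F, hFU, hFV, hFk⟩ := exists_hom_of_openEmbedding hU hV hcov hα hαβ hmeet rfl hv D D'
    (Monoid.Coprod.inl.comp Monoid.Coprod.inl) (Monoid.Coprod.inl.comp Monoid.Coprod.inr) τ
    (by simp [τ])
  let Θ := Monoid.Coprod.lift (Monoid.Coprod.lift (mapLoop iU rfl) (mapLoop iV hv))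
    (FreeGroup.lift fun k : {k // k ≠ k₀} => crossLoop hαβ rfl hv D D' k)
  have hΘ₁ : ∀ x, Θ (F x) = x := by
    intro x
    refine mem_of_openEmbedding hU hV hcov hαβ hmeet rfl hv D D'
      ((Θ.comp F).eqLocus (MonoidHom.id _)) (fun g => ?_) (fun g => ?_) (fun k => ?_) x
    · show Θ (F _) = _
      rw [hFU]; simp [Θ]
    · show Θ (F _) = _
      rw [hFV]; simp [Θ]
    · show Θ (F _) = _
      rw [hFk]
      by_cases h : k = k₀
      · subst h
        simp [τ, crossLoop_zero]
      · simp [τ, h, Θ]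
  have hΘ₂ : F.comp Θ = MonoidHom.id _ := by
    refine Monoid.Coprod.hom_ext (Monoid.Coprod.hom_ext ?_ ?_) (FreeGroup.ext_hom _ _ ?_)
    · ext g
      simp [Θ, hFU]
    · ext g
      simp [Θ, hFV]
    · rintro ⟨k, hk⟩
      simp [Θ, hFk, τ, hk]
  exact ⟨{ F with invFun := Θ, left_inv := hΘ₁, right_inv := DFunLike.congr_fun hΘ₂ }⟩

end VanKampenTheorem

/-! ### Simple connectivity of the sphere -/

section SimplyConnected

variable {X U V S : Type*} [TopologicalSpace X] [TopologicalSpace U] [TopologicalSpace V]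
  [TopologicalSpace S]

theorem nonempty_adaptedClasses_of_simplyConnectedSpace {K : Type*} [TopologicalSpace K]
    [SimplyConnectedSpace U] (α : C(K × S, U)) (k₀ : K) (s₀ : S) :
    Nonempty (AdaptedClasses α k₀ s₀ (α (k₀, s₀))) :=
  ⟨{ cls := fun u => .mk (PathConnectedSpace.somePath _ _)
     base := fun k => .mk (PathConnectedSpace.somePath _ _)
     base_point := rfl
     cls_base_point := Subsingleton.elim _ _
     base_zero := Subsingleton.elim _ _
     cls_base := fun _ => Subsingleton.elim _ _
     cls_slice := fun _ _ _ => Subsingleton.elim _ _ }⟩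

/-- A space covered by two simply connected open sets with path connected intersection is
simply connected. -/
theorem simplyConnectedSpace_of_openEmbedding [SimplyConnectedSpace U] [SimplyConnectedSpace V]
    [PathConnectedSpace S] {iU : C(U, X)} {iV : C(V, X)} (hU : IsOpenEmbedding iU)
    (hV : IsOpenEmbedding iV) (hcov : range iU ∪ range iV = univ) (α : C(S, U)) (β : C(S, V))
    (hαβ : ∀ x, iU (α x) = iV (β x)) (hmeet : ∀ u v, iU u = iV v → ∃ x, α x = u) :
    SimplyConnectedSpace X := by
  obtain ⟨s₁⟩ : Nonempty S := inferInstance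
  have : PathConnectedSpace X := by
    rw [pathConnectedSpace_iff_univ, ← hcov]
    exact (isPathConnected_range iU.continuous).union (isPathConnected_range iV.continuous)
      ⟨_, mem_range_self (α s₁), _, (hαβ s₁).symm⟩
  -- Only the generation half of van Kampen is used, with a single slice and `H = ⊥`; it asks for no
  -- more than path connectedness of `S`.
  let α' : C(Unit × S, U) := α.comp ⟨Prod.snd, by fun_prop⟩
  let β' : C(Unit × S, V) := β.comp ⟨Prod.snd, by fun_prop⟩
  have htriv : ∀ γ : FundamentalGroup X (iU (α s₁)), γ = 1 := by
    intro γ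
    obtain ⟨D⟩ := nonempty_adaptedClasses_of_simplyConnectedSpace α' () s₁
    obtain ⟨D'⟩ := nonempty_adaptedClasses_of_simplyConnectedSpace β' () s₁
    refine Subgroup.mem_bot.1 <| mem_of_openEmbedding (α := α') (β := β') hU hV hcov
      (fun x => hαβ _) (fun u v h => ?_) rfl (hαβ s₁).symm D D' ⊥ (fun g => ?_) (fun g => ?_)
      (fun k => ?_) γ
    · obtain ⟨x, hx⟩ := hmeet u v h
      exact ⟨((), x), hx⟩
    · rw [Subsingleton.elim g 1, map_one]; exact Subgroup.one_mem _
    · rw [Subsingleton.elim g 1, map_one]; exact Subgroup.one_mem _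
    · rw [Subsingleton.elim k (), crossLoop_zero]; exact Subgroup.one_mem _
  rw [simply_connected_iff_loops_nullhomotopic]
  refine ⟨this, fun x γ => ?_⟩
  have e := FundamentalGroup.fundamentalGroupMulEquivOfPathConnected x (iU (α s₁))
  have h1 : (FundamentalGroup.fromPath (.mk γ) : FundamentalGroup X x) = 1 :=
    e.injective ((htriv _).trans (htriv _).symm)
  exact Path.Homotopic.Quotient.exact h1

instance simplyConnectedSpace_prod [SimplyConnectedSpace U] [SimplyConnectedSpace V] :
    SimplyConnectedSpace (U × V) := by
  rw [simply_connected_iff_paths_homotopic]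
  refine ⟨inferInstance, ?_⟩
  rintro ⟨a, b⟩ ⟨c, d⟩
  refine ⟨fun p q => ?_⟩
  rw [← Path.Homotopic.prod_projLeft_projRight p, ← Path.Homotopic.prod_projLeft_projRight q]
  congr 1 <;> exact Subsingleton.elim _ _

theorem finrank_E3 : Module.finrank ℝ E3 = 3 := by simp

theorem one_lt_rank_orthogonal (v : S2) :
    1 < Module.rank ℝ (ℝ ∙ (v : E3))ᗮ := by
  have h : Module.finrank ℝ (ℝ ∙ (v : E3))ᗮ = 2 := by
    have : Fact (Module.finrank ℝ E3 = 2 + 1) := ⟨by simp⟩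
    exact Submodule.finrank_orthogonal_span_singleton (by
      intro h; have := norm_eq_of_mem_sphere v; rw [h] at this; simp at this)
  rw [← Module.finrank_eq_rank, h]
  norm_num

/-- Two stereographic charts with antipodal poles cover the sphere, and they overlap in a plane
without a point, which is path connected. -/
instance simplyConnectedSpace_S2 : SimplyConnectedSpace S2 := by
  let v : S2 := ⟨EuclideanSpace.single 0 1, by simp⟩
  have hv := norm_eq_of_mem_sphere v
  have hv' := norm_eq_of_mem_sphere (-v)
  let P := (ℝ ∙ (v : E3))ᗮ
  let iU : C(P, S2) := ⟨(stereographic hv).symm, (isOpenEmbedding_stereographic_symm hv).continuous⟩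
  let iV : C((ℝ ∙ ((-v : S2) : E3))ᗮ, S2) := ⟨(stereographic hv').symm,
    (isOpenEmbedding_stereographic_symm hv').continuous⟩
  have hrU : range iU = {v}ᶜ := range_stereographic_symm hv
  have hrV : range iV = {-v}ᶜ := range_stereographic_symm hv'
  have hneg : v ≠ -v := by
    intro h
    have := congrArg (fun x : S2 => (x : E3) 0) h
    simp [v] at this
    norm_num at this
  have : PathConnectedSpace ({0}ᶜ : Set P) := isPathConnected_iff_pathConnectedSpace.1
    (isPathConnected_compl_singleton_of_one_lt_rank (one_lt_rank_orthogonal v) 0)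
  have hU0 : iU 0 = -v := by
    have := stereographic_apply_neg v
    show (stereographic hv).symm 0 = -v
    rw [← this]
    exact (stereographic hv).left_inv (by
      rw [stereographic_source]; exact fun h => hneg (mem_singleton_iff.1 h).symm)
  have hinjU : Function.Injective iU := (isOpenEmbedding_stereographic_symm hv).injective
  let β : C(({0}ᶜ : Set P), (ℝ ∙ ((-v : S2) : E3))ᗮ) :=
    ⟨fun u => stereographic hv' (iU u), by
      refine (stereographic hv').continuousOn.comp_continuous (by fun_prop) fun u => ?_
      rw [stereographic_source]
      intro h
      exact u.2 (hinjU (h.trans hU0.symm))⟩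
  refine simplyConnectedSpace_of_openEmbedding (iU := iU) (iV := iV)
    (isOpenEmbedding_stereographic_symm hv) (isOpenEmbedding_stereographic_symm hv') ?_
    (⟨Subtype.val, continuous_subtype_val⟩ : C(({0}ᶜ : Set P), P)) β ?_ ?_
  · rw [hrU, hrV, ← compl_inter, singleton_inter_eq_empty.2 (by simpa using hneg), compl_empty]
  · intro u
    refine ((stereographic hv').left_inv ?_).symm
    rw [stereographic_source]
    intro h
    exact u.2 (hinjU (h.trans hU0.symm))
  · intro u w h
    refine ⟨⟨u, fun h0 => ?_⟩, rfl⟩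
    rw [mem_singleton_iff] at h0
    have h1 : iV w ∈ range iV := mem_range_self w
    rw [← h, h0, hU0, hrV] at h1
    exact h1 rfl

theorem isOpenEmbedding_of_slices {K : Type*} [TopologicalSpace K] [DiscreteTopology K]
    {f : K × S → X} (hf : Function.Injective f) (hk : ∀ k, IsOpenEmbedding fun s => f (k, s)) :
    IsOpenEmbedding f := by
  refine IsOpenEmbedding.of_continuous_injective_isOpenMap ?_ hf ?_
  · rw [continuous_prod_of_discrete_left]
    exact fun k => (hk k).continuous
  · intro W hW
    have : f '' W = ⋃ k, (fun s => f (k, s)) '' ((fun s => (k, s)) ⁻¹' W) := by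
      ext x
      simp only [mem_image, mem_iUnion, mem_preimage, Prod.exists]
    rw [this]
    exact isOpen_iUnion fun k => (hk k).isOpenMap _ (hW.preimage (by fun_prop))

end SimplyConnected

/-! ### Fundamental groups of the circle and of products -/

section CircleGroup

/-- A trivial group. -/
def mulEquivPUnit (G : Type*) [Group G] [Subsingleton G] : G ≃* PUnit.{1} where
  toFun _ := .unit
  invFun _ := 1
  left_inv _ := Subsingleton.elim _ _
  right_inv _ := rfl
  map_mul' _ _ := rfl

/-- The free product with a trivial group. -/
def coprodSubsingleton (G H : Type*) [Group G] [Group H] [Subsingleton H] :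
    Monoid.Coprod G H ≃* G :=
  (MulEquiv.coprodCongr (MulEquiv.refl _) (mulEquivPUnit _)).trans (MulEquiv.coprodPUnit _)

instance simplyConnectedSpace_Ioo (a b : ℝ) [h : Fact (a < b)] :
    SimplyConnectedSpace (Ioo a b) := by
  have : ContractibleSpace (Ioo a b) :=
    (convex_Ioo a b).contractibleSpace (nonempty_Ioo.2 h.out)
  infer_instance

theorem isOpenEmbedding_circleExp {a b : ℝ} (h : b - a ≤ 2 * Real.pi) :
    IsOpenEmbedding fun t : Ioo a b => Circle.exp t := by
  refine IsOpenEmbedding.of_continuous_injective_isOpenMap (by fun_prop) ?_ ?_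
  · intro s t hst
    exact Subtype.ext (Circle.exp_injOn_Ioc h (Ioo_subset_Ioc_self s.2)
      (Ioo_subset_Ioc_self t.2) hst)
  · exact isLocalHomeomorph_circleExp.isOpenMap.comp isOpen_Ioo.isOpenMap_subtype_val

/-- The arcs `(-π, π)` and `(0, 2π)` are simply connected and meet in two arcs, the second of which
provides the single free generator. -/
theorem nonempty_fundamentalGroup_circle_mulEquiv (a : Circle) :
    Nonempty (FundamentalGroup Circle a ≃* Multiplicative ℤ) := by
  have hpi := Real.pi_pos
  have : Fact (-Real.pi < Real.pi) := ⟨by linarith⟩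
  have : Fact (0 < 2 * Real.pi) := ⟨by linarith⟩
  have : Fact (0 < Real.pi) := ⟨by linarith⟩
  let iU : C(Ioo (-Real.pi) Real.pi, Circle) := ⟨fun t => Circle.exp t, by fun_prop⟩
  let iV : C(Ioo 0 (2 * Real.pi), Circle) := ⟨fun t => Circle.exp t, by fun_prop⟩
  -- `true` is the upper half circle, with the same angle in both arcs; `false` is the lower one,
  -- where the two angles differ by `2π`.
  let α : C(Bool × Ioo 0 Real.pi, Ioo (-Real.pi) Real.pi) :=
    ⟨fun x => cond x.1 ⟨x.2, by have := x.2.2; constructor <;> linarith [this.1, this.2]⟩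
      ⟨x.2 - Real.pi, by have := x.2.2; constructor <;> linarith [this.1, this.2]⟩, by
      rw [continuous_prod_of_discrete_left]
      rintro (_ | _) <;> dsimp <;> fun_prop⟩
  let β : C(Bool × Ioo 0 Real.pi, Ioo 0 (2 * Real.pi)) :=
    ⟨fun x => cond x.1 ⟨x.2, by have := x.2.2; constructor <;> linarith [this.1, this.2]⟩
      ⟨x.2 + Real.pi, by have := x.2.2; constructor <;> linarith [this.1, this.2]⟩, by
      rw [continuous_prod_of_discrete_left]
      rintro (_ | _) <;> dsimp <;> fun_prop⟩
  have hU : IsOpenEmbedding iU := isOpenEmbedding_circleExp (by linarith)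
  have hV : IsOpenEmbedding iV := isOpenEmbedding_circleExp (by linarith)
  have hexp : ∀ t : ℝ, Circle.exp (t - Real.pi) = Circle.exp (t + Real.pi) := fun t => by
    rw [← Circle.exp_sub_two_pi (t + Real.pi)]; congr 1; ring
  have hcov : range iU ∪ range iV = univ := by
    rw [eq_univ_iff_forall]
    intro z
    by_cases hz : Complex.arg z = Real.pi
    · right
      refine ⟨⟨Real.pi, by constructor <;> linarith⟩, ?_⟩
      show Circle.exp Real.pi = z
      rw [← hz]; exact Circle.exp_arg z
    · left
      exact ⟨⟨Complex.arg z, Complex.neg_pi_lt_arg _, lt_of_le_of_ne (Complex.arg_le_pi _) hz⟩,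
        Circle.exp_arg z⟩
  have hα : IsOpenEmbedding α := by
    refine isOpenEmbedding_of_slices ?_ ?_
    · rintro ⟨_ | _, s⟩ ⟨_ | _, t⟩ h
      all_goals
        have h' := congrArg Subtype.val h
        have hs := s.2
        have ht := t.2
        simp [α] at h'
        try (exfalso; linarith [hs.1, hs.2, ht.1, ht.2])
        try (rw [Subtype.ext h'])
    · rintro (_ | _)
      · refine .of_comp _ isOpen_Ioo.isOpenEmbedding_subtypeVal ?_
        exact (Homeomorph.subRight Real.pi).isOpenEmbedding.comp
          isOpen_Ioo.isOpenEmbedding_subtypeVal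
      · refine .of_comp _ isOpen_Ioo.isOpenEmbedding_subtypeVal ?_
        exact isOpen_Ioo.isOpenEmbedding_subtypeVal
  have hαβ : ∀ x, iU (α x) = iV (β x) := by
    rintro ⟨_ | _, t⟩
    · exact hexp t
    · rfl
  have hmeet : ∀ u v, iU u = iV v → ∃ x, α x = u := by
    rintro ⟨u, hu⟩ ⟨v, hv⟩ h
    have h' : Circle.exp u = Circle.exp v := h
    obtain ⟨m, hm⟩ := Circle.exp_eq_exp.1 h'
    have hu0 : u ≠ 0 := by
      rintro rfl
      have h1 : (-1 : ℝ) < m := by nlinarith [hv.1, hv.2]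
      have h2 : (m : ℝ) < 0 := by nlinarith [hv.1, hv.2]
      have h1' : (-1 : ℤ) < m := by exact_mod_cast h1
      have h2' : m < 0 := by exact_mod_cast h2
      omega
    rcases lt_or_gt_of_ne hu0 with h0 | h0
    · exact ⟨(false, ⟨u + Real.pi, by linarith [hu.1], by linarith⟩), by
        apply Subtype.ext; simp [α]⟩
    · exact ⟨(true, ⟨u, h0, hu.2⟩), rfl⟩
  obtain ⟨e⟩ := nonempty_fundamentalGroup_mulEquiv_coprod hU hV hcov hα hαβ hmeet true a
    ⟨0, by constructor <;> linarith⟩ ⟨Real.pi, by constructor <;> linarith⟩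
  let : Unique {k : Bool // k ≠ true} := ⟨⟨⟨false, by simp⟩⟩, by
    rintro ⟨_ | _, h⟩; exacts [rfl, (h rfl).elim]⟩
  exact ⟨e.trans <| (MulEquiv.coprodCongr ((coprodSubsingleton _ _).trans (mulEquivPUnit _))
    FreeGroup.mulEquivIntOfUnique).trans (MulEquiv.punitCoprod _)⟩

/-- The fundamental group of a product. -/
theorem nonempty_fundamentalGroup_prod_mulEquiv {X Y : Type*} [TopologicalSpace X]
    [TopologicalSpace Y] (x : X) (y : Y) :
    Nonempty (FundamentalGroup (X × Y) (x, y) ≃* FundamentalGroup X x × FundamentalGroup Y y) := by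
  have hfst : ∀ γ : FundamentalGroup (X × Y) (x, y),
      mapLoop (⟨Prod.fst, continuous_fst⟩ : C(X × Y, X)) (x₀ := x) rfl γ =
        Path.Homotopic.projLeft (FundamentalGroup.toPath γ) := by rintro ⟨γ⟩; rfl
  have hsnd : ∀ γ : FundamentalGroup (X × Y) (x, y),
      mapLoop (⟨Prod.snd, continuous_snd⟩ : C(X × Y, Y)) (x₀ := y) rfl γ =
        Path.Homotopic.projRight (FundamentalGroup.toPath γ) := by rintro ⟨γ⟩; rfl
  refine ⟨MulEquiv.ofBijective ((mapLoop (⟨Prod.fst, continuous_fst⟩ : C(X × Y, X)) rfl).prod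
    (mapLoop (⟨Prod.snd, continuous_snd⟩ : C(X × Y, Y)) rfl)) ⟨fun γ γ' h => ?_, fun γ => ?_⟩⟩
  · obtain ⟨h1, h2⟩ := Prod.ext_iff.1 h
    have h1' := (hfst γ).symm.trans (h1.trans (hfst γ'))
    have h2' := (hsnd γ).symm.trans (h2.trans (hsnd γ'))
    exact (Path.Homotopic.prod_projLeft_projRight (FundamentalGroup.toPath γ)).symm.trans
      ((congrArg₂ Path.Homotopic.prod h1' h2').trans
        (Path.Homotopic.prod_projLeft_projRight (FundamentalGroup.toPath γ')))
  · refine ⟨Path.Homotopic.prod (FundamentalGroup.toPath γ.1) (FundamentalGroup.toPath γ.2),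
      Prod.ext ?_ ?_⟩
    · exact (hfst _).trans (Path.Homotopic.projLeft_prod _ _)
    · exact (hsnd _).trans (Path.Homotopic.projRight_prod _ _)

end CircleGroup

/-! ### Spherical shells and the removal of a ball -/

section Shells

/-- Polar coordinates. -/
theorem isOpenEmbedding_polar {T : Type*} [TopologicalSpace T] {f : T → ℝ}
    (hf : IsOpenEmbedding f) (hpos : ∀ t, 0 < f t) :
    IsOpenEmbedding fun p : S2 × T => f p.2 • (p.1 : E3) := by
  have h1 : IsOpenEmbedding fun t : T => (⟨f t, hpos t⟩ : Ioi (0 : ℝ)) :=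
    .of_comp _ isOpen_Ioi.isOpenEmbedding_subtypeVal hf
  have h2 := (isOpen_compl_singleton (x := (0 : E3))).isOpenEmbedding_subtypeVal.comp
    ((homeomorphUnitSphereProd E3).symm.isOpenEmbedding.comp (IsOpenEmbedding.id.prodMap h1))
  exact h2

theorem isOpenEmbedding_shell {r₀ r₁ : ℝ} (h₀ : 0 ≤ r₀) :
    IsOpenEmbedding fun p : S2 × Ioo r₀ r₁ => (p.2 : ℝ) • (p.1 : E3) :=
  isOpenEmbedding_polar isOpen_Ioo.isOpenEmbedding_subtypeVal fun t => h₀.trans_lt t.2.1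

theorem norm_smul_S2 (x : S2) {t : ℝ} (ht : 0 ≤ t) : ‖t • (x : E3)‖ = t := by
  rw [norm_smul, norm_eq_of_mem_sphere x, mul_one, Real.norm_of_nonneg ht]

theorem exists_smul_S2 {y : E3} (hy : y ≠ 0) : ∃ x : S2, y = ‖y‖ • (x : E3) := by
  refine ⟨⟨‖y‖⁻¹ • y, ?_⟩, ?_⟩
  · rw [mem_sphere_zero_iff_norm, norm_smul, norm_inv, norm_norm,
      inv_mul_cancel₀ (norm_ne_zero_iff.2 hy)]
  · rw [smul_smul, mul_inv_cancel₀ (norm_ne_zero_iff.2 hy), one_smul]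

variable {N : Type*} [TopologicalSpace N]

theorem IsTameDisc.exists_openPartialHomeomorph {f : E3 → N} (hf : IsTameDisc f) :
    ∃ φ : OpenPartialHomeomorph E3 N, ⇑φ = f ∧ ball3 ⊆ φ.source := by
  obtain ⟨U, hU, hb, hf⟩ := hf
  have hinj : InjOn f U := injOn_iff_injective.2 hf.injective
  refine ⟨OpenPartialHomeomorph.ofContinuousOpenRestrict (hinj.toPartialEquiv f U)
    (continuousOn_iff_continuous_restrict.2 hf.continuous) hf.isOpenMap hU, rfl, hb⟩

theorem _root_.OpenPartialHomeomorph.isOpenEmbedding_comp_val {X Y : Type*} [TopologicalSpace X]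
    [TopologicalSpace Y] (φ : OpenPartialHomeomorph X Y) {W : Set X} (hW : IsOpen W)
    (hs : W ⊆ φ.source) : IsOpenEmbedding fun x : W => φ x := by
  refine IsOpenEmbedding.of_continuous_injective_isOpenMap ?_ ?_ ?_
  · exact continuousOn_iff_continuous_restrict.1 (φ.continuousOn.mono hs)
  · intro x y h
    exact Subtype.ext (φ.injOn (hs x.2) (hs y.2) h)
  · intro V hV
    have : (fun x : W => φ x) '' V = φ '' (Subtype.val '' V) := by rw [image_image]
    rw [this]
    exact φ.isOpen_image_of_subset_source (hW.isOpenMap_subtype_val _ hV)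
      (fun _ ⟨x, _, h⟩ => h ▸ hs x.2)

/-- A slightly larger concentric ball still lies in a neighbourhood of the unit ball. -/
theorem exists_ball_subset {U : Set E3} (hU : IsOpen U) (hb : ball3 ⊆ U) :
    ∃ δ > 0, Metric.ball (0 : E3) (1 + δ) ⊆ U := by
  obtain ⟨δ, hδ, h⟩ := (isCompact_closedBall (0 : E3) 1).exists_thickening_subset_open hU hb
  refine ⟨δ, hδ, ?_⟩
  rw [thickening_closedBall hδ zero_le_one, add_comm] at h
  exact h

variable [T2Space N]

/-- The shell around the removed ball is connected, so it lies on one side of any separation of the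
complement; filling in the ball on that side would separate `O`. For `r₀ = 0` a single point is
removed. -/
theorem isConnected_diff_ball {O : Set N} (hO : IsOpen O) (hOc : IsConnected O)
    (φ : OpenPartialHomeomorph E3 N) {r₀ r₁ : ℝ} (h₀ : 0 ≤ r₀) (h₀₁ : r₀ < r₁)
    (hφ : Metric.ball 0 r₁ ⊆ φ.source) (hφO : φ '' Metric.ball 0 r₁ ⊆ O) :
    IsOpen (O \ φ '' Metric.closedBall 0 r₀) ∧ IsConnected (O \ φ '' Metric.closedBall 0 r₀) := by
  have hsub : Metric.closedBall (0 : E3) r₀ ⊆ Metric.ball 0 r₁ := Metric.closedBall_subset_ball h₀₁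
  have hC : IsClosed (φ '' Metric.closedBall 0 r₀) :=
    ((isCompact_closedBall _ _).image_of_continuousOn
      (φ.continuousOn.mono (hsub.trans hφ))).isClosed
  have hopen : IsOpen (O \ φ '' Metric.closedBall 0 r₀) := hO.sdiff hC
  have : Fact (r₀ < r₁) := ⟨h₀₁⟩
  let g : S2 × Ioo r₀ r₁ → N := fun p => φ ((p.2 : ℝ) • (p.1 : E3))
  have hnorm : ∀ p : S2 × Ioo r₀ r₁, ‖(p.2 : ℝ) • (p.1 : E3)‖ = p.2 := fun p =>
    norm_smul_S2 p.1 (h₀.trans p.2.2.1.le)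
  have hgm : ∀ p : S2 × Ioo r₀ r₁, (p.2 : ℝ) • (p.1 : E3) ∈ Metric.ball (0 : E3) r₁ := fun p => by
    rw [mem_ball_zero_iff, hnorm]; exact p.2.2.2
  have hgc : Continuous g :=
    φ.continuousOn.comp_continuous (by fun_prop) fun p => hφ (hgm p)
  have hB : IsConnected (range g) := isConnected_range hgc
  have hBs : ∀ y ∈ Metric.ball (0 : E3) r₁, y ∉ Metric.closedBall (0 : E3) r₀ → φ y ∈ range g := by
    intro y hy hy'
    rw [mem_ball_zero_iff] at hy
    rw [mem_closedBall_zero_iff, not_le] at hy'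
    obtain ⟨x, hx⟩ := exists_smul_S2 (norm_pos_iff.1 (h₀.trans_lt hy'))
    refine ⟨(x, ⟨‖y‖, hy', hy⟩), ?_⟩
    show φ (‖y‖ • (x : E3)) = φ y
    rw [← hx]
  have hBO : range g ⊆ O \ φ '' Metric.closedBall 0 r₀ := by
    rintro _ ⟨p, rfl⟩
    refine ⟨hφO ⟨_, hgm p, rfl⟩, ?_⟩
    rintro ⟨y, hy, h⟩
    have := φ.injOn (hφ (hsub hy)) (hφ (hgm p)) h
    rw [this, mem_closedBall_zero_iff, hnorm] at hy
    exact absurd p.2.2.1 (not_lt.2 hy)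
  refine ⟨hopen, hB.nonempty.mono hBO, ?_⟩
  rw [isPreconnected_iff_subset_of_disjoint]
  have key : ∀ u v : Set N, IsOpen u → IsOpen v → O \ φ '' Metric.closedBall 0 r₀ ⊆ u ∪ v →
      (O \ φ '' Metric.closedBall 0 r₀) ∩ (u ∩ v) = ∅ → range g ⊆ u →
      O \ φ '' Metric.closedBall 0 r₀ ⊆ u := by
    intro u v hu hv huv hdis hgu
    have := isPreconnected_iff_subset_of_disjoint.1 hOc.isPreconnected
      ((u ∩ (O \ φ '' Metric.closedBall 0 r₀)) ∪ φ '' Metric.ball 0 r₁)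
      (v ∩ (O \ φ '' Metric.closedBall 0 r₀))
      ((hu.inter hopen).union (φ.isOpen_image_of_subset_source Metric.isOpen_ball hφ))
      (hv.inter hopen) ?_ ?_
    · rcases this with h | h
      · intro x hx
        rcases h hx.1 with h | ⟨y, hy, rfl⟩
        · exact h.1
        · exact hgu (hBs y hy fun hy' => hx.2 ⟨y, hy', rfl⟩)
      · obtain ⟨x, hx⟩ := hB.nonempty
        have hxv := (h (hBO hx).1).1
        exact (notMem_empty x (hdis ▸ ⟨hBO hx, hgu hx, hxv⟩)).elim
    · intro x hx
      by_cases hx' : x ∈ φ '' Metric.closedBall 0 r₀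
      · exact Or.inl (Or.inr (image_mono hsub hx'))
      · rcases huv ⟨hx, hx'⟩ with h | h
        · exact Or.inl (Or.inl ⟨h, hx, hx'⟩)
        · exact Or.inr ⟨h, hx, hx'⟩
    · rw [eq_empty_iff_forall_notMem]
      rintro x ⟨hx, hx1 | ⟨y, hy, rfl⟩, hx2⟩
      · exact notMem_empty x (hdis ▸ ⟨hx1.2, hx1.1, hx2.1⟩)
      · have hmem : φ y ∈ (O \ φ '' Metric.closedBall 0 r₀) ∩ (u ∩ v) :=
          ⟨hx2.2, hgu (hBs y hy fun hy' => hx2.2.2 ⟨y, hy', rfl⟩), hx2.1⟩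
        rw [hdis] at hmem
        exact hmem
  intro u v hu hv huv hdis
  rcases isPreconnected_iff_subset_of_disjoint.1 hB.isPreconnected u v hu hv (hBO.trans huv)
    (subset_empty_iff.1 (hdis ▸ inter_subset_inter_left _ hBO)) with h | h
  · exact Or.inl (key u v hu hv huv hdis h)
  · exact Or.inr (key v u hv hu (union_comm u v ▸ huv) (inter_comm u v ▸ hdis) h)

/-- Removing a closed ball does not change the fundamental group. -/
theorem nonempty_fundamentalGroup_diff_ball_mulEquiv [LocallyPathConnectedSpace N] {O : Set N}
    (hO : IsOpen O) (hOc : IsConnected O)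
    (φ : OpenPartialHomeomorph E3 N) {r₀ r₁ : ℝ} (h₀ : 0 ≤ r₀) (h₀₁ : r₀ < r₁)
    (hφ : Metric.ball 0 r₁ ⊆ φ.source) (hφO : φ '' Metric.ball 0 r₁ ⊆ O)
    (x : O) (y : ↥(O \ φ '' Metric.closedBall 0 r₀)) :
    Nonempty (FundamentalGroup O x ≃* FundamentalGroup ↥(O \ φ '' Metric.closedBall 0 r₀) y) := by
  obtain ⟨hop, hcon⟩ := isConnected_diff_ball hO hOc φ h₀ h₀₁ hφ hφO
  have : Fact (r₀ < r₁) := ⟨h₀₁⟩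
  have : PathConnectedSpace ↥(O \ φ '' Metric.closedBall 0 r₀) :=
    isPathConnected_iff_pathConnectedSpace.1 (hop.isConnected_iff_isPathConnected.1 hcon)
  have : ContractibleSpace (Metric.ball (0 : E3) r₁) :=
    (convex_ball 0 r₁).contractibleSpace ⟨0, Metric.mem_ball_self (h₀.trans_lt h₀₁)⟩
  let iU : C(↥(O \ φ '' Metric.closedBall 0 r₀), O) := ⟨fun z => ⟨z, z.2.1⟩, by fun_prop⟩
  have hball := φ.isOpenEmbedding_comp_val Metric.isOpen_ball hφ
  let iV : C(Metric.ball (0 : E3) r₁, O) :=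
    ⟨fun z => ⟨φ z, hφO ⟨z, z.2, rfl⟩⟩, hball.continuous.subtype_mk _⟩
  have hnorm : ∀ p : S2 × Ioo r₀ r₁, ‖(p.2 : ℝ) • (p.1 : E3)‖ = p.2 := fun p =>
    norm_smul_S2 p.1 (h₀.trans p.2.2.1.le)
  have hgm : ∀ p : S2 × Ioo r₀ r₁, (p.2 : ℝ) • (p.1 : E3) ∈ Metric.ball (0 : E3) r₁ := fun p => by
    rw [mem_ball_zero_iff, hnorm]; exact p.2.2.2
  have hsub : Metric.closedBall (0 : E3) r₀ ⊆ Metric.ball 0 r₁ := Metric.closedBall_subset_ball h₀₁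
  let β : C(Unit × (S2 × Ioo r₀ r₁), Metric.ball (0 : E3) r₁) :=
    ⟨fun p => ⟨(p.2.2 : ℝ) • (p.2.1 : E3), hgm p.2⟩, by fun_prop⟩
  have hα : ∀ p, φ (β p) ∈ O \ φ '' Metric.closedBall 0 r₀ := by
    intro p
    refine ⟨hφO ⟨_, (β p).2, rfl⟩, ?_⟩
    rintro ⟨y, hy, h⟩
    have := φ.injOn (hφ (hsub hy)) (hφ (β p).2) h
    have h2 : ‖((β p : Metric.ball (0 : E3) r₁) : E3)‖ = p.2.2 := hnorm p.2
    rw [this, mem_closedBall_zero_iff, h2] at hy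
    exact absurd p.2.2.2.1 (not_lt.2 hy)
  let α : C(Unit × (S2 × Ioo r₀ r₁), ↥(O \ φ '' Metric.closedBall 0 r₀)) :=
    ⟨fun p => ⟨φ (β p), hα p⟩, (hball.continuous.comp β.continuous).subtype_mk _⟩
  have hU : IsOpenEmbedding iU :=
    .of_comp _ hO.isOpenEmbedding_subtypeVal hop.isOpenEmbedding_subtypeVal
  have hV : IsOpenEmbedding iV := .of_comp _ hO.isOpenEmbedding_subtypeVal hball
  have hβe : IsOpenEmbedding β := by
    refine .of_comp _ Metric.isOpen_ball.isOpenEmbedding_subtypeVal ?_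
    exact (isOpenEmbedding_shell h₀).comp
      (Homeomorph.punitProd (S2 × Ioo r₀ r₁)).isOpenEmbedding
  have hαe : IsOpenEmbedding α :=
    .of_comp _ hop.isOpenEmbedding_subtypeVal (hball.comp hβe)
  have hcov : range iU ∪ range iV = univ := by
    rw [eq_univ_iff_forall]
    rintro ⟨z, hz⟩
    by_cases h : z ∈ φ '' Metric.closedBall 0 r₀
    · obtain ⟨y, hy, rfl⟩ := h
      exact Or.inr ⟨⟨y, hsub hy⟩, rfl⟩
    · exact Or.inl ⟨⟨z, hz, h⟩, rfl⟩
  have hmeet : ∀ u v, iU u = iV v → ∃ p, α p = u := by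
    rintro ⟨u, hu⟩ ⟨v, hv⟩ h
    have h' : u = φ v := congrArg Subtype.val h
    subst h'
    have hv' : r₀ < ‖v‖ := by
      by_contra hle
      exact hu.2 ⟨v, mem_closedBall_zero_iff.2 (not_lt.1 hle), rfl⟩
    obtain ⟨x, hx⟩ := exists_smul_S2 (norm_pos_iff.1 (h₀.trans_lt hv'))
    refine ⟨((), x, ⟨‖v‖, hv', mem_ball_zero_iff.1 hv⟩), Subtype.ext ?_⟩
    show φ (‖v‖ • (x : E3)) = φ v
    rw [← hx]
  -- The second piece is a contractible ball and the overlap is one shell, so neither contributes a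
  -- factor.
  obtain ⟨e⟩ := nonempty_fundamentalGroup_mulEquiv_coprod hU hV hcov hαe (fun _ => rfl) hmeet () x y
    ⟨0, Metric.mem_ball_self (h₀.trans_lt h₀₁)⟩
  have : IsEmpty {k : Unit // k ≠ ()} := ⟨fun k => k.2 rfl⟩
  exact ⟨e.trans ((coprodSubsingleton _ _).trans (coprodSubsingleton _ _))⟩

end Shells

/-! ### Points and open sets of a glued space -/

section GlueBasic

variable {X Y : Type*} [TopologicalSpace X] [TopologicalSpace Y] (R : X → Y → Prop)

/-- The inclusion of the first piece. -/
def Glue.inl (x : X) : Glue R := Quot.mk _ (Sum.inl x)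

/-- The inclusion of the second piece. -/
def Glue.inr (y : Y) : Glue R := Quot.mk _ (Sum.inr y)

theorem Glue.continuous_inl : Continuous (Glue.inl R) :=
  continuous_quot_mk.comp _root_.continuous_inl

theorem Glue.continuous_inr : Continuous (Glue.inr R) :=
  continuous_quot_mk.comp _root_.continuous_inr

variable {R}

theorem Glue.sound {x : X} {y : Y} (h : R x y) : Glue.inl R x = Glue.inr R y :=
  Quot.sound ⟨x, y, rfl, rfl, h⟩

theorem Glue.ind {P : Glue R → Prop} (hl : ∀ x, P (Glue.inl R x)) (hr : ∀ y, P (Glue.inr R y))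
    (z : Glue R) : P z := by
  rcases z with ⟨x | y⟩
  exacts [hl x, hr y]

theorem Glue.isOpen_iff {W : Set (Glue R)} :
    IsOpen W ↔ IsOpen (Glue.inl R ⁻¹' W) ∧ IsOpen (Glue.inr R ⁻¹' W) := by
  exact (isQuotientMap_quot_mk (r := glueRel R)).isOpen_preimage.symm.trans isOpen_sum_iff

theorem Glue.isClosed_iff {W : Set (Glue R)} :
    IsClosed W ↔ IsClosed (Glue.inl R ⁻¹' W) ∧ IsClosed (Glue.inr R ⁻¹' W) := by
  simp only [← isOpen_compl_iff, Glue.isOpen_iff, preimage_compl]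

/-- `R` is the graph of a bijection between a subset of `X` and a subset of `Y`. -/
structure IsPartialBijection (R : X → Y → Prop) : Prop where
  right : ∀ {x y y'}, R x y → R x y' → y = y'
  left : ∀ {x x' y}, R x y → R x' y → x = x'

/-- The class of `b` consists of `b` and its partner, if it has one. Membership in it respects the
identifications, so it descends to the quotient, and no chains of the generated equivalence relation
have to be analysed. -/
theorem IsPartialBijection.exists_separating (hR : IsPartialBijection R) (b : X ⊕ Y) :
    ∃ F : Glue R → Prop, (∀ x, F (Glue.inl R x) ↔ b.elim (x = ·) (R x)) ∧
      ∀ y, F (Glue.inr R y) ↔ b.elim (R · y) (y = ·) := by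
  refine ⟨Quot.lift (fun a => a.elim (fun x => b.elim (x = ·) (R x))
    fun y => b.elim (R · y) (y = ·)) ?_, fun x => Iff.rfl, fun y => Iff.rfl⟩
  rintro _ _ ⟨x, y, rfl, rfl, h⟩
  rcases b with x' | y'
  · exact propext ⟨fun e => by obtain rfl : x = x' := e; exact h, fun e => hR.left h e⟩
  · exact propext ⟨fun e => hR.right h e, fun e => by obtain rfl : y = y' := e; exact h⟩

theorem IsPartialBijection.inl_eq_inr_iff (hR : IsPartialBijection R) {x : X} {y : Y} :
    Glue.inl R x = Glue.inr R y ↔ R x y := by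
  refine ⟨fun h => ?_, Glue.sound⟩
  obtain ⟨F, h1, h2⟩ := hR.exists_separating (.inr y)
  exact (h1 x).1 (h ▸ (h2 y).2 rfl)

theorem IsPartialBijection.inl_injective (hR : IsPartialBijection R) :
    Function.Injective (Glue.inl R) := fun x x' h => by
  obtain ⟨F, h1, h2⟩ := hR.exists_separating (.inl x')
  exact (h1 x).1 (h ▸ (h1 x').2 rfl)

theorem IsPartialBijection.inr_injective (hR : IsPartialBijection R) :
    Function.Injective (Glue.inr R) := fun y y' h => by
  obtain ⟨F, h1, h2⟩ := hR.exists_separating (.inr y')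
  exact (h2 y).1 (h ▸ (h2 y').2 rfl)

theorem IsPartialBijection.isOpenEmbedding_inr_comp (hR : IsPartialBijection R) {V : Type*}
    [TopologicalSpace V] {g : V → Y} (hg : IsOpenEmbedding g) (hgR : ∀ x v, ¬ R x (g v)) :
    IsOpenEmbedding fun v => Glue.inr R (g v) := by
  refine IsOpenEmbedding.of_continuous_injective_isOpenMap
    ((Glue.continuous_inr R).comp hg.continuous) (hR.inr_injective.comp hg.injective) ?_
  intro W hW
  rw [Glue.isOpen_iff]
  have h1 : Glue.inl R ⁻¹' ((fun v => Glue.inr R (g v)) '' W) = ∅ := by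
    rw [eq_empty_iff_forall_notMem]
    rintro x ⟨v, _, hv⟩
    exact hgR x v (hR.inl_eq_inr_iff.1 hv.symm)
  have h2 : Glue.inr R ⁻¹' ((fun v => Glue.inr R (g v)) '' W) = g '' W := by
    ext y
    constructor
    · rintro ⟨v, hv, h⟩
      exact ⟨v, hv, hR.inr_injective h⟩
    · rintro ⟨v, hv, rfl⟩
      exact ⟨v, hv, rfl⟩
  rw [h1, h2]
  exact ⟨isOpen_empty, hg.isOpenMap W hW⟩

end GlueBasic

/-! ### Punctured discs as collars in the glued space -/

section Collar

variable {ι M Y : Type*} [TopologicalSpace M] [TopologicalSpace Y] [T2Space M]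

theorem IsTameDisc.injOn {f : E3 → M} (hf : IsTameDisc f) : InjOn f ball3 := by
  obtain ⟨φ, rfl, hb⟩ := hf.exists_openPartialHomeomorph
  exact φ.injOn.mono hb

theorem IsTameDisc.continuousOn {f : E3 → M} (hf : IsTameDisc f) : ContinuousOn f ball3 := by
  obtain ⟨φ, rfl, hb⟩ := hf.exists_openPartialHomeomorph
  exact φ.continuousOn.mono hb

theorem IsTameDisc.isClosed_image {f : E3 → M} (hf : IsTameDisc f) : IsClosed (f '' ball3) :=
  ((isCompact_closedBall _ _).image_of_continuousOn hf.continuousOn).isClosed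

theorem IsTameDisc.isOpen_image_ball {f : E3 → M} (hf : IsTameDisc f) :
    IsOpen (f '' Metric.ball 0 1) := by
  obtain ⟨φ, rfl, hb⟩ := hf.exists_openPartialHomeomorph
  exact φ.isOpen_image_of_subset_source Metric.isOpen_ball
    (Metric.ball_subset_closedBall.trans hb)

theorem IsTameDisc.exists_continuous_polar {f : E3 → M} (hf : IsTameDisc f) :
    ∃ g : {m : M // m ∈ f '' ball3 ∧ m ≠ f 0} → S2 × Ioc (0 : ℝ) 1, Continuous g ∧
      ∀ m : {m : M // m ∈ f '' ball3 ∧ m ≠ f 0}, (m : M) = f (((g m).2 : ℝ) • ((g m).1 : E3)) := by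
  obtain ⟨φ, rfl, hb⟩ := hf.exists_openPartialHomeomorph
  have hy : ∀ m : {m : M // m ∈ φ '' ball3 ∧ m ≠ φ 0},
      φ.symm m.1 ∈ ball3 ∧ φ (φ.symm m.1) = m.1 := by
    rintro ⟨_, ⟨y, hy, rfl⟩, h0⟩
    dsimp only
    rw [φ.left_inv (hb hy)]
    exact ⟨hy, rfl⟩
  have hy0 : ∀ m : {m : M // m ∈ φ '' ball3 ∧ m ≠ φ 0}, φ.symm m.1 ≠ 0 :=
    fun m h0 => m.2.2 (by rw [← (hy m).2, h0])
  have hyc : Continuous fun m : {m : M // m ∈ φ '' ball3 ∧ m ≠ φ 0} => φ.symm m.1 := by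
    refine φ.symm.continuousOn.comp_continuous continuous_subtype_val ?_
    rintro ⟨_, ⟨y, hy, rfl⟩, h0⟩
    exact φ.map_source (hb hy)
  refine ⟨fun m => (⟨‖φ.symm m.1‖⁻¹ • φ.symm m.1, ?_⟩,
    ⟨‖φ.symm m.1‖, norm_pos_iff.2 (hy0 m), mem_closedBall_zero_iff.1 (hy m).1⟩), ?_, ?_⟩
  · rw [mem_sphere_zero_iff_norm, norm_smul, norm_inv, norm_norm,
      inv_mul_cancel₀ (norm_ne_zero_iff.2 (hy0 m))]
  · exact (((hyc.norm.inv₀ fun m => norm_ne_zero_iff.2 (hy0 m)).smul hyc).subtype_mk _).prodMk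
      (hyc.norm.subtype_mk _)
  · intro m
    dsimp only
    rw [smul_smul, mul_inv_cancel₀ (norm_ne_zero_iff.2 (hy0 m)), one_smul, (hy m).2]

/-- A boundary point of a disc is the limit of the radial points just outside it. These avoid the
other discs, which form a closed set not containing the limit. -/
theorem mem_closure_compl_discs [Finite ι] {h : ι → E3 → M} (hh : ∀ s, IsTameDisc (h s))
    (hdis : ∀ s t, s ≠ t → Disjoint (h s '' ball3) (h t '' ball3)) {D : Set M}
    (hD : D = ⋃ s, h s '' ball3) {m : M} :
    m ∈ closure (univ \ D) ↔ ∀ s, m ∉ h s '' Metric.ball 0 1 := by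
  subst hD
  constructor
  · intro hm s hs
    have : closure (univ \ ⋃ s, h s '' ball3) ⊆ (h s '' Metric.ball 0 1)ᶜ := by
      refine closure_minimal ?_ (hh s).isOpen_image_ball.isClosed_compl
      rintro x ⟨_, hx⟩ hx'
      exact hx (mem_iUnion.2 ⟨s, image_mono Metric.ball_subset_closedBall hx'⟩)
    exact this hm hs
  · intro hm
    by_cases hmD : m ∈ ⋃ s, h s '' ball3
    · obtain ⟨s, x, hx, rfl⟩ := mem_iUnion.1 hmD
      have hx1 : ‖x‖ = 1 := by
        refine le_antisymm (mem_closedBall_zero_iff.1 hx) (not_lt.1 fun hlt => ?_)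
        exact hm s ⟨x, mem_ball_zero_iff.2 hlt, rfl⟩
      obtain ⟨φ, hφ, hb⟩ := (hh s).exists_openPartialHomeomorph
      have hcont : Tendsto (fun t : ℝ => t • x) (𝓝[>] 1) (𝓝 x) := by
        have : Tendsto (fun t : ℝ => t • x) (𝓝 1) (𝓝 ((1 : ℝ) • x)) :=
          (continuous_id.smul continuous_const).continuousAt
        rw [one_smul] at this
        exact this.mono_left nhdsWithin_le_nhds
      have hcont' : Tendsto (fun t : ℝ => h s (t • x)) (𝓝[>] 1) (𝓝 (h s x)) := by
        rw [← hφ]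
        exact (φ.continuousAt (hb hx)).tendsto.comp hcont
      have hcl : IsClosed (⋃ t ∈ {t | t ≠ s}, h t '' ball3) :=
        (toFinite {t | t ≠ s}).isClosed_biUnion fun t _ => (hh t).isClosed_image
      have hnot : h s x ∉ ⋃ t ∈ {t | t ≠ s}, h t '' ball3 := by
        intro hmem
        obtain ⟨t, ht, hxt⟩ := mem_iUnion₂.1 hmem
        exact disjoint_left.1 (hdis t s ht) hxt ⟨x, hx, rfl⟩
      refine mem_closure_of_tendsto hcont' ?_
      filter_upwards [hcont' (hcl.isOpen_compl.mem_nhds hnot), self_mem_nhdsWithin,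
        hcont (φ.open_source.mem_nhds (hb hx))] with t ht1 ht2 ht3
      refine ⟨mem_univ _, fun hmem => ?_⟩
      obtain ⟨r, hr⟩ := mem_iUnion.1 hmem
      by_cases hrs : r = s
      · subst hrs
        obtain ⟨y, hy, hyt⟩ := hr
        rw [← hφ] at hyt
        have := φ.injOn (hb hy) ht3 hyt
        rw [this, mem_closedBall_zero_iff, norm_smul, hx1, mul_one, Real.norm_eq_abs] at hy
        exact absurd (mem_Ioi.1 ht2) (not_lt.2 ((le_abs_self t).trans hy))
      · exact ht1 (mem_iUnion₂.2 ⟨r, hrs, hr⟩)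
    · exact subset_closure ⟨mem_univ _, hmD⟩

/-- The parameter of the boundary of a collar. -/
def topParam : Ioc (0 : ℝ) 1 := ⟨1, one_pos, le_rfl⟩

/-- If the boundary spheres of discs in `M` are glued to the ends of collars in `Y`, then the
complement of the centres of the discs embeds as an open set. -/
theorem exists_collar_embedding [Finite ι] [TopologicalSpace ι] [DiscreteTopology ι]
    {h : ι → E3 → M} (hh : ∀ s, IsTameDisc (h s))
    (hdis : ∀ s t, s ≠ t → Disjoint (h s '' ball3) (h t '' ball3)) {D : Set M}
    (hD : D = ⋃ s, h s '' ball3) {κ : ι × (S2 × Ioc (0 : ℝ) 1) → Y} (hκ : IsOpenEmbedding κ)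
    {R : closure (univ \ D) → Y → Prop}
    (hR : ∀ p y, R p y ↔ ∃ s, ∃ x : S2, (p : M) = h s x ∧ y = κ (s, x, topParam)) :
    IsPartialBijection R ∧
    ∃ e : C({m : M // ∀ s, m ≠ h s 0}, Glue R), IsOpenEmbedding e ∧
      (∀ (m : {m : M // ∀ s, m ≠ h s 0}) (hm : (m : M) ∈ closure (univ \ D)), e m = Glue.inl R ⟨m, hm⟩) ∧
      ∀ (m : {m : M // ∀ s, m ≠ h s 0}) s (x : S2) (t : Ioc (0 : ℝ) 1),
        (m : M) = h s ((t : ℝ) • (x : E3)) → e m = Glue.inr R (κ (s, x, t)) := by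
  have hS : ∀ x : S2, (x : E3) ∈ ball3 := fun x => Metric.sphere_subset_closedBall x.2
  have hparam : ∀ s s' (y y' : E3), y ∈ ball3 → y' ∈ ball3 → h s y = h s' y' → s = s' ∧ y = y' := by
    intro s s' y y' hy hy' he
    by_cases hss : s = s'
    · subst hss
      exact ⟨rfl, (hh s).injOn hy hy' he⟩
    · exact (disjoint_left.1 (hdis s s' hss) ⟨y, hy, rfl⟩ ⟨y', hy', he.symm⟩).elim
  have hnorm : ∀ (x : S2) (t : Ioc (0 : ℝ) 1), ‖(t : ℝ) • (x : E3)‖ = t := fun x t =>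
    norm_smul_S2 x t.2.1.le
  have htx : ∀ (x : S2) (t : Ioc (0 : ℝ) 1), (t : ℝ) • (x : E3) ∈ ball3 := fun x t => by
    rw [mem_closedBall_zero_iff, hnorm]; exact t.2.2
  have hpol : ∀ s s' (x x' : S2) (t t' : Ioc (0 : ℝ) 1), h s ((t : ℝ) • (x : E3)) =
      h s' ((t' : ℝ) • (x' : E3)) → s = s' ∧ x = x' ∧ t = t' := by
    intro s s' x x' t t' he
    obtain ⟨h1, h2⟩ := hparam s s' _ _ (htx x t) (htx x' t') he
    have h3 : t = t' := Subtype.ext (by rw [← hnorm x t, ← hnorm x' t', h2])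
    subst h3
    exact ⟨h1, Subtype.ext ((smul_right_inj t.2.1.ne').1 h2), rfl⟩
  have htop : ∀ x : S2, ((topParam : Ioc (0 : ℝ) 1) : ℝ) • (x : E3) = x := fun x => by
    simp [topParam]
  have hRb : IsPartialBijection R := by
    constructor
    · intro p y y' h1 h2
      obtain ⟨s, x, hx, rfl⟩ := (hR _ _).1 h1
      obtain ⟨s', x', hx', rfl⟩ := (hR _ _).1 h2
      obtain ⟨rfl, hxx⟩ := hparam s s' x x' (hS x) (hS x') (hx.symm.trans hx')
      rw [Subtype.ext hxx]
    · intro p p' y h1 h2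
      obtain ⟨s, x, hx, rfl⟩ := (hR _ _).1 h1
      obtain ⟨s', x', hx', he⟩ := (hR _ _).1 h2
      have := hκ.injective he
      simp only [Prod.mk.injEq] at this
      obtain ⟨rfl, rfl, -⟩ := this
      exact Subtype.ext (hx.trans hx'.symm)
  refine ⟨hRb, ?_⟩
  have hcl := fun m => mem_closure_compl_discs hh hdis hD (m := m)
  -- a point of a disc in the closure of the complement lies on the boundary
  have hbd : ∀ m ∈ closure (univ \ D), ∀ s (x : S2) (t : Ioc (0 : ℝ) 1),
      m = h s ((t : ℝ) • (x : E3)) → t = topParam := by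
    intro m hm s x t hmt
    by_contra hne
    have hlt : (t : ℝ) < 1 := lt_of_le_of_ne t.2.2 fun h1 => hne (Subtype.ext h1)
    exact (hcl m).1 hm s ⟨_, by rw [mem_ball_zero_iff, hnorm]; exact hlt, hmt.symm⟩
  -- The map is the inclusion outside the open discs, and polar coordinates followed by `κ` on the
  -- punctured discs; the two prescriptions agree on the boundary spheres by the gluing relation.
  have hex : ∀ m : {m : M // ∀ s, m ≠ h s 0}, ∃ z : Glue R,
      (∀ hm : (m : M) ∈ closure (univ \ D), z = Glue.inl R ⟨m, hm⟩) ∧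
      ∀ s (x : S2) (t : Ioc (0 : ℝ) 1), (m : M) = h s ((t : ℝ) • (x : E3)) →
        z = Glue.inr R (κ (s, x, t)) := by
    intro m
    by_cases hm : (m : M) ∈ closure (univ \ D)
    · refine ⟨Glue.inl R ⟨m, hm⟩, fun _ => rfl, fun s x t hmt => ?_⟩
      obtain rfl := hbd m hm s x t hmt
      exact Glue.sound ((hR _ _).2 ⟨s, x, by rw [hmt, htop], rfl⟩)
    · rw [hcl] at hm
      push Not at hm
      obtain ⟨s, y, hy, hym⟩ := hm
      have hy0 : y ≠ 0 := by rintro rfl; exact m.2 s hym.symm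
      obtain ⟨x, hx⟩ := exists_smul_S2 hy0
      have hy1 : ‖y‖ < 1 := mem_ball_zero_iff.1 hy
      refine ⟨Glue.inr R (κ (s, x, ⟨‖y‖, norm_pos_iff.2 hy0, hy1.le⟩)),
        fun hm => ((hcl _).1 hm s ⟨y, hy, hym⟩).elim, fun s' x' t hmt => ?_⟩
      have : h s (((⟨‖y‖, norm_pos_iff.2 hy0, hy1.le⟩ : Ioc (0 : ℝ) 1) : ℝ) • (x : E3)) =
          h s' ((t : ℝ) • (x' : E3)) := by
        rw [← hmt, ← hym]; exact congrArg (h s) hx.symm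
      obtain ⟨rfl, rfl, rfl⟩ := hpol _ _ _ _ _ _ this
      rfl
  choose e he1 he2 using hex
  have hcase : ∀ m : {m : M // ∀ s, m ≠ h s 0}, (m : M) ∈ closure (univ \ D) ∨
      ∃ s, ∃ (x : S2) (t : Ioc (0 : ℝ) 1), (m : M) = h s ((t : ℝ) • (x : E3)) := by
    intro m
    by_cases hm : (m : M) ∈ closure (univ \ D)
    · exact Or.inl hm
    · rw [hcl] at hm
      push Not at hm
      obtain ⟨s, y, hy, hym⟩ := hm
      have hy0 : y ≠ 0 := by rintro rfl; exact m.2 s hym.symm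
      obtain ⟨x, hx⟩ := exists_smul_S2 hy0
      exact Or.inr ⟨s, x, ⟨‖y‖, norm_pos_iff.2 hy0, (mem_ball_zero_iff.1 hy).le⟩, by
        rw [← hym]; exact congrArg (h s) hx⟩
  have hinlr : ∀ (m m' : {m : M // ∀ s, m ≠ h s 0}), (m : M) ∈ closure (univ \ D) →
      ∀ s (x : S2) (t : Ioc (0 : ℝ) 1), (m' : M) = h s ((t : ℝ) • (x : E3)) → e m = e m' →
        m = m' := by
    intro m m' hm s x t hm' hee
    rw [he1 m hm, he2 m' s x t hm', hRb.inl_eq_inr_iff, hR] at hee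
    obtain ⟨s', x', hx', hk⟩ := hee
    have := hκ.injective hk
    simp only [Prod.mk.injEq] at this
    obtain ⟨rfl, rfl, rfl⟩ := this
    exact Subtype.ext (by rw [hm', htop]; exact hx')
  have hinj : Function.Injective e := by
    intro m m' hee
    rcases hcase m with hm | ⟨s, x, t, hm⟩ <;> rcases hcase m' with hm' | ⟨s', x', t', hm'⟩
    · rw [he1 m hm, he1 m' hm'] at hee
      have := hRb.inl_injective hee
      exact Subtype.ext (congrArg (fun z : closure (univ \ D) => (z : M)) this)
    · exact hinlr m m' hm s' x' t' hm' hee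
    · exact (hinlr m' m hm' s x t hm hee.symm).symm
    · rw [he2 m s x t hm, he2 m' s' x' t' hm'] at hee
      have := hκ.injective (hRb.inr_injective hee)
      simp only [Prod.mk.injEq] at this
      obtain ⟨rfl, rfl, rfl⟩ := this
      exact Subtype.ext (hm.trans hm'.symm)
  have hcont : Continuous e := by
    let f : Option ι → Set {m : M // ∀ s, m ≠ h s 0} := fun o =>
      o.elim {m | (m : M) ∈ closure (univ \ D)} fun s => {m | (m : M) ∈ h s '' ball3}
    refine (locallyFinite_of_finite f).continuous ?_ ?_ ?_
    · rw [eq_univ_iff_forall]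
      intro m
      rcases hcase m with hm | ⟨s, x, t, hm⟩
      · exact mem_iUnion.2 ⟨none, hm⟩
      · exact mem_iUnion.2 ⟨some s, _, htx x t, hm.symm⟩
    · rintro (_ | s)
      · exact isClosed_closure.preimage continuous_subtype_val
      · exact (hh s).isClosed_image.preimage continuous_subtype_val
    · rintro (_ | s)
      · rw [continuousOn_iff_continuous_domRestrict]
        have : (f none).domRestrict e = fun m => Glue.inl R ⟨m.1.1, m.2⟩ := by
          ext m; exact he1 m.1 m.2
        rw [this]
        exact (Glue.continuous_inl R).comp (by fun_prop)
      · obtain ⟨g, hgc, hg⟩ := (hh s).exists_continuous_polar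
        rw [continuousOn_iff_continuous_domRestrict]
        have : (f (some s)).domRestrict e = fun m =>
            Glue.inr R (κ (s, g ⟨m.1.1, m.2, m.1.2 s⟩)) := by
          ext m
          exact he2 m.1 s _ _ (hg ⟨m.1.1, m.2, m.1.2 s⟩)
        rw [this]
        refine (Glue.continuous_inr R).comp (hκ.continuous.comp ?_)
        exact continuous_const.prodMk (hgc.comp (by fun_prop))
  have hopenM : IsOpen {m : M | ∀ s, m ≠ h s 0} := by
    have : {m : M | ∀ s, m ≠ h s 0} = (range fun s => h s 0)ᶜ := by
      ext m; simp [eq_comm]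
    rw [this]
    exact (finite_range _).isClosed.isOpen_compl
  have hopen : IsOpenMap e := by
    intro W hW
    have hW' : IsOpen (Subtype.val '' W) := hopenM.isOpenMap_subtype_val W hW
    -- The image of `W` meets the first piece in the trace of `W` itself, and the second piece in
    -- the `κ`-image of `W` written in polar coordinates.
    rw [Glue.isOpen_iff]
    constructor
    · have : Glue.inl R ⁻¹' (e '' W) = Subtype.val ⁻¹' (Subtype.val '' W) := by
        ext p
        constructor
        · rintro ⟨m, hm, hmp⟩
          refine ⟨m, hm, ?_⟩
          rcases hcase m with hmc | ⟨s, x, t, hmt⟩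
          · rw [he1 m hmc] at hmp
            exact congrArg Subtype.val (hRb.inl_injective hmp)
          · rw [he2 m s x t hmt] at hmp
            obtain ⟨s', x', hx', hk⟩ := (hR _ _).1 (hRb.inl_eq_inr_iff.1 hmp.symm)
            have := hκ.injective hk
            simp only [Prod.mk.injEq] at this
            obtain ⟨rfl, rfl, rfl⟩ := this
            rw [hmt, htop]; exact hx'.symm
        · rintro ⟨m, hm, hmp⟩
          exact ⟨m, hm, (he1 m (hmp ▸ p.2)).trans (congrArg _ (Subtype.ext hmp))⟩
      rw [this]
      exact hW'.preimage continuous_subtype_val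
    · have hF : Continuous fun p : ι × (S2 × Ioc (0 : ℝ) 1) =>
          h p.1 ((p.2.2 : ℝ) • (p.2.1 : E3)) := by
        rw [continuous_prod_of_discrete_left]
        intro s
        exact (hh s).continuousOn.comp_continuous (by fun_prop) fun p => htx _ _
      have : Glue.inr R ⁻¹' (e '' W) = κ '' {p | h p.1 ((p.2.2 : ℝ) • (p.2.1 : E3)) ∈
          Subtype.val '' W} := by
        ext y
        constructor
        · rintro ⟨m, hm, hmy⟩
          rcases hcase m with hmc | ⟨s, x, t, hmt⟩
          · rw [he1 m hmc] at hmy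
            obtain ⟨s, x, hx, rfl⟩ := (hR _ _).1 (hRb.inl_eq_inr_iff.1 hmy)
            refine ⟨(s, x, topParam), ⟨m, hm, ?_⟩, rfl⟩
            show (m : M) = h s (((topParam : Ioc (0 : ℝ) 1) : ℝ) • (x : E3))
            rw [htop]; exact hx
          · rw [he2 m s x t hmt] at hmy
            exact ⟨(s, x, t), ⟨m, hm, hmt⟩, hRb.inr_injective hmy⟩
        · rintro ⟨⟨s, x, t⟩, ⟨m, hm, hmt⟩, rfl⟩
          exact ⟨m, hm, he2 m s x t hmt⟩
      rw [this]
      exact hκ.isOpenMap _ (hW'.preimage hF)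
  exact ⟨⟨e, hcont⟩, .of_continuous_injective_isOpenMap hcont hinj hopen, he1, he2⟩

end Collar

/-! ### Fundamental groups of homeomorphic spaces -/

section HomeomorphInvariance

variable {X Y : Type*} [TopologicalSpace X] [TopologicalSpace Y]

theorem mapClass_eq_self {f : C(X, X)} (hf : f = .id X) {a b : X} (γ : PathClass a b)
    (ha : f a = a) (hb : f b = b) : mapClass f γ ha hb = γ := by
  subst hf
  exact mapClass_id γ

theorem nonempty_fundamentalGroup_mulEquiv_of_homeomorph [PathConnectedSpace Y] (e : X ≃ₜ Y)
    (x : X) (y : Y) : Nonempty (FundamentalGroup X x ≃* FundamentalGroup Y y) := by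
  refine Nonempty.map (fun f : FundamentalGroup X x ≃* FundamentalGroup Y (e x) =>
    f.trans (FundamentalGroup.fundamentalGroupMulEquivOfPathConnected (e x) y)) ?_
  let g : FundamentalGroup Y (e x) → FundamentalGroup X x := fun γ =>
    mapClass (e.symm : C(Y, X)) γ (e.symm_apply_apply x) (e.symm_apply_apply x)
  have hmap : ∀ γ : FundamentalGroup X x,
      FundamentalGroup.map (e : C(X, Y)) x γ = mapClass (e : C(X, Y)) γ rfl rfl := by
    intro γ
    simp only [mapClass, Path.Homotopic.Quotient.cast_rfl_rfl]
    rfl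
  refine ⟨{ FundamentalGroup.map (e : C(X, Y)) x with
    toFun := FundamentalGroup.map (e : C(X, Y)) x, invFun := g, left_inv := ?_, right_inv := ?_ }⟩
  · intro γ
    rw [hmap]
    show mapClass _ (mapClass _ _ _ _) _ _ = _
    rw [mapClass_comp]
    exact mapClass_eq_self (by ext; simp) _ _ _
  · intro γ
    rw [hmap]
    show mapClass _ (mapClass _ _ _ _) _ _ = _
    rw [mapClass_comp]
    exact mapClass_eq_self (by ext; simp) _ _ _

end HomeomorphInvariance

/-! ### Fundamental group of a space glued along spheres -/

section Glue

variable {ι M Y V : Type*} [TopologicalSpace M] [TopologicalSpace Y] [T2Space M]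
  [TopologicalSpace V]

/-- Van Kampen for `M` without the disc centres and for `V`, which is the part of `Y` off the gluing
spheres by `hgr`; the two meet in one open shell for each disc. -/
theorem nonempty_fundamentalGroup_glue_mulEquiv [Finite ι] [TopologicalSpace ι]
    [DiscreteTopology ι] {h : ι → E3 → M} (hh : ∀ s, IsTameDisc (h s))
    (hdis : ∀ s t, s ≠ t → Disjoint (h s '' ball3) (h t '' ball3)) {D : Set M}
    (hD : D = ⋃ s, h s '' ball3) {κ : ι × (S2 × Ioc (0 : ℝ) 1) → Y} (hκ : IsOpenEmbedding κ)
    {R : closure (univ \ D) → Y → Prop}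
    (hR : ∀ p y, R p y ↔ ∃ s, ∃ x : S2, (p : M) = h s x ∧ y = κ (s, x, topParam))
    [PathConnectedSpace {m : M // ∀ s, m ≠ h s 0}] [PathConnectedSpace V]
    {g : V → Y} (hg : IsOpenEmbedding g)
    (hgr : ∀ y, y ∈ range g ↔ ∀ s x, y ≠ κ (s, x, topParam))
    (s₀ : ι) (z : Glue R) (u : {m : M // ∀ s, m ≠ h s 0}) (v : V) :
    Nonempty (FundamentalGroup (Glue R) z ≃*
      Monoid.Coprod (Monoid.Coprod (FundamentalGroup {m : M // ∀ s, m ≠ h s 0} u)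
        (FundamentalGroup V v)) (FreeGroup {s // s ≠ s₀})) := by
  obtain ⟨hRb, e, hee, he1, he2⟩ := exists_collar_embedding hh hdis hD hκ hR
  have hcl := fun m => mem_closure_compl_discs hh hdis hD (m := m)
  have hgR : ∀ p v, ¬ R p (g v) := by
    intro p v hpv
    obtain ⟨s, x, -, hx⟩ := (hR _ _).1 hpv
    exact (hgr (g v)).1 ⟨v, rfl⟩ s x hx
  have hiV := hRb.isOpenEmbedding_inr_comp hg hgR
  let iV : C(V, Glue R) := ⟨_, hiV.continuous⟩
  have : Fact ((0 : ℝ) < 1) := ⟨one_pos⟩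
  let j : S2 × Ioo (0 : ℝ) 1 → S2 × Ioc (0 : ℝ) 1 := fun p => (p.1, ⟨p.2, p.2.2.1, p.2.2.2.le⟩)
  have hjc : Continuous j := by fun_prop
  have hnorm : ∀ (x : S2) (t : Ioo (0 : ℝ) 1), ‖(t : ℝ) • (x : E3)‖ = t := fun x t =>
    norm_smul_S2 x t.2.1.le
  have htx : ∀ (x : S2) (t : Ioo (0 : ℝ) 1), (t : ℝ) • (x : E3) ∈ ball3 := fun x t => by
    rw [mem_closedBall_zero_iff, hnorm]; exact t.2.2.le
  have hne : ∀ s s' (x : S2) (t : Ioo (0 : ℝ) 1), h s ((t : ℝ) • (x : E3)) ≠ h s' 0 := by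
    intro s s' x t heq
    have h0 : (0 : E3) ∈ ball3 := Metric.mem_closedBall_self zero_le_one
    by_cases hss : s = s'
    · subst hss
      have := (hh s).injOn (htx x t) h0 heq
      have h1 := hnorm x t
      rw [this, norm_zero] at h1
      exact t.2.1.ne h1
    · exact disjoint_left.1 (hdis s s' hss) ⟨_, htx x t, rfl⟩ ⟨0, h0, heq.symm⟩
  let α₀ : ι × (S2 × Ioo (0 : ℝ) 1) → {m : M // ∀ s, m ≠ h s 0} := fun p =>
    ⟨h p.1 ((p.2.2 : ℝ) • (p.2.1 : E3)), fun s' => hne _ _ _ _⟩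
  have hopenM : IsOpen {m : M | ∀ s, m ≠ h s 0} := by
    have : {m : M | ∀ s, m ≠ h s 0} = (range fun s => h s 0)ᶜ := by
      ext m; simp [eq_comm]
    rw [this]
    exact (finite_range _).isClosed.isOpen_compl
  have hβv : ∀ p : ι × (S2 × Ioo (0 : ℝ) 1), κ (p.1, j p.2) ∈ range g := by
    rintro ⟨s, x, t⟩
    rw [hgr]
    intro s' x' heq
    have := hκ.injective heq
    simp only [j, Prod.mk.injEq, topParam, Subtype.mk.injEq] at this
    exact t.2.2.ne (congrArg Subtype.val this.2.2)
  have hαe : ∀ p, e (α₀ p) = Glue.inr R (κ (p.1, j p.2)) := fun p =>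
    he2 _ p.1 p.2.1 (j p.2).2 rfl
  have hαo : IsOpenEmbedding α₀ := by
    refine isOpenEmbedding_of_slices ?_ ?_
    · rintro ⟨s, x, t⟩ ⟨s', x', t'⟩ heq
      have := hκ.injective (hRb.inr_injective ((hαe _).symm.trans ((congrArg e heq).trans (hαe _))))
      simp only [j, Prod.mk.injEq, Subtype.mk.injEq] at this
      obtain ⟨rfl, rfl, h3⟩ := this
      have h4 : (t : ℝ) = t' := Subtype.mk.inj h3
      rw [Subtype.ext h4]
    · intro s
      obtain ⟨φ, hφ, hb⟩ := (hh s).exists_openPartialHomeomorph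
      refine .of_comp _ hopenM.isOpenEmbedding_subtypeVal ?_
      have h1 := φ.isOpenEmbedding_comp_val Metric.isOpen_ball
        (Metric.ball_subset_closedBall.trans hb)
      have h2 : IsOpenEmbedding fun p : S2 × Ioo (0 : ℝ) 1 =>
          (⟨(p.2 : ℝ) • (p.1 : E3), by
            rw [mem_ball_zero_iff, hnorm]; exact p.2.2.2⟩ : Metric.ball (0 : E3) 1) :=
        .of_comp _ Metric.isOpen_ball.isOpenEmbedding_subtypeVal (isOpenEmbedding_shell le_rfl)
      have h3 := h1.comp h2
      rw [hφ] at h3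
      exact h3
  let α : C(ι × (S2 × Ioo (0 : ℝ) 1), {m : M // ∀ s, m ≠ h s 0}) := ⟨α₀, hαo.continuous⟩
  choose b hb using hβv
  have hbc : Continuous b := by
    rw [hg.isInducing.continuous_iff]
    have : g ∘ b = fun p => κ (p.1, j p.2) := funext hb
    rw [this]
    exact hκ.continuous.comp (continuous_fst.prodMk (hjc.comp continuous_snd))
  let β : C(ι × (S2 × Ioo (0 : ℝ) 1), V) := ⟨b, hbc⟩
  refine nonempty_fundamentalGroup_mulEquiv_coprod (iU := e) (iV := iV) (α := α) (β := β)
    hee hiV ?_ hαo (fun p => ?_) ?_ s₀ z u v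
  · rw [eq_univ_iff_forall]
    have hleft : ∀ p, Glue.inl R p ∈ range e := by
      intro p
      refine ⟨⟨p, fun s hs => ?_⟩, he1 _ p.2⟩
      exact (hcl _).1 p.2 s ⟨0, Metric.mem_ball_self one_pos, hs.symm⟩
    refine Glue.ind (fun p => Or.inl (hleft p)) fun y => ?_
    by_cases hy : y ∈ range g
    · obtain ⟨v, rfl⟩ := hy
      exact Or.inr ⟨v, rfl⟩
    · rw [hgr] at hy
      push Not at hy
      obtain ⟨s, x, rfl⟩ := hy
      have hxb : (x : E3) ∈ ball3 := Metric.sphere_subset_closedBall x.2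
      have hne0 : ∀ s', h s x ≠ h s' 0 := by
        intro s' heq
        have h0 : (0 : E3) ∈ ball3 := Metric.mem_closedBall_self zero_le_one
        by_cases hss : s = s'
        · subst hss
          exact ne_zero_of_mem_unit_sphere x ((hh s).injOn hxb h0 heq)
        · exact disjoint_left.1 (hdis s s' hss) ⟨_, hxb, rfl⟩ ⟨0, h0, heq.symm⟩
      exact Or.inl ⟨⟨h s x, hne0⟩, he2 _ s x topParam (by simp [topParam])⟩
  · show e (α₀ p) = Glue.inr R (g (b p))
    rw [hαe, hb]
  · intro u v huv
    by_cases hu : (u : M) ∈ closure (univ \ D)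
    · rw [he1 u hu] at huv
      exact (hgR _ _ (hRb.inl_eq_inr_iff.1 huv)).elim
    · rw [hcl] at hu
      push Not at hu
      obtain ⟨s, y, hy, hyu⟩ := hu
      have hy0 : y ≠ 0 := by rintro rfl; exact u.2 s hyu.symm
      obtain ⟨x, hx⟩ := exists_smul_S2 hy0
      refine ⟨(s, x, ⟨‖y‖, norm_pos_iff.2 hy0, mem_ball_zero_iff.1 hy⟩), Subtype.ext ?_⟩
      show h s (‖y‖ • (x : E3)) = u
      rw [← hx, hyu]

end Glue

/-! ### Removing points and discs from a manifold -/

section Punctured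

variable {N : Type*} [TopologicalSpace N] [T2Space N] [LocallyPathConnectedSpace N]

/-- Removing the centre of a disc from a connected open set changes neither its connectedness
nor its fundamental group. -/
theorem IsTameDisc.diff_center {f : E3 → N} (hf : IsTameDisc f) {O : Set N} (hO : IsOpen O)
    (hOc : IsConnected O) (hfO : f '' ball3 ⊆ O) :
    IsOpen (O \ {f 0}) ∧ IsConnected (O \ {f 0}) ∧ ∀ (x : O) (y : ↥(O \ {f 0})),
      Nonempty (FundamentalGroup O x ≃* FundamentalGroup ↥(O \ {f 0}) y) := by
  obtain ⟨φ, rfl, hb⟩ := hf.exists_openPartialHomeomorph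
  have h0 : φ '' Metric.closedBall 0 0 = {φ 0} := by
    rw [Metric.closedBall_zero, image_singleton]
  rw [← h0]
  have h1 : Metric.ball 0 1 ⊆ φ.source := Metric.ball_subset_closedBall.trans hb
  have h2 : φ '' Metric.ball 0 1 ⊆ O := (image_mono Metric.ball_subset_closedBall).trans hfO
  obtain ⟨h3, h4⟩ := isConnected_diff_ball hO hOc φ le_rfl one_pos h1 h2
  exact ⟨h3, h4, nonempty_fundamentalGroup_diff_ball_mulEquiv hO hOc φ le_rfl one_pos h1 h2⟩

/-- Removing a disc changes neither connectedness nor the fundamental group. -/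
theorem IsTameDisc.diff_disc [ConnectedSpace N] {f : E3 → N} (hf : IsTameDisc f) :
    IsOpen (univ \ f '' ball3) ∧ IsConnected (univ \ f '' ball3) ∧
    ∀ (x : N) (y : ↥(univ \ f '' ball3)),
      Nonempty (FundamentalGroup N x ≃* FundamentalGroup ↥(univ \ f '' ball3) y) := by
  obtain ⟨φ, rfl, hb⟩ := hf.exists_openPartialHomeomorph
  obtain ⟨δ, hδ, hs⟩ := exists_ball_subset φ.open_source hb
  have h1 : (1 : ℝ) < 1 + δ := by linarith
  obtain ⟨h3, h4⟩ := isConnected_diff_ball isOpen_univ isConnected_univ φ zero_le_one h1 hs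
    (subset_univ _)
  refine ⟨h3, h4, fun x y => ?_⟩
  have : PathConnectedSpace (univ : Set N) := isPathConnected_iff_pathConnectedSpace.1
    (isOpen_univ.isConnected_iff_isPathConnected.1 isConnected_univ)
  obtain ⟨e⟩ := nonempty_fundamentalGroup_mulEquiv_of_homeomorph (Homeomorph.Set.univ N).symm x
    ⟨x, mem_univ x⟩
  obtain ⟨e'⟩ := nonempty_fundamentalGroup_diff_ball_mulEquiv isOpen_univ isConnected_univ φ
    zero_le_one h1 hs (subset_univ _) ⟨x, mem_univ x⟩ y
  exact ⟨e.trans e'⟩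

/-- Removing the centres of finitely many disjoint discs changes neither connectedness nor the
fundamental group. -/
theorem diff_centers [ConnectedSpace N] {ι : Type*} {h : ι → E3 → N}
    (hh : ∀ s, IsTameDisc (h s))
    (hdis : ∀ s t, s ≠ t → Disjoint (h s '' ball3) (h t '' ball3)) (F : Finset ι) :
    IsOpen {m | ∀ s ∈ F, m ≠ h s 0} ∧ IsConnected {m | ∀ s ∈ F, m ≠ h s 0} ∧
      ∀ (x : N) (y : {m // ∀ s ∈ F, m ≠ h s 0}),
        Nonempty (FundamentalGroup N x ≃* FundamentalGroup {m // ∀ s ∈ F, m ≠ h s 0} y) := by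
  classical
  induction F using Finset.induction_on with
  | empty =>
    have h0 : {m : N | ∀ s ∈ (∅ : Finset ι), m ≠ h s 0} = univ := by
      ext m; simp
    rw [h0]
    refine ⟨isOpen_univ, isConnected_univ, fun x y => ?_⟩
    have : PathConnectedSpace N :=
      pathConnectedSpace_iff_connectedSpace.2 inferInstance
    have e : {m // ∀ s ∈ (∅ : Finset ι), m ≠ h s 0} ≃ₜ N :=
      (Homeomorph.setCongr h0).trans (Homeomorph.Set.univ N)
    obtain ⟨f⟩ := nonempty_fundamentalGroup_mulEquiv_of_homeomorph e y x
    exact ⟨f.symm⟩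
  | insert s F hs ih =>
    obtain ⟨h1, h2, h3⟩ := ih
    have hset : {m | ∀ t ∈ insert s F, m ≠ h t 0} = {m | ∀ t ∈ F, m ≠ h t 0} \ {h s 0} := by
      ext m
      simp only [Finset.mem_insert, forall_eq_or_imp, mem_setOf_eq, mem_diff, mem_singleton_iff]
      tauto
    have hsub : h s '' ball3 ⊆ {m | ∀ t ∈ F, m ≠ h t 0} := by
      rintro m hm t ht rfl
      refine disjoint_left.1 (hdis s t ?_) hm ⟨0, Metric.mem_closedBall_self zero_le_one, rfl⟩
      rintro rfl
      exact hs ht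
    obtain ⟨g1, g2, g3⟩ := (hh s).diff_center h1 h2 hsub
    rw [hset]
    refine ⟨g1, g2, fun x => ?_⟩
    show ∀ y : ↥{m | ∀ t ∈ insert s F, m ≠ h t 0}, Nonempty (FundamentalGroup N x ≃*
      FundamentalGroup ↥{m | ∀ t ∈ insert s F, m ≠ h t 0} y)
    rw [hset]
    intro y
    obtain ⟨e⟩ := h3 x ⟨y, y.2.1⟩
    obtain ⟨e'⟩ := g3 ⟨y, y.2.1⟩ y
    exact ⟨e.trans e'⟩

theorem nonempty_fundamentalGroup_compl_centers_mulEquiv [ConnectedSpace N] {ι : Type*} [Finite ι]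
    {h : ι → E3 → N} (hh : ∀ s, IsTameDisc (h s))
    (hdis : ∀ s t, s ≠ t → Disjoint (h s '' ball3) (h t '' ball3)) :
    PathConnectedSpace {m // ∀ s, m ≠ h s 0} ∧ ∀ (x : N) (y : {m // ∀ s, m ≠ h s 0}),
        Nonempty (FundamentalGroup N x ≃* FundamentalGroup {m // ∀ s, m ≠ h s 0} y) := by
  have := Fintype.ofFinite ι
  obtain ⟨h1, h2, h3⟩ := diff_centers hh hdis Finset.univ
  simp only [Finset.mem_univ, true_imp_iff] at h1 h2
  have : PathConnectedSpace {m // ∀ s, m ≠ h s 0} :=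
    isPathConnected_iff_pathConnectedSpace.1 (h1.isConnected_iff_isPathConnected.1 h2)
  refine ⟨inferInstance, fun x y => ?_⟩
  obtain ⟨e⟩ := h3 x ⟨y, fun s _ => y.2 s⟩
  let f : {m // ∀ s ∈ Finset.univ, m ≠ h s 0} ≃ₜ {m // ∀ s, m ≠ h s 0} := Homeomorph.setCongr
    (s := {m | ∀ s ∈ Finset.univ, m ≠ h s 0}) (t := {m | ∀ s, m ≠ h s 0}) (by simp)
  obtain ⟨e'⟩ := nonempty_fundamentalGroup_mulEquiv_of_homeomorph f ⟨y, fun s _ => y.2 s⟩ y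
  exact ⟨e.trans e'⟩

end Punctured

/-! ### The two points of the zero sphere -/

section ZeroSphere

theorem S0.eq_or (s : S0) : (s : ℝ) = 1 ∨ (s : ℝ) = -1 := by
  have := s.2
  rw [mem_sphere_zero_iff_norm, Real.norm_eq_abs] at this
  exact eq_or_eq_neg_of_abs_eq this

/-- The point `1` of `S⁰`. -/
def S0.pos : S0 := ⟨1, by simp⟩

/-- The point `-1` of `S⁰`. -/
def S0.neg : S0 := ⟨-1, by simp⟩

theorem S0.pos_ne_neg : S0.pos ≠ S0.neg := fun h => by
  have : (1 : ℝ) = -1 := congrArg Subtype.val h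
  norm_num at this

theorem S0.eq_pos_or_eq_neg (s : S0) : s = S0.pos ∨ s = S0.neg :=
  s.eq_or.imp (fun h => Subtype.ext h) fun h => Subtype.ext h

instance : Finite S0 := by
  refine Finite.of_surjective (fun b : Bool => if b then S0.pos else S0.neg) fun s => ?_
  rcases s.eq_pos_or_eq_neg with rfl | rfl
  exacts [⟨true, rfl⟩, ⟨false, rfl⟩]

instance : DiscreteTopology S0 := inferInstance

instance : Unique {s : S0 // s ≠ S0.pos} where
  default := ⟨S0.neg, S0.pos_ne_neg.symm⟩
  uniq s := Subtype.ext (s.1.eq_pos_or_eq_neg.resolve_left s.2)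

theorem S0.mul_self (s : S0) : (s : ℝ) * s = 1 := by
  rcases s.eq_or with h | h <;> rw [h] <;> norm_num

end ZeroSphere

/-! ### Fundamental group of the surgery -/

section ZeroSurgery

/-- The collar of the boundary of `D¹ × S²`. -/
def handleCollar (p : S0 × (S2 × Ioc (0 : ℝ) 1)) : D1 × S2 :=
  (⟨p.1 * p.2.2, by
    rw [mem_closedBall_zero_iff, norm_mul, norm_eq_of_mem_sphere, one_mul, Real.norm_eq_abs,
      abs_of_pos p.2.2.2.1]
    exact p.2.2.2.2⟩, p.2.1)

theorem isOpenEmbedding_handleCollar : IsOpenEmbedding handleCollar := by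
  refine isOpenEmbedding_of_slices ?_ fun s => ?_
  · rintro ⟨s, x, t⟩ ⟨s', x', t'⟩ h
    have h1 : (s : ℝ) * t = s' * t' := congrArg (fun q : D1 × S2 => (q.1 : ℝ)) h
    have h2 : x = x' := congrArg Prod.snd h
    have ht := t.2.1
    have ht' := t'.2.1
    have h3 : s = s' := by
      rcases s.eq_or with hs | hs <;> rcases s'.eq_or with hs' | hs' <;> rw [hs, hs'] at h1
      · exact Subtype.ext (hs.trans hs'.symm)
      · linarith
      · linarith
      · exact Subtype.ext (hs.trans hs'.symm)
    subst h3 h2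
    have h4 : (t : ℝ) = t' := mul_left_cancel₀ (ne_zero_of_mem_unit_sphere s) h1
    rw [Subtype.ext h4]
  · let f : Ioc (0 : ℝ) 1 → D1 := fun t => ⟨s * t, by
      rw [mem_closedBall_zero_iff, norm_mul, norm_eq_of_mem_sphere, one_mul, Real.norm_eq_abs,
        abs_of_pos t.2.1]
      exact t.2.2⟩
    have hf : IsOpenEmbedding f := by
      constructor
      · refine .of_comp (by fun_prop) continuous_subtype_val ?_
        exact (Homeomorph.mulLeft₀ (s : ℝ) (ne_zero_of_mem_unit_sphere s)).isEmbedding.comp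
          IsEmbedding.subtypeVal
      · have : range f = {d : D1 | 0 < (s : ℝ) * d} := by
          ext d
          constructor
          · rintro ⟨t, rfl⟩
            show 0 < (s : ℝ) * (s * t)
            rw [← mul_assoc, s.mul_self, one_mul]
            exact t.2.1
          · intro hd
            have hd1 : ‖(d : ℝ)‖ ≤ 1 := mem_closedBall_zero_iff.1 d.2
            refine ⟨⟨s * d, hd, (le_abs_self _).trans ?_⟩, Subtype.ext ?_⟩
            · rw [abs_mul, ← Real.norm_eq_abs, norm_eq_of_mem_sphere, one_mul]
              exact hd1
            · show (s : ℝ) * (s * d) = d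
              rw [← mul_assoc, s.mul_self, one_mul]
        rw [this]
        exact isOpen_lt continuous_const (by fun_prop)
    exact (hf.prodMap IsOpenEmbedding.id).comp (Homeomorph.prodComm S2 (Ioc (0 : ℝ) 1)).isOpenEmbedding

variable {M : Type*} [TopologicalSpace M] [T2Space M]

theorem zeroSurgery_rel_iff {h : S0 → E3 → M} (p : M) (q : D1 × S2) :
    (∃ s : S0, (s : ℝ) = q.1 ∧ p = h s q.2) ↔
      ∃ s, ∃ x : S2, p = h s x ∧ q = handleCollar (s, x, topParam) := by
  have hk : ∀ s x, handleCollar (s, x, topParam) =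
      (⟨s, Metric.sphere_subset_closedBall s.2⟩, x) := fun s x =>
    Prod.ext (Subtype.ext (mul_one _)) rfl
  constructor
  · rintro ⟨s, hs, hp⟩
    exact ⟨s, q.2, hp, by rw [hk]; exact Prod.ext (Subtype.ext hs.symm) rfl⟩
  · rintro ⟨s, x, hp, rfl⟩
    rw [hk]
    exact ⟨s, rfl, hp⟩

/-- The open handle `(-1, 1) × S²` is simply connected and meets `M` in two shells. The second shell
gives a loop running once over the handle, which generates the factor `ℤ`. -/
theorem nonempty_fundamentalGroup_zeroSurgery_mulEquiv [ConnectedSpace M]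
    [LocallyPathConnectedSpace M] {h : S0 → E3 → M} (hh : IsFramedEmbedding h)
    (z : ZeroSurgery h) (m : M) :
    Nonempty (FundamentalGroup (ZeroSurgery h) z ≃*
      Monoid.Coprod (FundamentalGroup M m) (Multiplicative ℤ)) := by
  obtain ⟨hpc, hM⟩ := nonempty_fundamentalGroup_compl_centers_mulEquiv hh.tame hh.disjoint
  have := hpc
  have : Fact ((-1 : ℝ) < 1) := ⟨by norm_num⟩
  obtain ⟨u⟩ : Nonempty {m : M // ∀ s, m ≠ h s 0} := inferInstance
  obtain ⟨x⟩ : Nonempty S2 := inferInstance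
  let g₀ : Ioo (-1 : ℝ) 1 → D1 := fun t => ⟨t, by
    rw [mem_closedBall_zero_iff, Real.norm_eq_abs]
    exact (abs_lt.2 t.2).le⟩
  have hg₀ : IsOpenEmbedding g₀ := by
    constructor
    · exact .of_comp (by fun_prop) continuous_subtype_val IsEmbedding.subtypeVal
    · have : range g₀ = Subtype.val ⁻¹' Ioo (-1 : ℝ) 1 := by
        ext d
        constructor
        · rintro ⟨t, rfl⟩; exact t.2
        · intro hd; exact ⟨⟨d, hd⟩, rfl⟩
      rw [this]
      exact isOpen_Ioo.preimage continuous_subtype_val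
  obtain ⟨e⟩ := nonempty_fundamentalGroup_glue_mulEquiv (D := removed h) hh.tame hh.disjoint rfl
    isOpenEmbedding_handleCollar (fun p q => zeroSurgery_rel_iff (p : M) q)
    (hg₀.prodMap (IsOpenEmbedding.id (X := S2))) (by
      rintro ⟨d, x⟩
      constructor
      · rintro ⟨⟨t, x'⟩, htx⟩ s x'' heq
        rw [heq] at htx
        have h1 : (t : ℝ) = s * 1 := congrArg (fun q : D1 × S2 => (q.1 : ℝ)) htx
        have := t.2
        rcases s.eq_or with hs | hs <;> rw [hs] at h1 <;> linarith [this.1, this.2]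
      · intro hne
        have hd : |(d : ℝ)| ≤ 1 := mem_closedBall_zero_iff.1 d.2
        have hd' : |(d : ℝ)| ≠ 1 := fun h1 => hne ⟨d, mem_sphere_zero_iff_norm.2 h1⟩ x
          (Prod.ext (Subtype.ext (mul_one _).symm) rfl)
        exact ⟨(⟨d, abs_lt.1 (lt_of_le_of_ne hd hd')⟩, x), rfl⟩)
    S0.pos z u (⟨0, by norm_num⟩, x)
  obtain ⟨e'⟩ := hM m u
  exact ⟨e.trans (((coprodSubsingleton _ _).trans e'.symm).coprodCongr
    (FreeGroup.mulEquivIntOfUnique))⟩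

end ZeroSurgery

/-! ### Fundamental group of the connected sum -/

section ConnectedSum

variable {M N : Type*} [TopologicalSpace M] [T2Space M] [TopologicalSpace N] [T2Space N]

theorem IsTameDisc.mem_closure {j : E3 → N} (hj : IsTameDisc j) {n : N} :
    n ∈ closure (univ \ j '' ball3) ↔ n ∉ j '' Metric.ball 0 1 := by
  refine (mem_closure_compl_discs (ι := Unit) (h := fun _ => j) (fun _ => hj)
    (fun s t hst => (hst rfl).elim) (by rw [iUnion_const])).trans ?_
  simp

/-- The collar lies outside the disc: the parameter `1` is the boundary sphere, and the radius grows
to `1 + δ` as the parameter tends to `0`. -/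
theorem IsTameDisc.exists_collar {j : E3 → N} (hj : IsTameDisc j) :
    ∃ κ : Unit × (S2 × Ioc (0 : ℝ) 1) → closure (univ \ j '' ball3), IsOpenEmbedding κ ∧
      ∀ x : S2, (κ ((), x, topParam) : N) = j x := by
  have hcl := fun n => hj.mem_closure (n := n)
  obtain ⟨φ, rfl, hb⟩ := hj.exists_openPartialHomeomorph
  obtain ⟨δ₀, hδ₀, hs⟩ := exists_ball_subset φ.open_source hb
  -- The bound `1 / 2` keeps the radius `1 + δ * (1 - t)` positive for all `t < 2`. The parameter is
  -- first allowed to exceed `1` in order to obtain an open subset of `N`.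
  let δ := min δ₀ (1 / 2)
  have hδ : 0 < δ := lt_min hδ₀ (by norm_num)
  have hδ1 : δ ≤ 1 / 2 := min_le_right _ _
  have hs' : Metric.ball 0 (1 + δ) ⊆ φ.source :=
    (Metric.ball_subset_ball (by linarith [min_le_left δ₀ (1 / 2)])).trans hs
  let r : Ioo (0 : ℝ) 2 → ℝ := fun t => 1 + δ * (1 - t)
  have hrpos : ∀ t, 0 < r t := fun t => by
    have := t.2.2
    simp only [r]; nlinarith
  have hr : IsOpenEmbedding r := by
    have h1 : IsOpenEmbedding fun t : ℝ => 1 + δ * (1 - t) :=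
      ((Homeomorph.subLeft (1 : ℝ)).trans ((Homeomorph.mulLeft₀ δ hδ.ne').trans
        (Homeomorph.addLeft (1 : ℝ)))).isOpenEmbedding
    exact h1.comp isOpen_Ioo.isOpenEmbedding_subtypeVal
  have hnorm : ∀ (x : S2) t, ‖r t • (x : E3)‖ = r t := fun x t => norm_smul_S2 x (hrpos t).le
  have hmem : ∀ (x : S2) t, r t • (x : E3) ∈ Metric.ball (0 : E3) (1 + δ) := fun x t => by
    rw [mem_ball_zero_iff, hnorm]
    have := t.2.1
    simp only [r]; nlinarith
  let P : S2 × Ioo (0 : ℝ) 2 → Metric.ball (0 : E3) (1 + δ) := fun p => ⟨r p.2 • p.1, hmem _ _⟩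
  have hP : IsOpenEmbedding P :=
    .of_comp _ Metric.isOpen_ball.isOpenEmbedding_subtypeVal (isOpenEmbedding_polar hr hrpos)
  have hF := (φ.isOpenEmbedding_comp_val Metric.isOpen_ball hs').comp hP
  let inc : Ioc (0 : ℝ) 1 → Ioo (0 : ℝ) 2 := fun t => ⟨t, t.2.1, by linarith [t.2.2]⟩
  have hinc : IsEmbedding inc :=
    .of_comp (by fun_prop) continuous_subtype_val IsEmbedding.subtypeVal
  have hκm : ∀ (x : S2) (t : Ioc (0 : ℝ) 1),
      φ (P (x, inc t)) ∈ closure (univ \ φ '' ball3) := by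
    intro x t
    rw [hcl]
    rintro ⟨y, hy, heq⟩
    have := φ.injOn (hb (Metric.ball_subset_closedBall hy)) (hs' (P (x, inc t)).2) heq
    have h1 : ‖y‖ = r (inc t) := by rw [this]; exact hnorm _ _
    rw [mem_ball_zero_iff, h1] at hy
    have h2 := t.2.2
    have h3 : r (inc t) = 1 + δ * (1 - t) := rfl
    nlinarith
  let κ : Unit × (S2 × Ioc (0 : ℝ) 1) → closure (univ \ φ '' ball3) := fun p =>
    ⟨φ (P (p.2.1, inc p.2.2)), hκm _ _⟩
  have hκe : IsEmbedding κ := by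
    have h1 : IsEmbedding (Subtype.val ∘ κ) :=
      hF.isEmbedding.comp ((IsEmbedding.id.prodMap hinc).comp
        (Homeomorph.punitProd (S2 × Ioc (0 : ℝ) 1)).isEmbedding)
    exact .of_comp (h1.continuous.subtype_mk _) continuous_subtype_val h1
  refine ⟨κ, ⟨hκe, ?_⟩, fun x => ?_⟩
  · have : range κ = Subtype.val ⁻¹' range (fun p => φ (P p)) := by
      ext y
      constructor
      · rintro ⟨p, rfl⟩
        exact ⟨_, rfl⟩
      · rintro ⟨⟨x, t⟩, hxt⟩
        have ht : (t : ℝ) ≤ 1 := by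
          by_contra hlt
          refine (hcl y).1 y.2 ⟨P (x, t), ?_, hxt⟩
          rw [mem_ball_zero_iff]
          refine (hnorm x t).trans_lt ?_
          have h3 : r t = 1 + δ * (1 - t) := rfl
          nlinarith
        exact ⟨((), x, ⟨t, t.2.1, ht⟩), Subtype.ext hxt⟩
    rw [this]
    exact hF.isOpen_range.preimage continuous_subtype_val
  · show φ (r (inc topParam) • (x : E3)) = φ x
    simp [r, inc, topParam]

/-- With a single disc there is a single shell and hence no free generator; the second piece is `N`
without the closed disc, which has the same group as `N`. -/
theorem nonempty_fundamentalGroup_connectedSum_mulEquiv [ConnectedSpace M]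
    [LocallyPathConnectedSpace M] [ConnectedSpace N] [LocallyPathConnectedSpace N]
    {i : E3 → M} {j : E3 → N} (hi : IsTameDisc i) (hj : IsTameDisc j)
    (z : ConnectedSum i j) (m : M) (n : N) :
    Nonempty (FundamentalGroup (ConnectedSum i j) z ≃*
      Monoid.Coprod (FundamentalGroup M m) (FundamentalGroup N n)) := by
  have hdis : ∀ s t : Unit, s ≠ t → Disjoint (i '' ball3) (i '' ball3) :=
    fun s t hst => (hst rfl).elim
  obtain ⟨hpc, hM⟩ := nonempty_fundamentalGroup_compl_centers_mulEquiv (ι := Unit)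
    (h := fun _ => i) (fun _ => hi) hdis
  obtain ⟨hVo, hVc, hN⟩ := hj.diff_disc
  have := hpc
  have : PathConnectedSpace ↥(univ \ j '' ball3) :=
    isPathConnected_iff_pathConnectedSpace.1 (hVo.isConnected_iff_isPathConnected.1 hVc)
  obtain ⟨u⟩ : Nonempty {m : M // ∀ _ : Unit, m ≠ i 0} := inferInstance
  obtain ⟨v⟩ : Nonempty ↥(univ \ j '' ball3) := inferInstance
  obtain ⟨κ, hκ, hκj⟩ := hj.exists_collar
  let g : ↥(univ \ j '' ball3) → closure (univ \ j '' ball3) := fun v => ⟨v, subset_closure v.2⟩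
  have hgr : range g = Subtype.val ⁻¹' (univ \ j '' ball3) := by
    ext y
    exact ⟨by rintro ⟨v, rfl⟩; exact v.2, fun hy => ⟨⟨y, hy⟩, rfl⟩⟩
  have hg : IsOpenEmbedding g := by
    constructor
    · exact .of_comp (by fun_prop) continuous_subtype_val IsEmbedding.subtypeVal
    · rw [hgr]
      exact hVo.preimage continuous_subtype_val
  obtain ⟨e⟩ := nonempty_fundamentalGroup_glue_mulEquiv (ι := Unit) (h := fun _ => i)
    (D := i '' ball3) (fun _ => hi) hdis (by rw [iUnion_const]) hκ
    (R := fun p q => ∃ x : S2, (p : M) = i x ∧ (q : N) = j x) (by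
      intro p y
      constructor
      · rintro ⟨x, hx, hy⟩
        exact ⟨(), x, hx, Subtype.ext (hy.trans (hκj x).symm)⟩
      · rintro ⟨-, x, hx, rfl⟩
        exact ⟨x, hx, hκj x⟩)
    hg (by
      intro y
      rw [hgr]
      constructor
      · rintro hy s x rfl
        exact hy.2 ⟨x, Metric.sphere_subset_closedBall x.2, (hκj x).symm⟩
      · intro hne
        refine ⟨mem_univ _, ?_⟩
        rintro ⟨w, hw, hwy⟩
        have hw1 : ‖w‖ = 1 := by
          refine le_antisymm (mem_closedBall_zero_iff.1 hw) (not_lt.1 fun hlt => ?_)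
          exact hj.mem_closure.1 y.2 ⟨w, mem_ball_zero_iff.2 hlt, hwy⟩
        exact hne () ⟨w, mem_sphere_zero_iff_norm.2 hw1⟩
          (Subtype.ext (hwy.symm.trans (hκj ⟨w, mem_sphere_zero_iff_norm.2 hw1⟩).symm)))
    () z u v
  have : IsEmpty {k : Unit // k ≠ ()} := ⟨fun k => k.2 rfl⟩
  obtain ⟨e₁⟩ := hM m u
  obtain ⟨e₂⟩ := hN n v
  exact ⟨e.trans ((coprodSubsingleton _ _).trans (e₁.symm.coprodCongr e₂.symm))⟩

end ConnectedSum

/-! ### Comparison of the fundamental groups -/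

section FundamentalGroups

instance locallyPathConnectedSpace_S1xS2 : LocallyPathConnectedSpace S1xS2 :=
  have : LocallyPathConnectedSpace (ModelProd (EuclideanSpace ℝ (Fin 1))
      (EuclideanSpace ℝ (Fin 2))) :=
    inferInstanceAs (LocallyPathConnectedSpace
      (EuclideanSpace ℝ (Fin 1) × EuclideanSpace ℝ (Fin 2)))
  ChartedSpace.locallyPathConnectedSpace
    (ModelProd (EuclideanSpace ℝ (Fin 1)) (EuclideanSpace ℝ (Fin 2))) S1xS2

instance connectedSpace_circle : ConnectedSpace Circle :=
  Function.Surjective.connectedSpace (f := Circle.exp) (fun z => ⟨_, Circle.exp_arg z⟩)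
    Circle.exp.continuous

variable {M : Type*} [TopologicalSpace M] [T2Space M] [ConnectedSpace M]
  [LocallyPathConnectedSpace M]

theorem fundamentalGroup_zeroSurgery_connectedSum {h : S0 → E3 → M} (hh : IsFramedEmbedding h)
    {i : E3 → M} {j : E3 → S1xS2} (hi : IsTameDisc i) (hj : IsTameDisc j)
    (x : ZeroSurgery h) (y : ConnectedSum i j) (m : M) (a : Circle) (b : S2) :
    Nonempty (FundamentalGroup (ZeroSurgery h) x ≃* FundamentalGroup (ConnectedSum i j) y) ∧
    Nonempty (FundamentalGroup (ConnectedSum i j) y ≃*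
      Monoid.Coprod (FundamentalGroup M m) (FundamentalGroup S1xS2 (a, b))) ∧
    Nonempty (Monoid.Coprod (FundamentalGroup M m) (FundamentalGroup S1xS2 (a, b)) ≃*
      Monoid.Coprod (FundamentalGroup M m) (FundamentalGroup Circle a × FundamentalGroup S2 b)) := by
  obtain ⟨e₁⟩ := nonempty_fundamentalGroup_zeroSurgery_mulEquiv hh x m
  obtain ⟨e₂⟩ := nonempty_fundamentalGroup_connectedSum_mulEquiv hi hj y m (a, b)
  obtain ⟨e₃⟩ := nonempty_fundamentalGroup_prod_mulEquiv a b
  obtain ⟨e₄⟩ := nonempty_fundamentalGroup_circle_mulEquiv a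
  have e₅ : FundamentalGroup S1xS2 (a, b) ≃* Multiplicative ℤ :=
    e₃.trans ((e₄.prodCongr (mulEquivPUnit _)).trans MulEquiv.prodUnique)
  exact ⟨⟨e₁.trans (((MulEquiv.refl _).coprodCongr e₅.symm).trans e₂.symm)⟩, ⟨e₂⟩,
    ⟨(MulEquiv.refl _).coprodCongr e₃⟩⟩

end FundamentalGroups

/-! ### Homeomorphisms of `ℝ³` with small support -/

section Cutoff

/-- A piecewise linear cutoff function. -/
def cutoff (p : E3) (ε : ℝ) (x : E3) : ℝ := max 0 (min 1 (2 - 2 / ε * dist x p))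

variable {p : E3} {ε : ℝ}

theorem cutoff_nonneg (x : E3) : 0 ≤ cutoff p ε x := le_max_left _ _

theorem cutoff_le_one (x : E3) : cutoff p ε x ≤ 1 := max_le zero_le_one (min_le_left _ _)

theorem cutoff_eq_one (hε : 0 < ε) {x : E3} (hx : dist x p ≤ ε / 2) : cutoff p ε x = 1 := by
  have h1 : 2 / ε * dist x p ≤ 1 := by
    calc 2 / ε * dist x p ≤ 2 / ε * (ε / 2) := by gcongr
      _ = 1 := by field_simp
  rw [cutoff, min_eq_left (by linarith), max_eq_right zero_le_one]

theorem cutoff_eq_zero (hε : 0 < ε) {x : E3} (hx : ε ≤ dist x p) : cutoff p ε x = 0 := by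
  have h1 : 2 ≤ 2 / ε * dist x p := by
    calc (2 : ℝ) = 2 / ε * ε := by field_simp
      _ ≤ 2 / ε * dist x p := by gcongr
  exact max_eq_left ((min_le_right _ _).trans (by linarith))

theorem abs_cutoff_sub_le (hε : 0 < ε) (x y : E3) :
    |cutoff p ε x - cutoff p ε y| ≤ 2 / ε * ‖x - y‖ := by
  have h1 : ∀ a b : ℝ, |max 0 (min 1 a) - max 0 (min 1 b)| ≤ |a - b| := by
    intro a b
    refine (abs_max_sub_max_le_max _ _ _ _).trans (max_le (by simp) ?_)
    exact (abs_min_sub_min_le_max _ _ _ _).trans (max_le (by simp) le_rfl)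
  refine (h1 _ _).trans ?_
  have h2 : (2 - 2 / ε * dist x p) - (2 - 2 / ε * dist y p) = 2 / ε * (dist y p - dist x p) := by
    ring
  rw [h2, abs_mul, abs_of_pos (by positivity)]
  gcongr
  rw [← dist_eq_norm, dist_comm x y]
  exact abs_dist_sub_le y x p

/-- The product rule bounds the Lipschitz constant by `1 / 4 + (2 / ε) * (ε / 4) = 3 / 4`. Being
less than `1`, it makes the identity plus this map a homeomorphism. -/
theorem norm_cutoff_smul_sub_le {u : E3 → E3} (hε : 0 < ε)
    (hu : ∀ x, dist x p ≤ ε → ∀ y, dist y p ≤ ε → ‖u x - u y‖ ≤ 1 / 4 * ‖x - y‖)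
    (hb : ∀ x, dist x p ≤ ε → ‖u x‖ ≤ ε / 4) (x y : E3) :
    ‖cutoff p ε x • u x - cutoff p ε y • u y‖ ≤ 3 / 4 * ‖x - y‖ := by
  have key : ∀ a b : E3, dist b p ≤ ε →
      ‖(cutoff p ε a - cutoff p ε b) • u b‖ ≤ 1 / 2 * ‖a - b‖ := by
    intro a b hbp
    rw [norm_smul, Real.norm_eq_abs]
    calc |cutoff p ε a - cutoff p ε b| * ‖u b‖ ≤ (2 / ε * ‖a - b‖) * (ε / 4) := by
          gcongr
          exacts [abs_cutoff_sub_le hε a b, hb b hbp]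
      _ = 1 / 2 * ‖a - b‖ := by field_simp; ring
  have hn := norm_nonneg (x - y)
  by_cases hx : dist x p ≤ ε <;> by_cases hy : dist y p ≤ ε
  · have h1 : cutoff p ε x • u x - cutoff p ε y • u y =
        cutoff p ε x • (u x - u y) + (cutoff p ε x - cutoff p ε y) • u y := by module
    rw [h1]
    refine (norm_add_le _ _).trans ?_
    have h2 : ‖cutoff p ε x • (u x - u y)‖ ≤ 1 / 4 * ‖x - y‖ := by
      rw [norm_smul, Real.norm_of_nonneg (cutoff_nonneg x)]
      calc cutoff p ε x * ‖u x - u y‖ ≤ 1 * (1 / 4 * ‖x - y‖) := by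
            gcongr
            exacts [cutoff_le_one x, hu x hx y hy]
        _ = _ := one_mul _
    linarith [key x y hy]
  · have h0 := cutoff_eq_zero hε (not_le.1 hy).le
    have h1 := key y x hx
    rw [h0, zero_sub, neg_smul, norm_neg, norm_sub_rev] at h1
    rw [h0, zero_smul, sub_zero]
    linarith
  · have h0 := cutoff_eq_zero hε (not_le.1 hx).le
    have h1 := key x y hy
    rw [h0, zero_sub, neg_smul, norm_neg] at h1
    rw [h0, zero_smul, zero_sub, norm_neg]
    linarith
  · rw [cutoff_eq_zero hε (not_le.1 hy).le, cutoff_eq_zero hε (not_le.1 hx).le]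
    simp only [zero_smul, sub_zero, norm_zero]
    positivity

/-- A small perturbation of the identity can be cut off to a homeomorphism. -/
theorem exists_homeomorph_of_small {u : E3 → E3} (hε : 0 < ε)
    (hu : ∀ x, dist x p ≤ ε → ∀ y, dist y p ≤ ε → ‖u x - u y‖ ≤ 1 / 4 * ‖x - y‖)
    (hb : ∀ x, dist x p ≤ ε → ‖u x‖ ≤ ε / 4) :
    ∃ G : E3 ≃ₜ E3, (∀ x, dist x p ≤ ε / 2 → G x = x + u x) ∧ ∀ x, ε ≤ dist x p → G x = x := by
  have h1 : ApproximatesLinearOn (fun x => x + cutoff p ε x • u x)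
      ((ContinuousLinearEquiv.refl ℝ E3 : E3 ≃L[ℝ] E3) : E3 →L[ℝ] E3) univ (3 / 4) := by
    intro x _ y _
    have h2 : x + cutoff p ε x • u x - (y + cutoff p ε y • u y) -
        ((ContinuousLinearEquiv.refl ℝ E3 : E3 ≃L[ℝ] E3) : E3 →L[ℝ] E3) (x - y) =
        cutoff p ε x • u x - cutoff p ε y • u y := by
      simp only [ContinuousLinearEquiv.coe_refl, ContinuousLinearMap.coe_id', id_eq]
      abel
    rw [h2]
    exact norm_cutoff_smul_sub_le hε hu hb x y
  have h3 : (3 / 4 : NNReal) < ‖((ContinuousLinearEquiv.refl ℝ E3).symm : E3 →L[ℝ] E3)‖₊⁻¹ := by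
    have : ‖((ContinuousLinearEquiv.refl ℝ E3).symm : E3 →L[ℝ] E3)‖₊ = 1 := by
      ext
      exact ContinuousLinearMap.norm_id
    rw [this, inv_one, ← NNReal.coe_lt_coe]
    push_cast
    norm_num
  refine ⟨h1.toHomeomorph _ (Or.inr h3), fun x hx => ?_, fun x hx => ?_⟩
  · show x + cutoff p ε x • u x = _
    rw [cutoff_eq_one hε hx, one_smul]
  · show x + cutoff p ε x • u x = _
    rw [cutoff_eq_zero hε hx, zero_smul, add_zero]

end Cutoff

/-! ### Germs and their linear parts -/

section LocalEquiv

/-- The germs at `0` of the maps `f` and `g` differ by a homeomorphism of `ℝ³` whose support is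
contained in any given neighbourhood of `p`. -/
def LocalEquiv (p : E3) (f g : E3 → E3) : Prop :=
  ∀ r > 0, ∃ G : E3 ≃ₜ E3, (∀ x, r ≤ dist x p → G x = x) ∧ ∀ᶠ x in 𝓝 0, G (f x) = g x

theorem LocalEquiv.symm {p : E3} {f g : E3 → E3} (h : LocalEquiv p f g) : LocalEquiv p g f := by
  intro r hr
  obtain ⟨G, h1, h2⟩ := h r hr
  refine ⟨G.symm, fun x hx => ?_, h2.mono fun x hx => ?_⟩
  · rw [Homeomorph.symm_apply_eq, h1 x hx]
  · rw [← hx, G.symm_apply_apply]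

theorem LocalEquiv.trans {p : E3} {f g k : E3 → E3} (h : LocalEquiv p f g)
    (h' : LocalEquiv p g k) : LocalEquiv p f k := by
  intro r hr
  obtain ⟨G, h1, h2⟩ := h r hr
  obtain ⟨G', h1', h2'⟩ := h' r hr
  refine ⟨G.trans G', fun x hx => ?_, (h2.and h2').mono fun x hx => ?_⟩
  · rw [Homeomorph.trans_apply, h1 x hx, h1' x hx]
  · rw [Homeomorph.trans_apply, hx.1, hx.2]

theorem LocalEquiv.comp {p : E3} {f g t : E3 → E3} (h : LocalEquiv p f g)
    (ht : Tendsto t (𝓝 0) (𝓝 0)) : LocalEquiv p (f ∘ t) (g ∘ t) := fun r hr => by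
  obtain ⟨G, h1, h2⟩ := h r hr
  exact ⟨G, h1, ht.eventually h2⟩

theorem localEquiv_refl (p : E3) (f : E3 → E3) : LocalEquiv p f f :=
  fun _ _ => ⟨Homeomorph.refl _, fun _ _ => rfl, Eventually.of_forall fun _ => rfl⟩

/-- A map with invertible strict derivative is locally equivalent to its derivative. -/
theorem LocalEquiv.of_hasStrictFDerivAt {t : E3 → E3} {L : E3 ≃L[ℝ] E3}
    (ht : HasStrictFDerivAt t (L : E3 →L[ℝ] E3) 0) :
    LocalEquiv (t 0) (fun x => t 0 + L x) t := by
  intro r hr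
  set p := t 0 with hp
  -- This is the deviation from the identity of `t` composed with the inverse of `x ↦ p + L x`. Its
  -- strict derivative at `p` vanishes, so it is `1 / 4`-Lipschitz near `p`.
  let u : E3 → E3 := fun y => t (L.symm (y - p)) - y
  have hu : HasStrictFDerivAt u (0 : E3 →L[ℝ] E3) p := by
    have h1 : HasStrictFDerivAt (fun y : E3 => L.symm (y - p)) (L.symm : E3 →L[ℝ] E3) p :=
      HasStrictFDerivAt.comp (g := L.symm) p L.symm.hasStrictFDerivAt
        ((hasStrictFDerivAt_id p).sub_const p)
    have h2 : HasStrictFDerivAt t (L : E3 →L[ℝ] E3) (L.symm (p - p)) := by simpa using ht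
    have h3 := (h2.comp p h1).sub (hasStrictFDerivAt_id p)
    have h4 : (L : E3 →L[ℝ] E3).comp (L.symm : E3 →L[ℝ] E3) - ContinuousLinearMap.id ℝ E3 = 0 := by
      ext; simp
    rw [h4] at h3
    exact h3
  obtain ⟨s, hs, hl⟩ := hu.exists_lipschitzOnWith_of_nnnorm_lt (1 / 4) (by simp)
  obtain ⟨δ, hδ, hδs⟩ := Metric.nhds_basis_closedBall.mem_iff.1 hs
  have hε : 0 < min δ r := lt_min hδ hr
  have hl' : ∀ x, dist x p ≤ min δ r → ∀ y, dist y p ≤ min δ r →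
      ‖u x - u y‖ ≤ 1 / 4 * ‖x - y‖ := by
    intro x hx y hy
    have := hl.dist_le_mul x (hδs (hx.trans (min_le_left _ _))) y
      (hδs (hy.trans (min_le_left _ _)))
    rw [dist_eq_norm, dist_eq_norm] at this
    simpa using this
  have hup : u p = 0 := by simp [u, hp]
  obtain ⟨G, h1, h2⟩ := exists_homeomorph_of_small hε hl' (fun x hx => by
    have := hl' x hx p (by simpa using hε.le)
    rw [hup, sub_zero, ← dist_eq_norm x p] at this
    linarith)
  refine ⟨G, fun x hx => h2 x ((min_le_right _ _).trans hx), ?_⟩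
  have hc : Tendsto (fun x : E3 => p + L x) (𝓝 0) (𝓝 p) := by
    have : Continuous fun x : E3 => p + L x := by fun_prop
    simpa using this.tendsto 0
  filter_upwards [hc (Metric.closedBall_mem_nhds p (half_pos hε))] with x hx
  rw [h1 _ hx]
  simp [u]

/-- Small translations are locally equivalent to the identity. -/
theorem exists_homeomorph_slide (p : E3) {r : ℝ} (hr : 0 < r) {p' : E3} (hp' : dist p' p ≤ r / 4) :
    ∃ G : E3 ≃ₜ E3, (∀ x, r ≤ dist x p → G x = x) ∧ ∀ᶠ x in 𝓝 0, G (p + x) = p' + x := by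
  obtain ⟨G, h1, h2⟩ := exists_homeomorph_of_small (u := fun _ => p' - p) hr
    (fun x _ y _ => by rw [sub_self, norm_zero]; positivity)
    (fun x _ => (dist_eq_norm p' p).symm.le.trans hp')
  refine ⟨G, h2, ?_⟩
  filter_upwards [Metric.closedBall_mem_nhds (0 : E3) (half_pos hr)] with x hx
  rw [h1]
  · abel
  · rw [dist_eq_norm, add_sub_cancel_left]
    exact mem_closedBall_zero_iff.1 hx

end LocalEquiv

/-! ### Linear germs -/

section Linear

/-- The linear map of `ℝ³` with a given matrix. -/
def linMap : Matrix (Fin 3) (Fin 3) ℝ →ₗ[ℝ] E3 →L[ℝ] E3 :=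
  LinearMap.toContinuousLinearMap.toLinearMap ∘ₗ
    (Matrix.toLin (EuclideanSpace.basisFun (Fin 3) ℝ).toBasis
      (EuclideanSpace.basisFun (Fin 3) ℝ).toBasis).toLinearMap

theorem linMap_mul (A B : Matrix (Fin 3) (Fin 3) ℝ) (x : E3) :
    linMap (A * B) x = linMap A (linMap B x) := by
  simp [linMap, Matrix.toLin_mul (EuclideanSpace.basisFun (Fin 3) ℝ).toBasis
      (EuclideanSpace.basisFun (Fin 3) ℝ).toBasis]

theorem linMap_one (x : E3) : linMap 1 x = x := by
  simp [linMap, Matrix.toLin_one]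

theorem continuous_linMap : Continuous linMap := LinearMap.continuous_of_finiteDimensional _

theorem det_linMap (A : Matrix (Fin 3) (Fin 3) ℝ) : (linMap A).det = A.det := by
  simp [linMap, ContinuousLinearMap.det, LinearMap.det_toLin]

theorem exists_linMap (L : E3 →L[ℝ] E3) : ∃ A, linMap A = L :=
  ⟨LinearMap.toMatrix (EuclideanSpace.basisFun (Fin 3) ℝ).toBasis
      (EuclideanSpace.basisFun (Fin 3) ℝ).toBasis (L : E3 →ₗ[ℝ] E3), by
    ext; simp [linMap]⟩

theorem linMap_apply (A : Matrix (Fin 3) (Fin 3) ℝ) (x : E3) (i : Fin 3) :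
    linMap A x i = ∑ j, A i j * x j := by
  have h := Matrix.toLin_apply (EuclideanSpace.basisFun (Fin 3) ℝ).toBasis
    (EuclideanSpace.basisFun (Fin 3) ℝ).toBasis A x
  have h2 : linMap A x = _ := h
  rw [h2]
  simp [Matrix.mulVec, dotProduct, Pi.single_apply, Finset.sum_apply]

/-- The reflection of `ℝ³` that changes the sign of the first coordinate. -/
def rho : E3 ≃ₗᵢ[ℝ] E3 :=
  LinearIsometryEquiv.piLpCongrRight 2 fun i : Fin 3 =>
    if i = 0 then LinearIsometryEquiv.neg ℝ else LinearIsometryEquiv.refl ℝ ℝ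

theorem rho_apply (x : E3) (i : Fin 3) : rho x i = if i = 0 then -x i else x i := by
  simp only [rho, LinearIsometryEquiv.piLpCongrRight_apply]
  split_ifs <;> rfl

theorem rho_rho (x : E3) : rho (rho x) = x := by
  ext i
  simp only [rho_apply]
  split_ifs <;> simp

/-- The matrix of the reflection `rho`. -/
def rhoMat : Matrix (Fin 3) (Fin 3) ℝ := Matrix.diagonal ![-1, 1, 1]

theorem linMap_rhoMat (x : E3) : linMap rhoMat x = rho x := by
  ext i
  rw [linMap_apply, rho_apply]
  fin_cases i <;> simp [rhoMat, Fin.sum_univ_three, Matrix.diagonal]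

theorem rhoMat_mul_self : rhoMat * rhoMat = 1 := by
  rw [rhoMat, Matrix.diagonal_mul_diagonal, ← Matrix.diagonal_one]
  congr 1
  ext i
  fin_cases i <;> simp

/-- The linear map with matrix `A` is locally equivalent to the identity. -/
def IsotopicToOne (A : Matrix (Fin 3) (Fin 3) ℝ) : Prop := LocalEquiv 0 id (linMap A)

theorem tendsto_linMap (A : Matrix (Fin 3) (Fin 3) ℝ) : Tendsto (linMap A) (𝓝 0) (𝓝 0) := by
  simpa using (linMap A).continuous.tendsto 0

theorem isotopicToOne_one : IsotopicToOne 1 := by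
  have : (linMap 1 : E3 → E3) = id := funext linMap_one
  rw [IsotopicToOne, this]
  exact localEquiv_refl _ _

/-- Equivalences act on the target, so precomposing the one from `id` to `A` with `B` connects `B`
to `A * B`. -/
theorem IsotopicToOne.mul {A B : Matrix (Fin 3) (Fin 3) ℝ} (hA : IsotopicToOne A)
    (hB : IsotopicToOne B) : IsotopicToOne (A * B) := by
  have h := LocalEquiv.comp hA (tendsto_linMap B)
  have h2 : (linMap A : E3 → E3) ∘ linMap B = linMap (A * B) :=
    funext fun x => (linMap_mul A B x).symm
  rw [h2] at h
  exact LocalEquiv.trans hB h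

theorem IsotopicToOne.of_mul_eq_one {A B : Matrix (Fin 3) (Fin 3) ℝ} (hA : IsotopicToOne A)
    (hAB : A * B = 1) : IsotopicToOne B := by
  have h := LocalEquiv.comp hA (tendsto_linMap B)
  have h2 : (linMap A : E3 → E3) ∘ linMap B = id := funext fun x => by
    rw [Function.comp_apply, ← linMap_mul, hAB, linMap_one, id_eq]
  rw [h2] at h
  exact LocalEquiv.symm h

/-- The homeomorphism is conjugated by `rho`, an isometry fixing `0`, so its support stays in the
same ball. -/
theorem IsotopicToOne.conj_rhoMat {A : Matrix (Fin 3) (Fin 3) ℝ} (hA : IsotopicToOne A) :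
    IsotopicToOne (rhoMat * A * rhoMat) := by
  intro r hr
  obtain ⟨G, h1, h2⟩ := hA r hr
  refine ⟨rho.toHomeomorph.trans (G.trans rho.toHomeomorph), fun x hx => ?_, ?_⟩
  · show rho (G (rho x)) = x
    rw [h1, rho_rho]
    rwa [dist_zero_right, rho.norm_map, ← dist_zero_right]
  · have ht : Tendsto rho (𝓝 0) (𝓝 0) := by simpa using rho.continuous.tendsto 0
    filter_upwards [ht.eventually h2] with x hx
    show rho (G (rho x)) = _
    rw [show G (rho x) = linMap A (rho x) from hx, linMap_mul, linMap_mul, linMap_rhoMat,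
      linMap_rhoMat]

/-- Once `A - 1` has norm at most `1 / 4`, it is itself an admissible small perturbation. -/
theorem eventually_isotopicToOne : ∀ᶠ A in 𝓝 (1 : Matrix (Fin 3) (Fin 3) ℝ), IsotopicToOne A := by
  have hc : Tendsto (fun A => linMap A - linMap 1) (𝓝 (1 : Matrix (Fin 3) (Fin 3) ℝ)) (𝓝 0) := by
    have : Continuous fun A => linMap A - linMap 1 := continuous_linMap.sub continuous_const
    simpa using this.tendsto 1
  filter_upwards [hc (Metric.closedBall_mem_nhds 0 (show (0 : ℝ) < 1 / 4 by norm_num))] with A hA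
  have hA' : ‖linMap A - linMap 1‖ ≤ 1 / 4 := mem_closedBall_zero_iff.1 hA
  have hle : ∀ x, ‖(linMap A - linMap 1) x‖ ≤ 1 / 4 * ‖x‖ := fun x =>
    (ContinuousLinearMap.le_opNorm _ x).trans (by gcongr)
  intro r hr
  obtain ⟨G, h1, h2⟩ := exists_homeomorph_of_small (p := 0) (u := fun x => (linMap A - linMap 1) x)
    hr (fun x _ y _ => by rw [← map_sub]; exact hle _) (fun x hx => by
      rw [dist_zero_right] at hx
      exact (hle x).trans (by linarith))
  refine ⟨G, h2, ?_⟩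
  filter_upwards [Metric.closedBall_mem_nhds (0 : E3) (half_pos hr)] with x hx
  rw [id_eq, h1 x hx, ContinuousLinearMap.sub_apply, linMap_one]
  abel

/-- For `t` near `s` the matrix `(γ s)⁻¹ * γ t` is close to `1`, so the property is locally constant
along the path. -/
theorem isotopicToOne_of_path {γ : ℝ → Matrix (Fin 3) (Fin 3) ℝ} (hγ : Continuous γ)
    (hdet : ∀ t ∈ Icc (0 : ℝ) 1, (γ t).det ≠ 0) (h0 : γ 0 = 1) : IsotopicToOne (γ 1) := by
  have key : IsotopicToOne (γ 0) ↔ IsotopicToOne (γ 1) := by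
    refine isPreconnected_Icc.induction₂ (s := Icc (0 : ℝ) 1)
      (fun s t => IsotopicToOne (γ s) ↔ IsotopicToOne (γ t)) ?_
      (fun x y z _ _ _ h h' => h.trans h') (fun x y _ _ h => h.symm)
      (left_mem_Icc.2 zero_le_one) (right_mem_Icc.2 zero_le_one)
    intro s hs
    have hu : IsUnit (γ s).det := isUnit_iff_ne_zero.2 (hdet s hs)
    have hc : Tendsto (fun t => (γ s)⁻¹ * γ t) (𝓝 s) (𝓝 1) := by
      have : Continuous fun t => (γ s)⁻¹ * γ t := continuous_const.mul hγ
      have h := this.tendsto s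
      rwa [Matrix.nonsing_inv_mul _ hu] at h
    filter_upwards [nhdsWithin_le_nhds (hc.eventually eventually_isotopicToOne),
      self_mem_nhdsWithin] with t ht hts
    have hut : IsUnit (γ t).det := isUnit_iff_ne_zero.2 (hdet t hts)
    constructor
    · intro h
      have := h.mul ht
      rwa [← mul_assoc, Matrix.mul_nonsing_inv _ hu, one_mul] at this
    · intro h
      have h2 : (γ s)⁻¹ * γ t * ((γ t)⁻¹ * γ s) = 1 := by
        rw [mul_assoc, ← mul_assoc (γ t), Matrix.mul_nonsing_inv _ hut, one_mul,
          Matrix.nonsing_inv_mul _ hu]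
      have := h.mul (ht.of_mul_eq_one h2)
      rwa [← mul_assoc, Matrix.mul_nonsing_inv _ hut, one_mul] at this
  rw [← key, h0]
  exact isotopicToOne_one

theorem isotopicToOne_transvection {i j : Fin 3} (hij : i ≠ j) (c : ℝ) :
    IsotopicToOne (Matrix.transvection i j c) := by
  have h := isotopicToOne_of_path (γ := fun t => Matrix.transvection i j (t * c))
    (by
      have : (fun t : ℝ => Matrix.transvection i j (t * c)) =
          fun t => 1 + t • Matrix.single i j c := by
        ext1 t
        rw [Matrix.transvection, Matrix.smul_single, smul_eq_mul]
      rw [this]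
      fun_prop)
    (fun t _ => by rw [Matrix.det_transvection_of_ne _ _ hij]; exact one_ne_zero)
    (by simp)
  simpa using h

theorem isotopicToOne_diagonal {d : Fin 3 → ℝ} (hd : ∀ i, 0 < d i) :
    IsotopicToOne (Matrix.diagonal d) := by
  have h := isotopicToOne_of_path (γ := fun t => Matrix.diagonal fun i => (1 - t) + t * d i)
    (by
      refine Continuous.matrix_diagonal ?_
      fun_prop)
    (fun t ht => by
      rw [Matrix.det_diagonal, Finset.prod_ne_zero_iff]
      intro i _
      rcases eq_or_lt_of_le ht.1 with h0 | h0
      · rw [← h0]; norm_num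
      · have := mul_pos h0 (hd i)
        have := ht.2
        exact ne_of_gt (by linarith))
    (by simp)
  simpa using h

end Linear

/-! ### The sign of the determinant -/

section Determinant

/-- A product of three shears is a quarter turn of the first two coordinates, and the half turn is
its square. -/
theorem isotopicToOne_halfTurn_zero_one :
    IsotopicToOne (Matrix.diagonal ![-1, -1, 1]) := by
  have e1 : Matrix.transvection 0 1 (1 : ℝ) = !![1, 1, 0; 0, 1, 0; 0, 0, 1] := by
    ext a b
    fin_cases a <;> fin_cases b <;> simp [Matrix.transvection, Matrix.single]
  have e2 : Matrix.transvection 1 0 (-1 : ℝ) = !![1, 0, 0; -1, 1, 0; 0, 0, 1] := by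
    ext a b
    fin_cases a <;> fin_cases b <;> simp [Matrix.transvection, Matrix.single]
  have h1 := isotopicToOne_transvection (i := 0) (j := 1) (by decide) 1
  have h2 := isotopicToOne_transvection (i := 1) (j := 0) (by decide) (-1)
  rw [e1] at h1
  rw [e2] at h2
  have h3 := (h1.mul h2).mul h1
  have h4 := h3.mul h3
  convert h4 using 1
  ext a b
  fin_cases a <;> fin_cases b <;>
    simp [Matrix.mul_apply, Fin.sum_univ_three, Matrix.diagonal]

theorem isotopicToOne_halfTurn_zero_two :
    IsotopicToOne (Matrix.diagonal ![-1, 1, -1]) := by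
  have e1 : Matrix.transvection 0 2 (1 : ℝ) = !![1, 0, 1; 0, 1, 0; 0, 0, 1] := by
    ext a b
    fin_cases a <;> fin_cases b <;> simp [Matrix.transvection, Matrix.single]
  have e2 : Matrix.transvection 2 0 (-1 : ℝ) = !![1, 0, 0; 0, 1, 0; -1, 0, 1] := by
    ext a b
    fin_cases a <;> fin_cases b <;> simp [Matrix.transvection, Matrix.single]
  have h1 := isotopicToOne_transvection (i := 0) (j := 2) (by decide) 1
  have h2 := isotopicToOne_transvection (i := 2) (j := 0) (by decide) (-1)
  rw [e1] at h1
  rw [e2] at h2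
  have h3 := (h1.mul h2).mul h1
  have h4 := h3.mul h3
  convert h4 using 1
  ext a b
  fin_cases a <;> fin_cases b <;>
    simp [Matrix.mul_apply, Fin.sum_univ_three, Matrix.diagonal]

/-- The sign of the determinant decides whether a linear isomorphism is locally equivalent to the
identity or to the reflection `rho`. -/
def DetSignRule (A : Matrix (Fin 3) (Fin 3) ℝ) : Prop :=
  (0 < A.det → IsotopicToOne A) ∧ (A.det < 0 → IsotopicToOne (A * rhoMat))

/-- Conjugation pushes the reflections to the right, where they cancel in pairs. -/
theorem DetSignRule.mul {A B : Matrix (Fin 3) (Fin 3) ℝ} (hA0 : A.det ≠ 0) (hB0 : B.det ≠ 0)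
    (hA : DetSignRule A) (hB : DetSignRule B) : DetSignRule (A * B) := by
  rw [DetSignRule, Matrix.det_mul]
  have hr : ∀ C : Matrix (Fin 3) (Fin 3) ℝ, rhoMat * (rhoMat * C) = C := fun C => by
    rw [← mul_assoc, rhoMat_mul_self, one_mul]
  rcases lt_or_gt_of_ne hA0 with ha | ha <;> rcases lt_or_gt_of_ne hB0 with hb | hb
  · refine ⟨fun _ => ?_, fun h => absurd h (not_lt.2 (mul_pos_of_neg_of_neg ha hb).le)⟩
    have := (hA.2 ha).mul (hB.2 hb).conj_rhoMat
    simpa only [mul_assoc, hr, rhoMat_mul_self, mul_one] using this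
  · refine ⟨fun h => absurd h (not_lt.2 (mul_neg_of_neg_of_pos ha hb).le), fun _ => ?_⟩
    have := (hA.2 ha).mul (hB.1 hb).conj_rhoMat
    simpa only [mul_assoc, hr] using this
  · refine ⟨fun h => absurd h (not_lt.2 (mul_neg_of_pos_of_neg ha hb).le), fun _ => ?_⟩
    have := (hA.1 ha).mul (hB.2 hb)
    simpa only [mul_assoc] using this
  · exact ⟨fun _ => (hA.1 ha).mul (hB.1 hb), fun h => absurd h (not_lt.2 (mul_pos ha hb).le)⟩

/-- One diagonal entry is treated at a time. Up to a positive factor it is a single sign change, and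
that times `rhoMat` is the identity or a half turn in a coordinate plane. -/
theorem detSignRule_diagonal (d : Fin 3 → ℝ) (hd : (Matrix.diagonal d).det ≠ 0) :
    DetSignRule (Matrix.diagonal d) := by
  have hd' : ∀ i, d i ≠ 0 := by
    rw [Matrix.det_diagonal, Finset.prod_ne_zero_iff] at hd
    exact fun i => hd i (Finset.mem_univ i)
  have hpos : ∀ e : Fin 3 → ℝ, (∀ i, 0 < e i) → DetSignRule (Matrix.diagonal e) := fun e he =>
    ⟨fun _ => isotopicToOne_diagonal he, fun h => absurd h (not_lt.2 (by
      rw [Matrix.det_diagonal]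
      exact (Finset.prod_pos fun i _ => he i).le))⟩
  -- a single sign change
  have hsingle : ∀ i : Fin 3, DetSignRule (Matrix.diagonal fun k => if k = i then -1 else 1) := by
    intro i
    have hdet : (Matrix.diagonal fun k : Fin 3 => if k = i then (-1 : ℝ) else 1).det = -1 := by
      rw [Matrix.det_diagonal, Finset.prod_ite_eq' Finset.univ i (fun _ => (-1 : ℝ))]
      simp
    refine ⟨fun h => absurd h (by rw [hdet]; norm_num), fun _ => ?_⟩
    rw [rhoMat, Matrix.diagonal_mul_diagonal]
    fin_cases i
    · convert isotopicToOne_one using 1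
      rw [← Matrix.diagonal_one]
      congr 1
      ext k
      fin_cases k <;> simp
    · convert isotopicToOne_halfTurn_zero_one using 1
      congr 1
      ext k
      fin_cases k <;> simp
    · convert isotopicToOne_halfTurn_zero_two using 1
      congr 1
      ext k
      fin_cases k <;> simp
  have hsign : ∀ i : Fin 3, DetSignRule (Matrix.diagonal fun k => if k = i then d k else 1) := by
    intro i
    rcases lt_or_gt_of_ne (hd' i) with hi | hi
    · have h1 := hpos (fun k => if k = i then -d k else 1) (fun k => by
        split_ifs with hk
        · rw [hk]; linarith
        · exact one_pos)
      have h2 := h1.mul ?_ ?_ (hsingle i)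
      · rw [Matrix.diagonal_mul_diagonal] at h2
        convert h2 using 1
        congr 1
        ext k
        split_ifs <;> simp
      · rw [Matrix.det_diagonal, Finset.prod_ne_zero_iff]
        intro k _
        split_ifs
        exacts [neg_ne_zero.2 (hd' k), one_ne_zero]
      · rw [Matrix.det_diagonal, Finset.prod_ne_zero_iff]
        intro k _
        split_ifs
        exacts [by norm_num, one_ne_zero]
    · exact hpos _ fun k => by
        split_ifs with hk
        · rw [hk]; exact hi
        · exact one_pos
  have hne : ∀ i : Fin 3, (Matrix.diagonal fun k => if k = i then d k else 1).det ≠ 0 := by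
    intro i
    rw [Matrix.det_diagonal, Finset.prod_ne_zero_iff]
    intro k _
    split_ifs
    exacts [hd' k, one_ne_zero]
  have h01 := (hsign 0).mul (hne 0) (hne 1) (hsign 1)
  have h012 := h01.mul (by rw [Matrix.det_mul]; exact mul_ne_zero (hne 0) (hne 1)) (hne 2) (hsign 2)
  rw [Matrix.diagonal_mul_diagonal, Matrix.diagonal_mul_diagonal] at h012
  convert h012 using 1
  congr 1
  ext k
  fin_cases k <;> simp

/-- Gaussian elimination writes an invertible matrix as a product of transvections and a diagonal
matrix. -/
theorem detSignRule {A : Matrix (Fin 3) (Fin 3) ℝ} (hA : A.det ≠ 0) : DetSignRule A :=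
  Matrix.diagonal_transvection_induction_of_det_ne_zero DetSignRule A hA detSignRule_diagonal
    (fun t => ⟨fun _ => isotopicToOne_transvection t.hij t.c, fun h => absurd h (by
      rw [Matrix.TransvectionStruct.det]; norm_num)⟩)
    fun _ _ h h' => DetSignRule.mul h h'

theorem localEquiv_of_det_pos {L : E3 →L[ℝ] E3} (hL : 0 < L.det) : LocalEquiv 0 id L := by
  obtain ⟨A, rfl⟩ := exists_linMap L
  rw [det_linMap] at hL
  exact (detSignRule hL.ne').1 hL

theorem localEquiv_of_det_neg {L : E3 →L[ℝ] E3} (hL : L.det < 0) : LocalEquiv 0 rho L := by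
  obtain ⟨A, rfl⟩ := exists_linMap L
  rw [det_linMap] at hL
  have h := ((detSignRule hL.ne).2 hL).comp (tendsto_linMap rhoMat)
  have h1 : (linMap (A * rhoMat) : E3 → E3) ∘ linMap rhoMat = linMap A := funext fun x => by
    rw [Function.comp_apply, linMap_mul, linMap_rhoMat, linMap_rhoMat, rho_rho]
  have h2 : (id : E3 → E3) ∘ linMap rhoMat = rho := funext linMap_rhoMat
  rwa [h1, h2] at h

theorem LocalEquiv.translate {f g : E3 → E3} (h : LocalEquiv 0 f g) (p : E3) :
    LocalEquiv p (fun x => p + f x) fun x => p + g x := by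
  intro r hr
  obtain ⟨G, h1, h2⟩ := h r hr
  refine ⟨(Homeomorph.addLeft (-p)).trans (G.trans (Homeomorph.addLeft p)), fun x hx => ?_,
    h2.mono fun x hx => ?_⟩
  · show p + G (-p + x) = x
    rw [h1]
    · abel
    · rwa [dist_zero_right, neg_add_eq_sub, ← dist_eq_norm]
  · show p + G (-p + (p + f x)) = _
    rw [neg_add_cancel_left, hx]

/-- An orientation preserving map is locally equivalent to a translation. -/
theorem LocalEquiv.of_det_pos {t : E3 → E3} {L : E3 ≃L[ℝ] E3}
    (ht : HasStrictFDerivAt t (L : E3 →L[ℝ] E3) 0) (hL : 0 < (L : E3 →L[ℝ] E3).det) :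
    LocalEquiv (t 0) t fun x => t 0 + x :=
  (LocalEquiv.of_hasStrictFDerivAt ht).symm.trans ((localEquiv_of_det_pos hL).translate _).symm

/-- An orientation reversing map is locally equivalent to a reflection. -/
theorem LocalEquiv.of_det_neg {t : E3 → E3} {L : E3 ≃L[ℝ] E3}
    (ht : HasStrictFDerivAt t (L : E3 →L[ℝ] E3) 0) (hL : (L : E3 →L[ℝ] E3).det < 0) :
    LocalEquiv (t 0) t fun x => t 0 + rho x :=
  (LocalEquiv.of_hasStrictFDerivAt ht).symm.trans ((localEquiv_of_det_neg hL).translate _).symm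

theorem ContinuousLinearEquiv.det_coe_ne_zero (L : E3 ≃L[ℝ] E3) : (L : E3 →L[ℝ] E3).det ≠ 0 :=
  (LinearEquiv.isUnit_det' L.toLinearEquiv).ne_zero

end Determinant

/-! ### Germs of discs and ambient homeomorphisms -/

section Germs

variable {N : Type*} [TopologicalSpace N]

/-- Two parametrized germs differ by a homeomorphism of `N` that is the identity near `C`. -/
def GermEquiv (C : Set N) (f g : E3 → N) : Prop :=
  ∃ H : N ≃ₜ N, (∀ᶠ n in 𝓝ˢ C, H n = n) ∧ ∀ᶠ x in 𝓝 0, H (f x) = g x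

variable {C : Set N} {f g k : E3 → N}

theorem GermEquiv.of_eventuallyEq (C : Set N) (h : f =ᶠ[𝓝 0] g) : GermEquiv C f g :=
  ⟨Homeomorph.refl N, Eventually.of_forall fun _ => rfl, h⟩

theorem GermEquiv.symm (h : GermEquiv C f g) : GermEquiv C g f := by
  obtain ⟨H, h1, h2⟩ := h
  refine ⟨H.symm, h1.mono fun x hx => ?_, h2.mono fun x hx => ?_⟩
  · rw [Homeomorph.symm_apply_eq, hx]
  · rw [← hx, H.symm_apply_apply]

theorem GermEquiv.trans (h : GermEquiv C f g) (h' : GermEquiv C g k) : GermEquiv C f k := by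
  obtain ⟨H, h1, h2⟩ := h
  obtain ⟨H', h1', h2'⟩ := h'
  refine ⟨H.trans H', (h1.and h1').mono fun x hx => ?_, (h2.and h2').mono fun x hx => ?_⟩
  · rw [Homeomorph.trans_apply, hx.1, hx.2]
  · rw [Homeomorph.trans_apply, hx.1, hx.2]

theorem GermEquiv.comp {t : E3 → E3} (h : GermEquiv C f g) (ht : Tendsto t (𝓝 0) (𝓝 0)) :
    GermEquiv C (f ∘ t) (g ∘ t) := by
  obtain ⟨H, h1, h2⟩ := h
  exact ⟨H, h1, ht.eventually h2⟩

theorem tendsto_rho : Tendsto rho (𝓝 0) (𝓝 0) := by simpa using rho.continuous.tendsto 0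

theorem GermEquiv.comp_rho (h : GermEquiv C f g) : GermEquiv C (f ∘ rho) (g ∘ rho) :=
  h.comp tendsto_rho

theorem comp_rho_comp_rho (f : E3 → N) : (f ∘ rho) ∘ rho = f := funext fun x =>
  congrArg f (rho_rho x)

variable [T2Space N]

/-- A compactly supported homeomorphism of a chart domain extends by the identity. -/
theorem exists_homeomorph_extend (e : OpenPartialHomeomorph E3 N) {p : E3} {r : ℝ}
    (hr : Metric.closedBall p r ⊆ e.source) (G : E3 ≃ₜ E3) (hG : ∀ x, r ≤ dist x p → G x = x) :
    ∃ H : N ≃ₜ N, (∀ x ∈ e.source, H (e x) = e (G x)) ∧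
      ∀ n ∉ e '' Metric.closedBall p r, H n = n := by
  classical
  have hmaps : ∀ G : E3 ≃ₜ E3, (∀ x, r ≤ dist x p → G x = x) → ∀ x ∈ e.source, G x ∈ e.source := by
    intro G hG x hx
    by_cases h : dist (G x) p ≤ r
    · exact hr h
    -- A point sent outside the ball has a fixed image, so by injectivity it is itself fixed.
    · have h1 : G (G x) = G x := hG _ (not_le.1 h).le
      rwa [G.injective h1]
  have hclosed : IsClosed (e '' Metric.closedBall p r) :=
    ((isCompact_closedBall p r).image_of_continuousOn (e.continuousOn.mono hr)).isClosed
  let extG : (E3 ≃ₜ E3) → N → N := fun G n => if n ∈ e.target then e (G (e.symm n)) else n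
  have hEx : ∀ G : E3 ≃ₜ E3, ∀ x ∈ e.source, extG G (e x) = e (G x) := by
    intro G x hx
    simp only [extG, if_pos (e.map_source hx), e.left_inv hx]
  have hEx' : ∀ G : E3 ≃ₜ E3, (∀ x, r ≤ dist x p → G x = x) →
      ∀ n ∉ e '' Metric.closedBall p r, extG G n = n := by
    intro G hG n hn
    by_cases hnt : n ∈ e.target
    · rw [← e.right_inv hnt, hEx G _ (e.map_target hnt), hG]
      by_contra hlt
      exact hn ⟨e.symm n, (not_le.1 hlt).le, e.right_inv hnt⟩
    · simp only [extG, if_neg hnt]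
  have hcont : ∀ G : E3 ≃ₜ E3, (∀ x, r ≤ dist x p → G x = x) → Continuous (extG G) := by
    intro G hG
    rw [continuous_iff_continuousAt]
    intro n
    by_cases hn : n ∈ e '' Metric.closedBall p r
    · obtain ⟨x, hx, rfl⟩ := hn
      have hxt := e.map_source (hr hx)
      have h1 : ContinuousAt (fun n => e (G (e.symm n))) (e x) := by
        refine ContinuousAt.comp ?_ (G.continuous.continuousAt.comp (e.symm.continuousAt hxt))
        refine e.continuousAt ?_
        show G (e.symm (e x)) ∈ e.source
        rw [e.left_inv (hr hx)]
        exact hmaps G hG x (hr hx)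
      refine h1.congr ?_
      filter_upwards [e.open_target.mem_nhds hxt] with n hn
      simp only [extG, if_pos hn]
    · refine continuousAt_id.congr ?_
      filter_upwards [hclosed.isOpen_compl.mem_nhds hn] with n hn
      exact (hEx' G hG n hn).symm
  have hinv : ∀ G G' : E3 ≃ₜ E3, (∀ x, r ≤ dist x p → G x = x) → (∀ x, G' (G x) = x) →
      ∀ n, extG G' (extG G n) = n := by
    intro G G' hG hGG n
    by_cases hnt : n ∈ e.target
    · have hx := e.map_target hnt
      rw [← e.right_inv hnt, hEx G _ hx, hEx G' _ (hmaps G hG _ hx), hGG]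
    · simp only [extG, if_neg hnt]
  have hG' : ∀ x, r ≤ dist x p → G.symm x = x := fun x hx => by
    rw [Homeomorph.symm_apply_eq, hG x hx]
  let H : N ≃ₜ N :=
    { toFun := extG G
      invFun := extG G.symm
      left_inv := hinv G G.symm hG G.symm_apply_apply
      right_inv := hinv G.symm G hG' G.apply_symm_apply
      continuous_toFun := hcont G hG
      continuous_invFun := hcont G.symm hG' }
  exact ⟨H, hEx G, hEx' G hG⟩

theorem exists_closedBall_subset (e : OpenPartialHomeomorph E3 N) (hC : IsClosed C) {p : E3}
    (hp : p ∈ e.source) (hpC : e p ∉ C) :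
    ∃ r > 0, Metric.closedBall p r ⊆ e.source ∧ Disjoint (e '' Metric.closedBall p r) C := by
  have h1 := e.isOpen_inter_preimage hC.isOpen_compl
  obtain ⟨r, hr, hs⟩ := Metric.nhds_basis_closedBall.mem_iff.1 (h1.mem_nhds ⟨hp, hpC⟩)
  refine ⟨r, hr, fun x hx => (hs hx).1, disjoint_left.2 ?_⟩
  rintro _ ⟨x, hx, rfl⟩
  exact (hs hx).2

theorem germEquiv_of_homeomorph (e : OpenPartialHomeomorph E3 N) (hC : IsClosed C) {p : E3} {r : ℝ}
    (hr : Metric.closedBall p r ⊆ e.source) (hrC : Disjoint (e '' Metric.closedBall p r) C)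
    {s t : E3 → E3} (hs : Tendsto s (𝓝 0) (𝓝 p)) (hp : p ∈ e.source) (G : E3 ≃ₜ E3)
    (hG : ∀ x, r ≤ dist x p → G x = x) (hst : ∀ᶠ x in 𝓝 0, G (s x) = t x) :
    GermEquiv C (e ∘ s) (e ∘ t) := by
  obtain ⟨H, h1, h2⟩ := exists_homeomorph_extend e hr G hG
  have hclosed : IsClosed (e '' Metric.closedBall p r) :=
    ((isCompact_closedBall p r).image_of_continuousOn (e.continuousOn.mono hr)).isClosed
  refine ⟨H, ?_, ?_⟩
  · refine mem_of_superset (hclosed.isOpen_compl.mem_nhdsSet.2 ?_) fun n hn => h2 n hn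
    exact fun n hn => disjoint_right.1 hrC hn
  · filter_upwards [hst, hs (e.open_source.mem_nhds hp)] with x hx hxs
    rw [Function.comp_apply, h1 _ hxs, hx, Function.comp_apply]

theorem LocalEquiv.germEquiv (e : OpenPartialHomeomorph E3 N) (hC : IsClosed C) {p : E3}
    (hp : p ∈ e.source) (hpC : e p ∉ C) {s t : E3 → E3} (hs : Tendsto s (𝓝 0) (𝓝 p))
    (hst : LocalEquiv p s t) : GermEquiv C (e ∘ s) (e ∘ t) := by
  obtain ⟨r, hr, h1, h2⟩ := exists_closedBall_subset e hC hp hpC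
  obtain ⟨G, hG, hG'⟩ := hst r hr
  exact germEquiv_of_homeomorph e hC h1 h2 hs hp G hG hG'

theorem tendsto_add_zero (p : E3) : Tendsto (fun x : E3 => p + x) (𝓝 0) (𝓝 p) := by
  have : Continuous fun x : E3 => p + x := by fun_prop
  simpa using this.tendsto 0

theorem eventually_germEquiv_slide (e : OpenPartialHomeomorph E3 N) (hC : IsClosed C) {p : E3}
    (hp : p ∈ e.source) (hpC : e p ∉ C) :
    ∀ᶠ p' in 𝓝 p, GermEquiv C (fun x => e (p + x)) fun x => e (p' + x) := by
  obtain ⟨r, hr, h1, h2⟩ := exists_closedBall_subset e hC hp hpC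
  filter_upwards [Metric.closedBall_mem_nhds p (show 0 < r / 4 by positivity)] with p' hp'
  obtain ⟨G, hG, hG'⟩ := exists_homeomorph_slide p hr hp'
  exact germEquiv_of_homeomorph e hC h1 h2 (tendsto_add_zero p) hp G hG hG'

/-- Translated germs in a chart are equivalent as long as the translation can be carried out
in the complement of `C`. -/
theorem germEquiv_slide (e : OpenPartialHomeomorph E3 N) (hC : IsClosed C) {V : Set E3}
    (hV : IsPreconnected V) (hVe : V ⊆ e.source) (hVC : ∀ x ∈ V, e x ∉ C) {p p' : E3} (hp : p ∈ V)
    (hp' : p' ∈ V) : GermEquiv C (fun x => e (p + x)) fun x => e (p' + x) :=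
  hV.induction₂ (fun p p' => GermEquiv C (fun x => e (p + x)) fun x => e (p' + x))
    (fun p hp => nhdsWithin_le_nhds (eventually_germEquiv_slide e hC (hVe hp) (hVC p hp)))
    (fun _ _ _ _ _ _ h h' => h.trans h') (fun _ _ _ _ h => h.symm) hp hp'

end Germs

section ChartGerms

variable {N : Type*} [TopologicalSpace N] [T2Space N] {C : Set N}

theorem germEquiv_of_det_pos (e : OpenPartialHomeomorph E3 N) (hC : IsClosed C) {t : E3 → E3}
    {L : E3 ≃L[ℝ] E3} (ht : HasStrictFDerivAt t (L : E3 →L[ℝ] E3) 0)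
    (hL : 0 < (L : E3 →L[ℝ] E3).det) (hp : t 0 ∈ e.source) (hpC : e (t 0) ∉ C) :
    GermEquiv C (e ∘ t) fun x => e (t 0 + x) :=
  (LocalEquiv.of_det_pos ht hL).germEquiv e hC hp hpC ht.continuousAt

theorem germEquiv_of_det_neg (e : OpenPartialHomeomorph E3 N) (hC : IsClosed C) {t : E3 → E3}
    {L : E3 ≃L[ℝ] E3} (ht : HasStrictFDerivAt t (L : E3 →L[ℝ] E3) 0)
    (hL : (L : E3 →L[ℝ] E3).det < 0) (hp : t 0 ∈ e.source) (hpC : e (t 0) ∉ C) :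
    GermEquiv C (e ∘ t) fun x => e (t 0 + rho x) :=
  (LocalEquiv.of_det_neg ht hL).germEquiv e hC hp hpC ht.continuousAt

end ChartGerms

/-! ### Regular germs in smooth manifolds -/

section Regular

theorem exists_equiv_hasStrictFDerivAt {f : E3 → E3} {x : E3} (hf : ContDiffAt ℝ ∞ f x)
    (hinj : Function.Injective (fderiv ℝ f x)) :
    ∃ L : E3 ≃L[ℝ] E3, HasStrictFDerivAt f (L : E3 →L[ℝ] E3) x := by
  refine ⟨(LinearEquiv.ofInjectiveEndo (fderiv ℝ f x : E3 →ₗ[ℝ] E3) hinj).toContinuousLinearEquiv,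
    ?_⟩
  have h := hf.hasStrictFDerivAt (by simp)
  have h2 : ((LinearEquiv.ofInjectiveEndo (fderiv ℝ f x : E3 →ₗ[ℝ] E3)
      hinj).toContinuousLinearEquiv : E3 →L[ℝ] E3) = fderiv ℝ f x := by
    ext1 v
    rfl
  rw [h2]
  exact h

variable {E H : Type*} [NormedAddCommGroup E] [NormedSpace ℝ E] [TopologicalSpace H]
  (J : ModelWithCorners ℝ E H) {N : Type*} [TopologicalSpace N] [ChartedSpace H N]

/-- The smooth parametrizations of open subsets of `N` by open subsets of `ℝ³`. -/
def smoothParam (N : Type*) [TopologicalSpace N] [ChartedSpace H N] :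
    Set (OpenPartialHomeomorph E3 N) :=
  {e | ContMDiffOn 𝓘(ℝ, E3) J ∞ e e.source ∧ ContMDiffOn J 𝓘(ℝ, E3) ∞ e.symm e.target}

/-- `f` is a local diffeomorphism at `x`. -/
def IsRegularAt (f : E3 → N) (x : E3) : Prop :=
  ContinuousAt f x ∧ ∀ e ∈ smoothParam J N, f x ∈ e.target →
    ∃ L : E3 ≃L[ℝ] E3, HasStrictFDerivAt (e.symm ∘ f) (L : E3 →L[ℝ] E3) x

variable {J}

theorem smoothParam.contMDiffAt {e : OpenPartialHomeomorph E3 N} (he : e ∈ smoothParam J N) {x : E3}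
    (hx : x ∈ e.source) : ContMDiffAt 𝓘(ℝ, E3) J ∞ e x :=
  he.1.contMDiffAt (e.open_source.mem_nhds hx)

theorem smoothParam.contMDiffAt_symm {e : OpenPartialHomeomorph E3 N} (he : e ∈ smoothParam J N)
    {n : N} (hn : n ∈ e.target) : ContMDiffAt J 𝓘(ℝ, E3) ∞ e.symm n :=
  he.2.contMDiffAt (e.open_target.mem_nhds hn)

theorem exists_smoothParam [J.Boundaryless] [IsManifold J ∞ N] (Λ : E ≃L[ℝ] E3) (n : N) :
    ∃ e ∈ smoothParam J N, n ∈ e.target := by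
  let e : OpenPartialHomeomorph N E3 := (chartAt H n).trans
    (J.toHomeomorph.trans Λ.toHomeomorph).toOpenPartialHomeomorph
  have hes : e.source = (chartAt H n).source := by simp [e]
  refine ⟨e.symm, ⟨?_, ?_⟩, ?_⟩
  · have h1 : ContMDiffOn 𝓘(ℝ, E) J ∞ (extChartAt J n).symm (extChartAt J n).target :=
      contMDiffOn_extChartAt_symm n
    have h2 : ContMDiff 𝓘(ℝ, E3) 𝓘(ℝ, E) ∞ Λ.symm := Λ.symm.contDiff.contMDiff
    refine h1.comp h2.contMDiffOn ?_
    intro y hy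
    simp only [extChartAt, e] at hy ⊢
    have hy' : J.symm (Λ.symm y) ∈ (chartAt H n).target := by simpa using hy
    simpa using ⟨⟨J.symm (Λ.symm y), J.right_inv (by simp [J.range_eq_univ])⟩, hy'⟩
  · have h1 : ContMDiffOn J 𝓘(ℝ, E) ∞ (extChartAt J n) (chartAt H n).source :=
      contMDiffOn_extChartAt
    have h2 : ContMDiff 𝓘(ℝ, E) 𝓘(ℝ, E3) ∞ Λ := Λ.contDiff.contMDiff
    have h := h2.comp_contMDiffOn h1
    rw [← hes] at h
    exact h
  · show n ∈ e.source
    rw [hes]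
    exact mem_chart_source H n

/-- The transition maps in the two directions are inverse to each other near the point, so the chain
rule makes the derivative injective. -/
theorem smoothParam.isRegularAt {e : OpenPartialHomeomorph E3 N} (he : e ∈ smoothParam J N) {x : E3}
    (hx : x ∈ e.source) : IsRegularAt J e x := by
  refine ⟨e.continuousAt hx, fun e' he' hx' => ?_⟩
  have h1 : ContDiffAt ℝ ∞ (e'.symm ∘ e) x := contMDiffAt_iff_contDiffAt.1
    ((smoothParam.contMDiffAt_symm he' hx').comp x (smoothParam.contMDiffAt he hx))
  have h2 : ContDiffAt ℝ ∞ (e.symm ∘ e') (e'.symm (e x)) := contMDiffAt_iff_contDiffAt.1 <| by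
    refine ContMDiffAt.comp _ ?_ (smoothParam.contMDiffAt he' (e'.map_target hx'))
    rw [e'.right_inv hx']
    exact smoothParam.contMDiffAt_symm he (e.map_source hx)
  have h3 : (e.symm ∘ e') ∘ (e'.symm ∘ e) =ᶠ[𝓝 x] id := by
    filter_upwards [e.open_source.mem_nhds hx,
      (e.continuousAt hx).preimage_mem_nhds (e'.open_target.mem_nhds hx')] with y hy hy'
    simp only [Function.comp_apply, id_eq]
    rw [e'.right_inv hy', e.left_inv hy]
  refine exists_equiv_hasStrictFDerivAt h1 ?_
  have h4 := ((h2.differentiableAt (by simp)).hasFDerivAt.comp x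
    (h1.differentiableAt (by simp)).hasFDerivAt).unique
    ((hasFDerivAt_id x).congr_of_eventuallyEq h3)
  intro v w hvw
  have h5 := congrArg (fun L : E3 →L[ℝ] E3 => L v) h4
  have h6 := congrArg (fun L : E3 →L[ℝ] E3 => L w) h4
  simp only [ContinuousLinearMap.comp_apply, ContinuousLinearMap.id_apply] at h5 h6
  rw [← h5, ← h6]
  exact congrArg _ hvw

theorem isRegularAt_of_contMDiffAt {f : E3 → N} {x : E3} (hf : ContMDiffAt 𝓘(ℝ, E3) J ∞ f x)
    (hinj : Function.Injective (mfderiv 𝓘(ℝ, E3) J f x)) : IsRegularAt J f x := by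
  refine ⟨hf.continuousAt, fun e he hx => ?_⟩
  have h1 : ContMDiffAt 𝓘(ℝ, E3) 𝓘(ℝ, E3) ∞ (e.symm ∘ f) x :=
    (smoothParam.contMDiffAt_symm he hx).comp x hf
  refine exists_equiv_hasStrictFDerivAt (contMDiffAt_iff_contDiffAt.1 h1) ?_
  have h2 : e ∘ (e.symm ∘ f) =ᶠ[𝓝 x] f := by
    filter_upwards [hf.continuousAt.preimage_mem_nhds (e.open_target.mem_nhds hx)] with y hy
    exact e.right_inv hy
  have h3 : mfderiv 𝓘(ℝ, E3) J f x = _ := h2.mfderiv_eq.symm.trans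
    (mfderiv_comp x ((smoothParam.contMDiffAt he (e.map_target hx)).mdifferentiableAt (by simp))
      (h1.mdifferentiableAt (by simp)))
  rw [← mfderiv_eq_fderiv]
  rw [h3] at hinj
  exact Function.Injective.of_comp (f := mfderiv 𝓘(ℝ, E3) J e ((e.symm ∘ f) x)) hinj

theorem IsSmoothDisc.isRegularAt {f : E3 → N} (hf : IsSmoothDisc J f) {x : E3} (hx : x ∈ ball3) :
    IsRegularAt J f x := by
  obtain ⟨⟨U, hU, hb, hs⟩, -, hd⟩ := hf
  exact isRegularAt_of_contMDiffAt (hs.contMDiffAt (hU.mem_nhds (hb hx))) (hd x hx)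

theorem IsRegularAt.comp {f : E3 → N} {t : E3 → E3} {x : E3} (hf : IsRegularAt J f (t x))
    {L : E3 ≃L[ℝ] E3} (ht : HasStrictFDerivAt t (L : E3 →L[ℝ] E3) x) :
    IsRegularAt J (f ∘ t) x := by
  refine ⟨hf.1.comp ht.continuousAt, fun e he hx => ?_⟩
  obtain ⟨L', hL'⟩ := hf.2 e he hx
  exact ⟨L.trans L', hL'.comp x ht⟩

theorem IsRegularAt.exists_openPartialHomeomorph [J.Boundaryless] [IsManifold J ∞ N]
    (Λ : E ≃L[ℝ] E3) {f : E3 → N} {x : E3} (hf : IsRegularAt J f x) :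
    ∃ φ : OpenPartialHomeomorph E3 N, x ∈ φ.source ∧ f =ᶠ[𝓝 x] φ := by
  obtain ⟨e, he, hx⟩ := exists_smoothParam (J := J) Λ (f x)
  obtain ⟨L, hL⟩ := hf.2 e he hx
  refine ⟨(hL.toOpenPartialHomeomorph _).trans e, ?_, ?_⟩
  · rw [OpenPartialHomeomorph.trans_source]
    exact ⟨hL.mem_toOpenPartialHomeomorph_source, e.map_target hx⟩
  · filter_upwards [hf.1.preimage_mem_nhds (e.open_target.mem_nhds hx)] with y hy
    exact (e.right_inv hy).symm

/-- A locally injective map that is injective on a compact set is injective on a neighbourhood of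
it; being locally a chart, the map is also open there. -/
theorem isTameDisc_of_isRegularAt [T2Space N] [J.Boundaryless] [IsManifold J ∞ N]
    (Λ : E ≃L[ℝ] E3) {f : E3 → N} (hinj : InjOn f ball3) (hf : ∀ x ∈ ball3, IsRegularAt J f x) :
    IsTameDisc f := by
  let V₀ : Set E3 := {y | ∃ φ : OpenPartialHomeomorph E3 N, y ∈ φ.source ∧ f =ᶠ[𝓝 y] φ}
  have hV₀ : IsOpen V₀ := by
    rw [isOpen_iff_mem_nhds]
    rintro y ⟨φ, hy, hφ⟩
    filter_upwards [φ.open_source.mem_nhds hy, eventually_eventually_nhds.2 hφ] with z hz hz'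
    exact ⟨φ, hz, hz'⟩
  have hb : ball3 ⊆ V₀ := fun x hx => (hf x hx).exists_openPartialHomeomorph Λ
  obtain ⟨t, ht, hti⟩ := hinj.exists_mem_nhdsSet (isCompact_closedBall _ _) (fun x hx => (hf x hx).1)
    (fun x hx => by
      obtain ⟨φ, hx, hφ⟩ := hb hx
      refine ⟨_, inter_mem (φ.open_source.mem_nhds hx) hφ, fun y hy z hz hyz => ?_⟩
      exact φ.injOn hy.1 hz.1 (hy.2.symm.trans (hyz.trans hz.2)))
  have hVo : IsOpen (V₀ ∩ interior t) := hV₀.inter isOpen_interior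
  refine ⟨V₀ ∩ interior t, hVo, subset_inter hb (subset_interior_iff_mem_nhdsSet.2 ht), ?_⟩
  refine IsOpenEmbedding.of_continuous_injective_isOpenMap ?_ ?_ ?_
  · rw [← continuousOn_iff_continuous_domRestrict]
    rintro y ⟨⟨φ, hy, hφ⟩, -⟩
    exact ((φ.continuousAt hy).congr hφ.symm).continuousWithinAt
  · intro y z hyz
    exact Subtype.ext (hti (interior_subset y.2.2) (interior_subset z.2.2) hyz)
  · rw [isOpenMap_iff_nhds_le]
    intro y
    obtain ⟨φ, hy, hφ⟩ := y.2.1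
    have h1 : map ((V₀ ∩ interior t).domRestrict f) (𝓝 y) = map f (𝓝 (y : E3)) := by
      have : (V₀ ∩ interior t).domRestrict f = f ∘ Subtype.val := rfl
      rw [this, ← Filter.map_map, hVo.isOpenEmbedding_subtypeVal.map_nhds_eq]
    rw [h1, Filter.map_congr hφ, φ.map_nhds_eq hy]
    exact (congrArg 𝓝 hφ.self_of_nhds).le

theorem IsSmoothDisc.isTameDisc [T2Space N] [J.Boundaryless] [IsManifold J ∞ N]
    (Λ : E ≃L[ℝ] E3) {f : E3 → N} (hf : IsSmoothDisc J f) : IsTameDisc f :=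
  isTameDisc_of_isRegularAt Λ hf.2.1 fun _ hx => hf.isRegularAt hx

variable [T2Space N] {C : Set N}

/-- Read in the chart, the germ reduces to a translation or to a reflected translation according to
the sign of its Jacobian. -/
theorem IsRegularAt.germEquiv_or {f : E3 → N} (hf : IsRegularAt J f 0) (hC : IsClosed C)
    (hfC : f 0 ∉ C) {e : OpenPartialHomeomorph E3 N} (he : e ∈ smoothParam J N)
    (hfe : f 0 ∈ e.target) :
    GermEquiv C f (fun x => e (e.symm (f 0) + x)) ∨
      GermEquiv C f (fun x => e (e.symm (f 0) + rho x)) := by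
  obtain ⟨L, hL⟩ := hf.2 e he hfe
  have h1 : GermEquiv C f (e ∘ (e.symm ∘ f)) := by
    refine .of_eventuallyEq C ?_
    filter_upwards [hf.1.preimage_mem_nhds (e.open_target.mem_nhds hfe)] with y hy
    exact (e.right_inv hy).symm
  have hp : (e.symm ∘ f) 0 ∈ e.source := e.map_target hfe
  have hpC : e ((e.symm ∘ f) 0) ∉ C := by
    rw [Function.comp_apply, e.right_inv hfe]; exact hfC
  rcases lt_or_gt_of_ne (ContinuousLinearEquiv.det_coe_ne_zero L) with hd | hd
  · exact Or.inr (h1.trans (germEquiv_of_det_neg e hC hL hd hp hpC))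
  · exact Or.inl (h1.trans (germEquiv_of_det_pos e hC hL hd hp hpC))

theorem GermEquiv.or_trans {f g k : E3 → N} (h : GermEquiv C f g ∨ GermEquiv C f (g ∘ rho))
    (h' : GermEquiv C g k ∨ GermEquiv C g (k ∘ rho)) :
    GermEquiv C f k ∨ GermEquiv C f (k ∘ rho) := by
  rcases h with h | h <;> rcases h' with h' | h'
  · exact Or.inl (h.trans h')
  · exact Or.inr (h.trans h')
  · exact Or.inr (h.trans h'.comp_rho)
  · have := h.trans h'.comp_rho
    rw [comp_rho_comp_rho] at this
    exact Or.inl this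

theorem GermEquiv.or_symm {f g : E3 → N} (h : GermEquiv C f g ∨ GermEquiv C f (g ∘ rho)) :
    GermEquiv C g f ∨ GermEquiv C g (f ∘ rho) := by
  refine h.imp GermEquiv.symm fun h => ?_
  have := h.symm.comp_rho
  rwa [comp_rho_comp_rho] at this

/-- Regular germs in a connected set are equivalent up to a reflection. -/
theorem germEquiv_or_germEquiv_comp_rho [J.Boundaryless] [IsManifold J ∞ N] (Λ : E ≃L[ℝ] E3)
    (hC : IsClosed C) (hCc : IsPreconnected Cᶜ) {f g : E3 → N} (hf : IsRegularAt J f 0)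
    (hg : IsRegularAt J g 0) (hfC : f 0 ∉ C) (hgC : g 0 ∉ C) :
    GermEquiv C f g ∨ GermEquiv C f (g ∘ rho) := by
  have key : ∀ n n' : N, n ∈ Cᶜ → n' ∈ Cᶜ → ∀ f g : E3 → N, IsRegularAt J f 0 → IsRegularAt J g 0 →
      f 0 = n → g 0 = n' → GermEquiv C f g ∨ GermEquiv C f (g ∘ rho) := by
    intro n n' hn hn'
    refine hCc.induction₂ (fun n n' => ∀ f g : E3 → N, IsRegularAt J f 0 → IsRegularAt J g 0 →
      f 0 = n → g 0 = n' → GermEquiv C f g ∨ GermEquiv C f (g ∘ rho)) ?_ ?_ ?_ hn hn'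
    -- For nearby base points both germs are read in one chart and joined by a translation.
    · intro n hn
      obtain ⟨e, he, hne⟩ := exists_smoothParam (J := J) Λ n
      have hs := eventually_germEquiv_slide e hC (e.map_target hne)
        (by rw [e.right_inv hne]; exact hn)
      have hs' := (e.symm.continuousAt hne).eventually hs
      filter_upwards [nhdsWithin_le_nhds hs', self_mem_nhdsWithin,
        nhdsWithin_le_nhds (e.open_target.mem_nhds hne)] with n' hn' hn'C hn'e f g hf hg hfn hgn
      subst hfn hgn
      have h1 := hf.germEquiv_or hC hn he hne
      have h2 := hg.germEquiv_or hC hn'C he hn'e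
      exact GermEquiv.or_trans (GermEquiv.or_trans (k := fun x => e (e.symm (g 0) + x)) h1
        (Or.inl hn')) (GermEquiv.or_symm h2)
    · intro n n' n'' _ hn' _ h1 h2 f g hf hg hfn hgn
      obtain ⟨e, he, hne⟩ := exists_smoothParam (J := J) Λ n'
      -- Transitivity needs some regular germ at the intermediate point; a chart supplies one.
      let k : E3 → N := e ∘ fun x => e.symm n' + x
      have hk : IsRegularAt J k 0 := by
        have ht : HasStrictFDerivAt (fun x : E3 => e.symm n' + x)
            ((ContinuousLinearEquiv.refl ℝ E3 : E3 ≃L[ℝ] E3) : E3 →L[ℝ] E3) 0 :=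
          (hasStrictFDerivAt_id (0 : E3)).const_add _
        refine IsRegularAt.comp ?_ ht
        rw [add_zero]
        exact smoothParam.isRegularAt he (e.map_target hne)
      have hk0 : k 0 = n' := by simp [k, e.right_inv hne]
      exact GermEquiv.or_trans (h1 f k hf hk hfn hk0) (h2 k g hk hg hk0 hgn)
    · intro n n' _ _ h f g hf hg hfn hgn
      exact GermEquiv.or_symm (h g f hg hf hgn hfn)
  exact key _ _ hfC hgC f g hf hg rfl rfl

end Regular

/-! ### Orientations from classes of germs -/

section Orientation

theorem isConnected_ball_diff_singleton (a : E3) {r : ℝ} (hr : 0 < r) (b : E3) :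
    IsConnected (Metric.ball a r \ {b}) := by
  have hc : IsConnected (Metric.ball a r) := (convex_ball a r).isConnected (Metric.nonempty_ball.2 hr)
  by_cases hb : b ∈ Metric.ball a r
  · obtain ⟨δ, hδ, hs⟩ := Metric.isOpen_iff.1 Metric.isOpen_ball b hb
    have h := (isConnected_diff_ball Metric.isOpen_ball hc
      (Homeomorph.addLeft b).toOpenPartialHomeomorph le_rfl hδ (subset_univ _) ?_).2
    · simpa using h
    · rintro _ ⟨x, hx, rfl⟩
      refine hs ?_
      simpa using hx
  · rwa [diff_singleton_eq_self hb]

variable {M : Type*} [TopologicalSpace M] [ChartedSpace E3 M]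

theorem mem_maximalAtlas_iff_symm_mem_smoothParam [IsManifold 𝓘(ℝ, E3) ∞ M]
    (φ : OpenPartialHomeomorph M E3) :
    φ ∈ IsManifold.maximalAtlas 𝓘(ℝ, E3) ∞ M ↔ φ.symm ∈ smoothParam 𝓘(ℝ, E3) M := by
  rw [IsManifold.mem_maximalAtlas_iff_contMDiffOn]
  exact and_comm

/-- The smooth parametrizations all of whose germs away from `C` are equivalent to `k`. -/
def orientedParam (C : Set M) (k : E3 → M) : Set (OpenPartialHomeomorph E3 M) :=
  {e | e ∈ smoothParam 𝓘(ℝ, E3) M ∧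
    ∀ y ∈ e.source, e y ∉ C → GermEquiv C (fun x => e (y + x)) k}

theorem ContMDiffAt.continuousAt_det_fderiv {f : E3 → M} {v : E3}
    (hf : ContMDiffAt 𝓘(ℝ, E3) 𝓘(ℝ, E3) ∞ f v) {e : OpenPartialHomeomorph E3 M}
    (he : e ∈ smoothParam 𝓘(ℝ, E3) M) (hfe : f v ∈ e.target) :
    ContinuousAt (fun w => (fderiv ℝ (e.symm ∘ f) w).det) v := by
  have h1 : ContDiffAt ℝ ∞ (e.symm ∘ f) v := contMDiffAt_iff_contDiffAt.1
    ((smoothParam.contMDiffAt_symm he hfe).comp v hf)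
  have h2 : ContDiffAt ℝ 0 (fderiv ℝ (e.symm ∘ f)) v := h1.fderiv_right (by simp)
  exact ContinuousLinearMap.continuous_det.continuousAt.comp h2.continuousAt

variable [T2Space M] {C : Set M} {k : E3 → M}

/-- All germs of `e` away from `C` are equivalent to `k`, and relative to `e` the sign of the
Jacobian decides between a translate and a reflected translate. -/
theorem germEquiv_orientedParam (hC : IsClosed C) {e : OpenPartialHomeomorph E3 M}
    (he : e ∈ orientedParam C k) {f : E3 → M} {v : E3} (hf : IsRegularAt 𝓘(ℝ, E3) f v)
    (hfe : f v ∈ e.target) (hfC : f v ∉ C) :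
    (0 < (fderiv ℝ (e.symm ∘ f) v).det ∧ GermEquiv C (fun x => f (v + x)) k) ∨
    ((fderiv ℝ (e.symm ∘ f) v).det < 0 ∧ GermEquiv C (fun x => f (v + x)) (k ∘ rho)) := by
  obtain ⟨L, hL⟩ := hf.2 e he.1 hfe
  rw [hL.hasFDerivAt.fderiv]
  let t : E3 → E3 := fun x => e.symm (f (v + x))
  have ht : HasStrictFDerivAt t (L : E3 →L[ℝ] E3) 0 := by
    have h1 : HasStrictFDerivAt (fun x : E3 => v + x) (ContinuousLinearMap.id ℝ E3) 0 :=
      (hasStrictFDerivAt_id (0 : E3)).const_add v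
    have h2 : HasStrictFDerivAt (e.symm ∘ f) (L : E3 →L[ℝ] E3) (v + 0) := by rwa [add_zero]
    exact h2.comp (0 : E3) h1
  have ht0 : t 0 = e.symm (f v) := by simp [t]
  have hp : t 0 ∈ e.source := by rw [ht0]; exact e.map_target hfe
  have hpC : e (t 0) ∉ C := by rw [ht0, e.right_inv hfe]; exact hfC
  have h1 : GermEquiv C (fun x => f (v + x)) (e ∘ t) := by
    refine .of_eventuallyEq C ?_
    have hc : Tendsto (fun x => f (v + x)) (𝓝 0) (𝓝 (f v)) := hf.1.tendsto.comp (tendsto_add_zero v)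
    filter_upwards [hc (e.open_target.mem_nhds hfe)] with x hx
    exact (e.right_inv hx).symm
  have h2 := he.2 _ hp hpC
  rcases lt_or_gt_of_ne (ContinuousLinearEquiv.det_coe_ne_zero L) with hd | hd
  · exact Or.inr ⟨hd, (h1.trans (germEquiv_of_det_neg e hC ht hd hp hpC)).trans h2.comp_rho⟩
  · exact Or.inl ⟨hd, (h1.trans (germEquiv_of_det_pos e hC ht hd hp hpC)).trans h2⟩

/-- In a ball chart the germs off `c` are equivalent to each other by sliding, since a ball without
a point is connected. They are all equivalent to `k` or all to `k ∘ rho`; in the second case the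
chart is composed with `rho`. -/
theorem exists_mem_orientedParam [IsManifold 𝓘(ℝ, E3) ∞ M] {c : M}
    (hCc : IsPreconnected ({c} : Set M)ᶜ) (hk : IsRegularAt 𝓘(ℝ, E3) k 0) (hkc : k 0 ≠ c) (n : M) :
    ∃ e ∈ orientedParam {c} k, n ∈ e.target := by
  obtain ⟨e₀, he₀, hn⟩ := exists_smoothParam (J := 𝓘(ℝ, E3)) (ContinuousLinearEquiv.refl ℝ E3) n
  obtain ⟨r, hr, hrs⟩ := Metric.isOpen_iff.1 e₀.open_source _ (e₀.map_target hn)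
  set a := e₀.symm n
  let e := e₀.restrOpen (Metric.ball a r) Metric.isOpen_ball
  have hes : e.source = Metric.ball a r := by
    simp only [e, OpenPartialHomeomorph.restrOpen_source, inter_eq_right]
    exact hrs
  have hea : a ∈ e.source := by rw [hes]; exact Metric.mem_ball_self hr
  have hen : n ∈ e.target := by
    have := e.map_source hea
    rwa [show e a = n from e₀.right_inv hn] at this
  have he : e ∈ smoothParam 𝓘(ℝ, E3) M := by
    refine ⟨he₀.1.mono (hes.subset.trans hrs), he₀.2.mono ?_⟩
    intro m hm
    have := e.map_target hm
    rw [hes] at this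
    rw [← e.right_inv hm]
    exact e₀.map_source (hrs this)
  have hC : IsClosed ({c} : Set M) := isClosed_singleton
  have hV : IsConnected {y | y ∈ e.source ∧ e y ∉ ({c} : Set M)} := by
    have : {y | y ∈ e.source ∧ e y ∉ ({c} : Set M)} = Metric.ball a r \ {y | y ∈ e.source ∧ e y = c} := by
      ext y
      simp only [mem_setOf_eq, mem_diff, hes, mem_singleton_iff]
      tauto
    rw [this]
    by_cases hc : c ∈ e.target
    · have : {y | y ∈ e.source ∧ e y = c} = {e.symm c} := by
        ext y
        constructor
        · rintro ⟨hy, hyc⟩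
          rw [mem_singleton_iff, ← hyc, e.left_inv hy]
        · rintro rfl
          exact ⟨e.map_target hc, e.right_inv hc⟩
      rw [this]
      exact isConnected_ball_diff_singleton a hr _
    · have : {y | y ∈ e.source ∧ e y = c} = ∅ := by
        rw [eq_empty_iff_forall_notMem]
        rintro y ⟨hy, rfl⟩
        exact hc (e.map_source hy)
      rw [this, diff_empty]
      exact (convex_ball a r).isConnected (Metric.nonempty_ball.2 hr)
  obtain ⟨y₁, hy₁, hy₁C⟩ := hV.nonempty
  have hslide : ∀ y ∈ e.source, e y ∉ ({c} : Set M) →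
      GermEquiv {c} (fun x => e (y + x)) fun x => e (y₁ + x) := fun y hy hyC =>
    germEquiv_slide e hC hV.isPreconnected (fun x hx => hx.1) (fun x hx => hx.2) ⟨hy, hyC⟩
      ⟨hy₁, hy₁C⟩
  have hreg : IsRegularAt 𝓘(ℝ, E3) (e ∘ fun x => y₁ + x) 0 := by
    have ht : HasStrictFDerivAt (fun x : E3 => y₁ + x)
        ((ContinuousLinearEquiv.refl ℝ E3 : E3 ≃L[ℝ] E3) : E3 →L[ℝ] E3) 0 :=
      (hasStrictFDerivAt_id (0 : E3)).const_add _
    refine IsRegularAt.comp ?_ ht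
    rw [add_zero]
    exact smoothParam.isRegularAt he hy₁
  rcases germEquiv_or_germEquiv_comp_rho (ContinuousLinearEquiv.refl ℝ E3) hC hCc hreg hk
    (by simpa using hy₁C) (by simpa using hkc) with h | h
  · exact ⟨e, ⟨he, fun y hy hyC => (hslide y hy hyC).trans h⟩, hen⟩
  · have hrho : ContMDiff 𝓘(ℝ, E3) 𝓘(ℝ, E3) ∞ rho := rho.contDiff.contMDiff
    let e' := rho.toHomeomorph.toOpenPartialHomeomorph.trans e
    have hes' : e'.source = rho ⁻¹' e.source := by simp [e']
    have het' : e'.target = e.target := by simp [e']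
    refine ⟨e', ⟨⟨?_, ?_⟩, fun y hy hyC => ?_⟩, by rw [het']; exact hen⟩
    · rw [hes']
      exact he.1.comp hrho.contMDiffOn fun x hx => hx
    · rw [het']
      exact (rho.symm.contDiff.contMDiff : ContMDiff 𝓘(ℝ, E3) 𝓘(ℝ, E3) ∞ rho.symm).comp_contMDiffOn
        he.2
    · rw [hes'] at hy
      have h1 := ((hslide (rho y) hy hyC).trans h).comp_rho
      rw [comp_rho_comp_rho] at h1
      convert h1 using 2 with x
      show e (rho (y + x)) = e (rho y + rho x)
      rw [map_add]

/-- A negative Jacobian off `c` would make `k` equivalent to its own reflection. At `c`, where no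
germs are controlled, the sign follows from continuity and non-vanishing of the Jacobian. -/
theorem isOrientedAtlas_orientedParam [IsManifold 𝓘(ℝ, E3) ∞ M] {c : M}
    (hCc : IsPreconnected ({c} : Set M)ᶜ) (hk : IsRegularAt 𝓘(ℝ, E3) k 0) (hkc : k 0 ≠ c)
    (hno : ¬ GermEquiv {c} k (k ∘ rho)) :
    IsOrientedAtlas {φ : OpenPartialHomeomorph M E3 | φ.symm ∈ orientedParam {c} k} := by
  have hC : IsClosed ({c} : Set M) := isClosed_singleton
  refine ⟨fun φ hφ => (mem_maximalAtlas_iff_symm_mem_smoothParam φ).2 hφ.1, fun n => ?_, ?_⟩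
  · obtain ⟨e, he, hn⟩ := exists_mem_orientedParam hCc hk hkc n
    exact ⟨e.symm, by simpa using he, hn⟩
  · intro φ hφ ψ hψ y hy
    rw [OpenPartialHomeomorph.trans_source] at hy
    have key : ∀ z ∈ φ.symm.source, φ.symm z ∈ ψ.source → φ.symm z ∉ ({c} : Set M) →
        0 < (fderiv ℝ (ψ.symm.symm ∘ φ.symm) z).det := by
      intro z hz hzψ hzC
      rcases germEquiv_orientedParam hC hψ (smoothParam.isRegularAt hφ.1 hz) hzψ hzC with h | h
      · exact h.1
      · exact (hno ((hφ.2 z hz hzC).symm.trans h.2)).elim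
    show 0 < (fderiv ℝ (ψ.symm.symm ∘ φ.symm) y).det
    by_cases hyC : φ.symm y = c
    · have hcont := ContMDiffAt.continuousAt_det_fderiv (smoothParam.contMDiffAt hφ.1 hy.1)
        hψ.1 hy.2
      obtain ⟨L, hL⟩ := (smoothParam.isRegularAt hφ.1 hy.1).2 ψ.symm hψ.1 hy.2
      have hne : (fderiv ℝ (ψ.symm.symm ∘ φ.symm) y).det ≠ 0 := by
        rw [hL.hasFDerivAt.fderiv]
        exact ContinuousLinearEquiv.det_coe_ne_zero L
      refine lt_of_le_of_ne ?_ hne.symm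
      refine ge_of_tendsto (hcont.tendsto.mono_left nhdsWithin_le_nhds :
        Tendsto _ (𝓝[≠] y) _) ?_
      filter_upwards [self_mem_nhdsWithin,
        nhdsWithin_le_nhds (φ.symm.open_source.mem_nhds hy.1),
        nhdsWithin_le_nhds ((φ.symm.continuousAt hy.1).preimage_mem_nhds
          (ψ.open_source.mem_nhds hy.2))] with z hz hz1 hz2
      refine (key z hz1 hz2 fun hzc => hz ?_).le
      exact φ.symm.injOn hz1 hy.1 (hzc.trans hyC.symm)
    · exact key y hy.1 hy.2 hyC

/-- If `h` respects orientations, then the first disc can be moved to an orientation reversed copy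
of the second one, by a homeomorphism that is the identity near the centre of the latter. -/
theorem germEquiv_of_respectsOrientation [ConnectedSpace M] [IsManifold 𝓘(ℝ, E3) ∞ M]
    {h : S0 → E3 → M} (hh : IsFramedEmbedding h) (hs : ∀ s, IsSmoothDisc 𝓘(ℝ, E3) (h s))
    (ho : RespectsOrientation h) {t : E3 → E3} {L : E3 ≃L[ℝ] E3}
    (ht : HasStrictFDerivAt t (L : E3 →L[ℝ] E3) 0) (hL : (L : E3 →L[ℝ] E3).det < 0)
    (ht0 : t 0 ≠ 0) (ht1 : t 0 ∈ Metric.ball 0 1) :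
    GermEquiv {h S0.neg 0} (h S0.pos) (h S0.neg ∘ t) := by
  have : LocallyPathConnectedSpace M := ChartedSpace.locallyPathConnectedSpace E3 M
  have hz : (0 : E3) ∈ ball3 := Metric.mem_closedBall_self zero_le_one
  have hC : IsClosed ({h S0.neg 0} : Set M) := isClosed_singleton
  have hCc : IsPreconnected ({h S0.neg 0} : Set M)ᶜ := by
    have h1 := ((hh.tame S0.neg).diff_center isOpen_univ isConnected_univ (subset_univ _)).2.1
    rw [compl_eq_univ_diff]
    exact h1.isPreconnected
  obtain ⟨φ, hφ, hb⟩ := (hh.tame S0.neg).exists_openPartialHomeomorph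
  have hbs : Metric.ball 0 1 ⊆ φ.source := Metric.ball_subset_closedBall.trans hb
  have hne : h S0.pos 0 ≠ h S0.neg 0 := fun heq =>
    disjoint_left.1 (hh.disjoint _ _ S0.pos_ne_neg) ⟨0, hz, rfl⟩ ⟨0, hz, heq.symm⟩
  have hFne : ∀ v ∈ ball3, v ≠ 0 → h S0.neg v ∉ ({h S0.neg 0} : Set M) := fun v hv hv0 heq =>
    hv0 ((hh.tame S0.neg).injOn hv hz heq)
  have hreg := (hs S0.pos).isRegularAt hz
  have hreg' : IsRegularAt 𝓘(ℝ, E3) (h S0.neg ∘ t) 0 :=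
    ((hs S0.neg).isRegularAt (Metric.ball_subset_closedBall ht1)).comp ht
  -- Otherwise the first disc is equivalent to the reflection of `h S0.neg ∘ t`, hence not to its
  -- own reflection, and its germ defines an orientation of `M`.
  by_contra hcon
  have h1 := (germEquiv_or_germEquiv_comp_rho (ContinuousLinearEquiv.refl ℝ E3) hC hCc hreg hreg'
    hne (hFne _ (Metric.ball_subset_closedBall ht1) ht0)).resolve_left hcon
  have hno : ¬ GermEquiv {h S0.neg 0} (h S0.pos) (h S0.pos ∘ rho) := by
    intro h2
    have h3 := h2.trans h1.comp_rho
    rw [comp_rho_comp_rho] at h3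
    exact hcon h3
  have hA := isOrientedAtlas_orientedParam hCc hreg hne hno
  obtain ⟨e, he, hpe⟩ := exists_mem_orientedParam hCc hreg hne (h S0.pos 0)
  obtain ⟨e', he', hpe'⟩ := exists_mem_orientedParam hCc hreg hne (h S0.neg 0)
  have hprod : (fderiv ℝ (e.symm ∘ h S0.pos) 0).det * (fderiv ℝ (e'.symm ∘ h S0.neg) 0).det < 0 :=
    ho _ hA e.symm (by simpa using he) e'.symm (by simpa using he') S0.pos S0.neg
      S0.pos_ne_neg hpe hpe'
  have hpos : 0 < (fderiv ℝ (e.symm ∘ h S0.pos) 0).det := by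
    rcases germEquiv_orientedParam hC he hreg hpe hne with h2 | h2
    · exact h2.1
    · refine (hno ?_).elim
      simpa using h2.2
  have hneg : (fderiv ℝ (e'.symm ∘ h S0.neg) 0).det < 0 := by
    by_contra hle
    exact absurd hprod (not_lt.2 (mul_nonneg hpos.le (not_lt.1 hle)))
  obtain ⟨⟨U, hU, hbU, hsm⟩, -, -⟩ := hs S0.neg
  have hcm : ContMDiffAt 𝓘(ℝ, E3) 𝓘(ℝ, E3) ∞ (h S0.neg) 0 :=
    hsm.contMDiffAt (hU.mem_nhds (hbU hz))
  -- The centre of the second disc is the excluded point. The negative Jacobian is therefore carried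
  -- to a nearby point `v`, whose germ is then slid to `t 0`; as `t` reverses orientation once more,
  -- the result contradicts `hcon`.
  have hev : ∀ᶠ v in 𝓝[≠] (0 : E3), (fderiv ℝ (e'.symm ∘ h S0.neg) v).det < 0 ∧
      h S0.neg v ∈ e'.target ∧ v ∈ Metric.ball (0 : E3) 1 ∧ v ≠ 0 := by
    filter_upwards [nhdsWithin_le_nhds ((ContMDiffAt.continuousAt_det_fderiv hcm he'.1
        hpe').eventually (gt_mem_nhds hneg)),
      nhdsWithin_le_nhds (hcm.continuousAt.preimage_mem_nhds (e'.open_target.mem_nhds hpe')),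
      nhdsWithin_le_nhds (Metric.ball_mem_nhds (0 : E3) one_pos), self_mem_nhdsWithin]
      with v h1 h2 h3 h4
    exact ⟨h1, h2, h3, h4⟩
  obtain ⟨v, hv1, hv2, hv3, hv4⟩ := hev.exists
  have hv3' := Metric.ball_subset_closedBall hv3
  have h2 : GermEquiv {h S0.neg 0} (fun x => h S0.neg (v + x)) (h S0.pos ∘ rho) := by
    rcases germEquiv_orientedParam hC he' ((hs S0.neg).isRegularAt hv3') hv2
      (hFne v hv3' hv4) with h2 | h2
    · exact absurd h2.1 (not_lt.2 hv1.le)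
    · exact h2.2
  have h3 : GermEquiv {h S0.neg 0} (fun x => φ (t 0 + x)) fun x => φ (v + x) := by
    refine germEquiv_slide φ hC
      (isConnected_ball_diff_singleton (0 : E3) one_pos 0).isPreconnected
      (fun x hx => hbs hx.1) (fun x hx => ?_) ⟨ht1, ht0⟩ ⟨hv3, hv4⟩
    rw [hφ]
    exact hFne x (Metric.ball_subset_closedBall hx.1) hx.2
  have h4 := germEquiv_of_det_neg φ hC ht hL (hbs ht1) (by
    rw [hφ]
    exact hFne _ (Metric.ball_subset_closedBall ht1) ht0)
  rw [hφ] at h3 h4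
  have h5 := h4.trans (h3.trans h2).comp_rho
  rw [comp_rho_comp_rho] at h5
  exact hcon h5.symm

end Orientation

/-! ### Shrinking discs into the domain of a germ -/

section Shrink

theorem exists_homeomorph_radial {ε δ : ℝ} (hε : 0 < ε) (hε1 : ε ≤ 1) (hδ : 0 < δ) :
    ∃ G : E3 ≃ₜ E3, (∀ x ∈ ball3, G x = ε • x) ∧ ∀ x, 1 + δ ≤ dist x 0 → G x = x := by
  -- The radial factor is `ε` up to radius `1` and then grows linearly, reaching `1` at radius `1 +
  -- δ`. As it is monotone, `t ↦ s t * t` is strictly increasing.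
  let s : ℝ → ℝ := fun t => max ε (min 1 (ε + (1 - ε) / δ * (t - 1)))
  have hsc : Continuous s := by fun_prop
  have hsε : ∀ t, ε ≤ s t := fun t => le_max_left _ _
  have hs0 : ∀ t, 0 < s t := fun t => hε.trans_le (hsε t)
  have hc : 0 ≤ (1 - ε) / δ := div_nonneg (by linarith) hδ.le
  have hsm : Monotone s := by
    intro t t' h
    simp only [s]
    gcongr
  have hsmall : ∀ t ≤ 1, s t = ε := by
    intro t ht
    refine max_eq_left ((min_le_right _ _).trans ?_)
    have := mul_nonneg hc (sub_nonneg.2 ht)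
    nlinarith
  have hlarge : ∀ t, 1 + δ ≤ t → s t = 1 := by
    intro t ht
    have h1 : 1 - ε ≤ (1 - ε) / δ * (t - 1) := by
      calc 1 - ε = (1 - ε) / δ * δ := by field_simp
        _ ≤ (1 - ε) / δ * (t - 1) := by gcongr; linarith
    simp only [s]
    rw [min_eq_left (by linarith), max_eq_right hε1]
  let g : E3 → E3 := fun x => s ‖x‖ • x
  have hgn : ∀ x, ‖g x‖ = s ‖x‖ * ‖x‖ := fun x => by
    rw [norm_smul, Real.norm_of_nonneg (hs0 _).le]
  have hgc : Continuous g := by fun_prop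
  have hmono : ∀ t t', 0 ≤ t → t < t' → s t * t < s t' * t' := by
    intro t t' h0 h
    calc s t * t ≤ s t' * t := by gcongr; exact hsm h.le
      _ < s t' * t' := mul_lt_mul_of_pos_left h (hs0 t')
  have hinj : Function.Injective g := by
    intro x y hxy
    have h1 : ‖x‖ = ‖y‖ := by
      have h2 := congrArg norm hxy
      rw [hgn, hgn] at h2
      rcases lt_trichotomy ‖x‖ ‖y‖ with h | h | h
      · exact absurd h2 (hmono _ _ (norm_nonneg _) h).ne
      · exact h
      · exact absurd h2 (hmono _ _ (norm_nonneg _) h).ne'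
    simp only [g, h1] at hxy
    exact (smul_right_inj (hs0 _).ne').1 hxy
  have hsurj : Function.Surjective g := by
    intro y
    by_cases hy : y = 0
    · exact ⟨0, by simp [g, hy]⟩
    · have hy0 : 0 < ‖y‖ := norm_pos_iff.2 hy
      have hcont : ContinuousOn (fun t => s t * t) (Icc 0 (‖y‖ / ε)) := by fun_prop
      have h1 : ‖y‖ ∈ Icc (s 0 * 0) (s (‖y‖ / ε) * (‖y‖ / ε)) := by
        refine ⟨by simp, ?_⟩
        calc ‖y‖ = ε * (‖y‖ / ε) := by field_simp
          _ ≤ s (‖y‖ / ε) * (‖y‖ / ε) := by gcongr; exact hsε _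
      obtain ⟨t, ht, hty⟩ := intermediate_value_Icc (by positivity) hcont h1
      have hty : s t * t = ‖y‖ := hty
      have hn : ‖(t / ‖y‖) • y‖ = t := by
        rw [norm_smul, Real.norm_of_nonneg (div_nonneg ht.1 hy0.le)]
        field_simp
      refine ⟨(t / ‖y‖) • y, ?_⟩
      simp only [g]
      rw [hn, smul_smul, ← mul_div_assoc, hty, div_self hy0.ne', one_smul]
  have hclosed : IsClosedMap g := by
    refine (isProperMap_iff_tendsto_cocompact.2 ⟨hgc, ?_⟩).isClosedMap
    rw [← Metric.cobounded_eq_cocompact, ← tendsto_norm_atTop_iff_cobounded]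
    have h1 : Tendsto (fun x : E3 => ε * ‖x‖) (Bornology.cobounded E3) atTop :=
      tendsto_norm_cobounded_atTop.const_mul_atTop hε
    refine tendsto_atTop_mono (fun x => ?_) h1
    rw [hgn]
    gcongr
    exact hsε _
  refine ⟨(Equiv.ofBijective g ⟨hinj, hsurj⟩).toHomeomorphOfContinuousClosed hgc hclosed,
    fun x hx => ?_, fun x hx => ?_⟩
  · show s ‖x‖ • x = _
    rw [hsmall _ (mem_closedBall_zero_iff.1 hx)]
  · show s ‖x‖ • x = _
    rw [dist_zero_right] at hx
    rw [hlarge _ hx, one_smul]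

variable {N : Type*} [TopologicalSpace N] [T2Space N]

theorem IsTameDisc.exists_shrink {f : E3 → N} (hf : IsTameDisc f) {K : Set N} (hK : IsClosed K)
    (hfK : Disjoint (f '' ball3) K) {ε : ℝ} (hε : 0 < ε) (hε1 : ε ≤ 1) :
    ∃ S : N ≃ₜ N, (∀ x ∈ ball3, S (f x) = f (ε • x)) ∧ ∀ n ∈ K, S n = n := by
  obtain ⟨φ, rfl, hb⟩ := hf.exists_openPartialHomeomorph
  obtain ⟨δ, hδ, hs⟩ := exists_ball_subset (φ.isOpen_inter_preimage hK.isOpen_compl)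
    (fun x hx => ⟨hb hx, disjoint_left.1 hfK ⟨x, hx, rfl⟩⟩)
  have hs' : Metric.closedBall 0 (1 + δ / 2) ⊆ φ.source ∩ φ ⁻¹' Kᶜ :=
    (Metric.closedBall_subset_ball (by linarith)).trans hs
  obtain ⟨G, h1, h2⟩ := exists_homeomorph_radial hε hε1 (half_pos hδ)
  obtain ⟨S, h3, h4⟩ := exists_homeomorph_extend φ (hs'.trans inter_subset_left) G h2
  refine ⟨S, fun x hx => by rw [h3 x (hb hx), h1 x hx], fun n hn => h4 n ?_⟩
  rintro ⟨x, hx, rfl⟩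
  exact (hs' hx).2 hn

theorem smul_mem_ball3 {ε : ℝ} (hε : 0 < ε) (hε1 : ε ≤ 1) {x : E3} (hx : x ∈ ball3) :
    ε • x ∈ ball3 := by
  rw [mem_closedBall_zero_iff] at hx ⊢
  rw [norm_smul, Real.norm_of_nonneg hε.le]
  exact mul_le_one₀ hε1 (norm_nonneg _) hx

theorem exists_scale {P : E3 → Prop} (hP : ∀ᶠ x in 𝓝 0, P x) :
    ∃ ε : ℝ, 0 < ε ∧ ε ≤ 1 ∧ ∀ x ∈ ball3, P (ε • x) := by
  obtain ⟨r, hr, hs⟩ := Metric.nhds_basis_closedBall.mem_iff.1 hP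
  refine ⟨min r 1, lt_min hr one_pos, min_le_right _ _, fun x hx => hs ?_⟩
  rw [mem_closedBall_zero_iff] at hx ⊢
  rw [norm_smul, Real.norm_of_nonneg (lt_min hr one_pos).le]
  calc min r 1 * ‖x‖ ≤ min r 1 * 1 := by gcongr
    _ ≤ r := by rw [mul_one]; exact min_le_left _ _

/-- Discs with equivalent germs are equivalent. -/
theorem IsTameDisc.exists_homeomorph {f g : E3 → N} (hf : IsTameDisc f) (hg : IsTameDisc g)
    {C : Set N} (hfg : GermEquiv C f g) : ∃ H : N ≃ₜ N, ∀ x ∈ ball3, H (f x) = g x := by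
  obtain ⟨H, -, hH⟩ := hfg
  -- Shrink `f` to the region where `H` carries it to `g`, apply `H`, and expand again along `g`.
  obtain ⟨ε, hε, hε1, hεH⟩ := exists_scale hH
  obtain ⟨S, hS, -⟩ := hf.exists_shrink isClosed_empty (disjoint_empty _) hε hε1
  obtain ⟨S', hS', -⟩ := hg.exists_shrink isClosed_empty (disjoint_empty _) hε hε1
  refine ⟨S.trans (H.trans S'.symm), fun x hx => ?_⟩
  rw [Homeomorph.trans_apply, Homeomorph.trans_apply, hS x hx, hεH x hx, Homeomorph.symm_apply_eq,
    hS' x hx]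

theorem IsFramedEmbedding.exists_shrink {h : S0 → E3 → N} (hh : IsFramedEmbedding h) {ε : ℝ}
    (hε : 0 < ε) (hε1 : ε ≤ 1) : ∃ S : N ≃ₜ N, ∀ s, ∀ x ∈ ball3, S (h s x) = h s (ε • x) := by
  obtain ⟨S, h1, h2⟩ := (hh.tame S0.pos).exists_shrink (hh.tame S0.neg).isClosed_image
    (hh.disjoint _ _ S0.pos_ne_neg) hε hε1
  obtain ⟨S', h1', h2'⟩ := (hh.tame S0.neg).exists_shrink (hh.tame S0.pos).isClosed_image
    (hh.disjoint _ _ S0.pos_ne_neg.symm) hε hε1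
  refine ⟨S'.trans S, fun s x hx => ?_⟩
  rw [Homeomorph.trans_apply]
  rcases s.eq_pos_or_eq_neg with rfl | rfl
  · rw [h2' _ ⟨x, hx, rfl⟩, h1 x hx]
  · rw [h1' x hx, h2 _ ⟨_, smul_mem_ball3 hε hε1 hx, rfl⟩]

/-- Framed embeddings with equivalent germs are equivalent. -/
theorem IsFramedEmbedding.exists_homeomorph {h h' : S0 → E3 → N} (hh : IsFramedEmbedding h)
    (hh' : IsFramedEmbedding h') (H : N ≃ₜ N) (hH : ∀ s, ∀ᶠ x in 𝓝 0, H (h s x) = h' s x) :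
    ∃ H' : N ≃ₜ N, ∀ s, ∀ x ∈ ball3, H' (h s x) = h' s x := by
  obtain ⟨ε, hε, hε1, hεH⟩ := exists_scale (eventually_all.2 hH)
  obtain ⟨S, hS⟩ := hh.exists_shrink hε hε1
  obtain ⟨S', hS'⟩ := hh'.exists_shrink hε hε1
  refine ⟨S.trans (H.trans S'.symm), fun s x hx => ?_⟩
  rw [Homeomorph.trans_apply, Homeomorph.trans_apply, hS s x hx, hεH x hx s,
    Homeomorph.symm_apply_eq, hS' s x hx]

end Shrink

/-! ### Homeomorphisms of glued spaces -/

section GlueHomeomorph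

variable {X Y X' Y' Z : Type*} [TopologicalSpace X] [TopologicalSpace Y] [TopologicalSpace X']
  [TopologicalSpace Y'] [TopologicalSpace Z] {R : X → Y → Prop} {R' : X' → Y' → Prop}

/-- The map out of a glued space defined by compatible maps of the pieces. -/
def Glue.desc (a : X → Z) (b : Y → Z) (h : ∀ x y, R x y → a x = b y) : Glue R → Z :=
  Quot.lift (Sum.elim a b) (by rintro _ _ ⟨x, y, rfl, rfl, hxy⟩; exact h x y hxy)

theorem Glue.continuous_desc {a : X → Z} {b : Y → Z} (ha : Continuous a) (hb : Continuous b)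
    (h : ∀ x y, R x y → a x = b y) : Continuous (Glue.desc a b h) :=
  continuous_quot_lift _ (ha.sumElim hb)

/-- Homeomorphic pieces with the same identifications have homeomorphic glued spaces. -/
theorem Glue.nonempty_congr (eX : X ≃ₜ X') (eY : Y ≃ₜ Y')
    (h : ∀ x y, R x y ↔ R' (eX x) (eY y)) : Nonempty (Glue R ≃ₜ Glue R') := by
  have h' : ∀ x y, R' x y ↔ R (eX.symm x) (eY.symm y) := fun x y => by
    rw [h, eX.apply_symm_apply, eY.apply_symm_apply]
  refine ⟨{ toFun := Glue.desc (fun x => Glue.inl R' (eX x)) (fun y => Glue.inr R' (eY y))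
              fun x y hxy => Glue.sound ((h x y).1 hxy)
            invFun := Glue.desc (fun x => Glue.inl R (eX.symm x)) (fun y => Glue.inr R (eY.symm y))
              fun x y hxy => Glue.sound ((h' x y).1 hxy)
            left_inv := ?_
            right_inv := ?_
            continuous_toFun := Glue.continuous_desc ((Glue.continuous_inl R').comp eX.continuous)
              ((Glue.continuous_inr R').comp eY.continuous) _
            continuous_invFun := Glue.continuous_desc
              ((Glue.continuous_inl R).comp eX.symm.continuous)
              ((Glue.continuous_inr R).comp eY.symm.continuous) _ }⟩
  · refine Glue.ind (fun x => ?_) fun y => ?_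
    · exact congrArg (Glue.inl R) (eX.symm_apply_apply x)
    · exact congrArg (Glue.inr R) (eY.symm_apply_apply y)
  · refine Glue.ind (fun x => ?_) fun y => ?_
    · exact congrArg (Glue.inl R') (eX.apply_symm_apply x)
    · exact congrArg (Glue.inr R') (eY.apply_symm_apply y)

/-- A space that is covered by closed embedded pieces is obtained by gluing the pieces. -/
theorem Glue.nonempty_homeomorph_of_isClosedMap {a : X → Z} {b : Y → Z} (ha : Continuous a)
    (hb : Continuous b) (hac : IsClosedMap a) (hbc : IsClosedMap b) (hai : Function.Injective a)
    (hbi : Function.Injective b) (hab : ∀ x y, a x = b y ↔ R x y)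
    (hsurj : ∀ z, (∃ x, a x = z) ∨ ∃ y, b y = z) : Nonempty (Glue R ≃ₜ Z) := by
  let θ : Glue R → Z := Glue.desc a b fun x y => (hab x y).2
  have hθ : Continuous θ := Glue.continuous_desc ha hb _
  have hinj : Function.Injective θ := by
    intro z w
    refine Glue.ind (P := fun z => θ z = θ w → z = w) (fun x => ?_) (fun y => ?_) z <;>
    refine Glue.ind (P := fun w => _ = θ w → _ = w) (fun x' => ?_) (fun y' => ?_) w
    · intro h; exact congrArg _ (hai h)
    · intro h; exact Glue.sound ((hab x y').1 h)
    · intro h; exact (Glue.sound ((hab x' y).1 h.symm)).symm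
    · intro h; exact congrArg _ (hbi h)
  have hsur : Function.Surjective θ := by
    intro z
    rcases hsurj z with ⟨x, hx⟩ | ⟨y, hy⟩
    exacts [⟨Glue.inl R x, hx⟩, ⟨Glue.inr R y, hy⟩]
  refine ⟨(Equiv.ofBijective θ ⟨hinj, hsur⟩).toHomeomorphOfContinuousClosed hθ ?_⟩
  intro W hW
  have : θ '' W = a '' (Glue.inl R ⁻¹' W) ∪ b '' (Glue.inr R ⁻¹' W) := by
    ext z
    constructor
    · rintro ⟨w, hw, rfl⟩
      revert hw
      refine Glue.ind (P := fun w => w ∈ W → θ w ∈ _) (fun x hx => Or.inl ⟨x, hx, rfl⟩)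
        (fun y hy => Or.inr ⟨y, hy, rfl⟩) w
    · rintro (⟨x, hx, rfl⟩ | ⟨y, hy, rfl⟩)
      exacts [⟨_, hx, rfl⟩, ⟨_, hy, rfl⟩]
  show IsClosed (θ '' W)
  rw [this]
  exact (hac _ (Glue.isClosed_iff.1 hW).1).union (hbc _ (Glue.isClosed_iff.1 hW).2)

end GlueHomeomorph

/-! ### Surgery and connected sum under ambient homeomorphisms -/

section Congruence

variable {M N : Type*} [TopologicalSpace M] [TopologicalSpace N]

theorem mem_closure_compl_iff (H : M ≃ₜ N) {A : Set M} {B : Set N} (hAB : H '' A = B) (m : M) :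
    m ∈ closure (univ \ A) ↔ H m ∈ closure (univ \ B) := by
  have h1 : H '' (univ \ A) = univ \ B := by
    rw [image_diff H.injective, image_univ, H.range_coe, hAB]
  rw [← h1, ← H.image_closure, H.injective.mem_set_image]

theorem zeroSurgery_congr {h h' : S0 → E3 → M} (H : M ≃ₜ M)
    (hH : ∀ s, ∀ x ∈ ball3, H (h s x) = h' s x) :
    Nonempty (ZeroSurgery h ≃ₜ ZeroSurgery h') := by
  have hS : ∀ x : S2, (x : E3) ∈ ball3 := fun x => Metric.sphere_subset_closedBall x.2
  have hAB : H '' removed h = removed h' := by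
    simp only [removed, image_iUnion, image_image]
    exact iUnion_congr fun s => image_congr fun x hx => hH s x hx
  refine Glue.nonempty_congr (H.subtype (mem_closure_compl_iff H hAB)) (Homeomorph.refl _) ?_
  intro p q
  refine exists_congr fun s => and_congr Iff.rfl ?_
  show (p : M) = h s q.2 ↔ H p = h' s q.2
  rw [← hH s q.2 (hS _), H.injective.eq_iff]

theorem connectedSum_congr {i i' : E3 → M} {j j' : E3 → N} (H : M ≃ₜ M) (K : N ≃ₜ N)
    (hH : ∀ x ∈ ball3, H (i x) = i' x) (hK : ∀ x ∈ ball3, K (j x) = j' x) :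
    Nonempty (ConnectedSum i j ≃ₜ ConnectedSum i' j') := by
  have hS : ∀ x : S2, (x : E3) ∈ ball3 := fun x => Metric.sphere_subset_closedBall x.2
  have hAB : H '' (i '' ball3) = i' '' ball3 := by
    rw [image_image]; exact image_congr hH
  have hAB' : K '' (j '' ball3) = j' '' ball3 := by
    rw [image_image]; exact image_congr hK
  refine Glue.nonempty_congr (H.subtype (mem_closure_compl_iff H hAB))
    (K.subtype (mem_closure_compl_iff K hAB')) ?_
  intro p q
  refine exists_congr fun x => ?_
  show (p : M) = i x ∧ (q : N) = j x ↔ H p = i' x ∧ K q = j' x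
  rw [← hH x (hS x), ← hK x (hS x), H.injective.eq_iff, K.injective.eq_iff]

theorem image_rho_ball3 : rho '' ball3 = ball3 := by
  rw [ball3, LinearIsometryEquiv.image_closedBall, map_zero]

/-- Reflecting both discs does not change the connected sum. -/
theorem connectedSum_comp_rho (i : E3 → M) (j : E3 → N) :
    Nonempty (ConnectedSum i j ≃ₜ ConnectedSum (i ∘ rho) (j ∘ rho)) := by
  have h1 : i '' ball3 = i ∘ rho '' ball3 := by rw [image_comp, image_rho_ball3]
  have h2 : j '' ball3 = j ∘ rho '' ball3 := by rw [image_comp, image_rho_ball3]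
  refine Glue.nonempty_congr (Homeomorph.setCongr (by rw [h1])) (Homeomorph.setCongr (by rw [h2])) ?_
  intro p q
  show (∃ x : S2, (p : M) = i x ∧ (q : N) = j x) ↔
    ∃ x : S2, (p : M) = i (rho x) ∧ (q : N) = j (rho x)
  have hr : ∀ x : S2, rho x ∈ Metric.sphere (0 : E3) 1 := fun x => by
    rw [mem_sphere_zero_iff_norm, rho.norm_map]; exact norm_eq_of_mem_sphere x
  constructor
  · rintro ⟨x, hp, hq⟩
    exact ⟨⟨rho x, hr x⟩, by simpa [rho_rho] using hp, by simpa [rho_rho] using hq⟩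
  · rintro ⟨x, hp, hq⟩
    exact ⟨⟨rho x, hr x⟩, hp, hq⟩

end Congruence

/-! ### Surgery inside a ball as a connected sum -/

section Model

variable {M N : Type*} [TopologicalSpace M] [T2Space M] [TopologicalSpace N] [T2Space N]

/-- The points of the unit ball outside the interiors of two smaller discs. -/
def pants (T : S0 → E3 → E3) : Set E3 := {u | u ∈ ball3 ∧ ∀ s, u ∉ T s '' Metric.ball 0 1}

/-- A decomposition of `closure (N \ j(D³))` into a copy of `D¹ × S²` and a copy of the unit ball
without two discs identifies a connected sum with `N` as a surgery. -/
theorem zeroSurgery_homeomorph_connectedSum {F : E3 → M} (hF : IsTameDisc F) {j : E3 → N}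
    (hj : IsTameDisc j) {T : S0 → E3 → E3} (hT : ∀ s, ∀ x ∈ ball3, T s x ∈ Metric.ball (0 : E3) 1)
    (hh : IsFramedEmbedding fun s => F ∘ T s) (hW : IsCompact (pants T))
    {ψ : E3 → N} (hψ : ContinuousOn ψ (pants T)) (hψi : InjOn ψ (pants T))
    (hψj : ∀ x : S2, ψ x = j x) (hψY : ∀ u ∈ pants T, ψ u ∉ j '' Metric.ball 0 1)
    {b : D1 × S2 → N} (hb : Continuous b) (hbi : Function.Injective b)
    (hbj : ∀ q, b q ∉ j '' ball3)
    (hψb : ∀ u ∈ pants T, ∀ q : D1 × S2, ψ u = b q ↔ ∃ s : S0, (s : ℝ) = q.1 ∧ u = T s q.2)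
    (hsurj : ∀ n ∉ j '' Metric.ball 0 1, (∃ u ∈ pants T, ψ u = n) ∨ ∃ q, b q = n) :
    Nonempty (ZeroSurgery (fun s => F ∘ T s) ≃ₜ ConnectedSum F j) := by
  have hbb : Metric.ball (0 : E3) 1 ⊆ ball3 := Metric.ball_subset_closedBall
  have hS : ∀ x : S2, (x : E3) ∈ ball3 := fun x => Metric.sphere_subset_closedBall x.2
  have hX1 : ∀ m : M, m ∈ closure (univ \ removed fun s => F ∘ T s) ↔
      ∀ s, m ∉ F ∘ T s '' Metric.ball 0 1 := fun m =>
    mem_closure_compl_discs hh.tame hh.disjoint rfl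
  have hX0 := fun m => hF.mem_closure (n := m)
  have hY0 := fun n => hj.mem_closure (n := n)
  have hSW : ∀ x : S2, (x : E3) ∈ pants T := by
    refine fun x => ⟨hS x, ?_⟩
    rintro s ⟨y, hy, hyx⟩
    have := hT s y (hbb hy)
    rw [hyx, mem_ball_zero_iff, norm_eq_of_mem_sphere] at this
    exact lt_irrefl _ this
  have hTW : ∀ s (x : S2), T s x ∈ pants T := by
    refine fun s x => ⟨hbb (hT s x (hS x)), ?_⟩
    rintro s' ⟨y, hy, hyx⟩
    by_cases hss : s = s'
    · subst hss
      have := (hh.tame s).injOn (hbb hy) (hS x) (congrArg F hyx)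
      rw [this, mem_ball_zero_iff, norm_eq_of_mem_sphere] at hy
      exact lt_irrefl _ hy
    · exact disjoint_left.1 (hh.disjoint s s' hss) ⟨x, hS x, rfl⟩ ⟨y, hbb hy, congrArg F hyx⟩
  -- points of the two pieces of the remaining part of `M`
  have hWX1 : ∀ u ∈ pants T, F u ∈ closure (univ \ removed fun s => F ∘ T s) := by
    intro u hu
    rw [hX1]
    rintro s ⟨x, hx, hxu⟩
    have := hF.injOn (hbb (hT s x (hbb hx))) hu.1 hxu
    exact hu.2 s ⟨x, hx, this⟩
  have hX01 : ∀ m ∈ closure (univ \ F '' ball3), m ∈ closure (univ \ removed fun s => F ∘ T s) := by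
    intro m hm
    rw [hX1]
    rintro s ⟨x, hx, rfl⟩
    exact (hX0 _).1 hm ⟨T s x, hT s x (hbb hx), rfl⟩
  have hcase : ∀ m ∈ closure (univ \ removed fun s => F ∘ T s),
      m ∈ closure (univ \ F '' ball3) ∨ ∃ u ∈ pants T, m = F u := by
    intro m hm
    by_cases h0 : m ∈ closure (univ \ F '' ball3)
    · exact Or.inl h0
    · rw [hX0, not_not] at h0
      obtain ⟨u, hu, rfl⟩ := h0
      refine Or.inr ⟨u, ⟨hbb hu, ?_⟩, rfl⟩
      rintro s ⟨x, hx, rfl⟩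
      exact (hX1 _).1 hm s ⟨x, hx, rfl⟩
  let Rc : closure (univ \ F '' ball3) → closure (univ \ j '' ball3) → Prop :=
    fun p q => ∃ x : S2, (p : M) = F x ∧ (q : N) = j x
  have hRc : IsPartialBijection Rc := by
    constructor
    · rintro p q q' ⟨x, hx, hq⟩ ⟨x', hx', hq'⟩
      have := hF.injOn (hS x) (hS x') (hx.symm.trans hx')
      exact Subtype.ext (by rw [hq, hq', this])
    · rintro p p' q ⟨x, hx, hq⟩ ⟨x', hx', hq'⟩
      have := hj.injOn (hS x) (hS x') (hq.symm.trans hq')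
      exact Subtype.ext (by rw [hx, hx', this])
  have hψY0 : ∀ u ∈ pants T, ψ u ∈ closure (univ \ j '' ball3) := fun u hu => (hY0 _).2 (hψY u hu)
  have hbY0 : ∀ q, b q ∈ closure (univ \ j '' ball3) := fun q =>
    (hY0 _).2 fun h => hbj q (image_mono hbb h)
  -- equality of the two kinds of points in the connected sum
  have hlr : ∀ (p : closure (univ \ F '' ball3)) (u : E3) (hu : u ∈ pants T),
      Glue.inl Rc p = Glue.inr Rc ⟨ψ u, hψY0 u hu⟩ ↔ (p : M) = F u := by
    intro p u hu
    rw [hRc.inl_eq_inr_iff]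
    constructor
    · rintro ⟨x, hx, hux⟩
      have : u = x := hψi hu (hSW x) (hux.trans (hψj x).symm)
      rw [hx, this]
    · intro hpu
      have hu1 : ‖u‖ = 1 := by
        refine le_antisymm (mem_closedBall_zero_iff.1 hu.1) (not_lt.1 fun hlt => ?_)
        exact (hX0 _).1 p.2 ⟨u, mem_ball_zero_iff.2 hlt, hpu.symm⟩
      exact ⟨⟨u, mem_sphere_zero_iff_norm.2 hu1⟩, hpu, hψj ⟨u, mem_sphere_zero_iff_norm.2 hu1⟩⟩
  have hlb : ∀ (p : closure (univ \ F '' ball3)) q, Glue.inl Rc p ≠ Glue.inr Rc ⟨b q, hbY0 q⟩ := by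
    intro p q heq
    obtain ⟨x, -, hx⟩ := hRc.inl_eq_inr_iff.1 heq
    exact hbj q ⟨x, hS x, hx.symm⟩
  -- The remaining part of `M` enters the connected sum by inclusion outside the big disc and by `ψ`
  -- on the pants; `hψj` makes the two agree on the sphere between them.
  have hex : ∀ m : closure (univ \ removed fun s => F ∘ T s), ∃ z : Glue Rc,
      (∀ hm : (m : M) ∈ closure (univ \ F '' ball3), z = Glue.inl Rc ⟨m, hm⟩) ∧
      ∀ u (hu : u ∈ pants T), (m : M) = F u → z = Glue.inr Rc ⟨ψ u, hψY0 u hu⟩ := by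
    intro m
    rcases hcase m m.2 with hm | ⟨u, hu, hmu⟩
    · exact ⟨Glue.inl Rc ⟨m, hm⟩, fun _ => rfl, fun u hu hmu => (hlr _ u hu).2 hmu⟩
    · refine ⟨Glue.inr Rc ⟨ψ u, hψY0 u hu⟩, fun hm => ((hlr ⟨m, hm⟩ u hu).2 hmu).symm,
        fun u' hu' hmu' => ?_⟩
      have : u = u' := hF.injOn hu.1 hu'.1 (hmu.symm.trans hmu')
      subst this
      rfl
  choose a ha1 ha2 using hex
  have hal : ∀ (m : closure (univ \ removed fun s => F ∘ T s)) (p : closure (univ \ F '' ball3)),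
      a m = Glue.inl Rc p ↔ (m : M) = p := by
    intro m p
    rcases hcase m m.2 with hm | ⟨u, hu, hmu⟩
    · rw [ha1 m hm, hRc.inl_injective.eq_iff, Subtype.ext_iff]
    · rw [ha2 m u hu hmu, eq_comm, hlr _ u hu, hmu, eq_comm]
  have har : ∀ (m : closure (univ \ removed fun s => F ∘ T s)) u (hu : u ∈ pants T),
      a m = Glue.inr Rc ⟨ψ u, hψY0 u hu⟩ ↔ (m : M) = F u := by
    intro m u hu
    rcases hcase m m.2 with hm | ⟨u', hu', hmu⟩
    · rw [ha1 m hm, hlr _ u hu]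
    · rw [ha2 m u' hu' hmu, hRc.inr_injective.eq_iff, Subtype.ext_iff, hmu]
      exact ⟨fun h => congrArg F (hψi hu' hu h), fun h => congrArg ψ (hF.injOn hu'.1 hu.1 h)⟩
  have har' : ∀ (m : closure (univ \ removed fun s => F ∘ T s)) (y : closure (univ \ j '' ball3)),
      a m = Glue.inr Rc y ↔ ∃ u ∈ pants T, ψ u = y ∧ (m : M) = F u := by
    intro m y
    constructor
    · intro h
      rcases hcase m m.2 with hm | ⟨u, hu, hmu⟩
      · rw [ha1 m hm] at h
        obtain ⟨x, hx, hy⟩ := hRc.inl_eq_inr_iff.1 h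
        exact ⟨x, hSW x, (hψj x).trans hy.symm, hx⟩
      · rw [ha2 m u hu hmu] at h
        exact ⟨u, hu, congrArg Subtype.val (hRc.inr_injective h), hmu⟩
    · rintro ⟨u, hu, huy, hmu⟩
      rw [ha2 m u hu hmu]
      exact congrArg _ (Subtype.ext huy)
  have hFW : ContinuousOn F (pants T) := hF.continuousOn.mono fun u hu => hu.1
  have hX1c : IsClosed (closure (univ \ removed fun s => F ∘ T s)) := isClosed_closure
  -- Here and for closedness one works with closed sets: the pants are compact, so both `F` and `ψ`
  -- send their closed subsets to closed sets.
  have hac : Continuous a := by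
    rw [continuous_iff_isClosed]
    intro K hK
    obtain ⟨hK1, hK2⟩ := Glue.isClosed_iff.1 hK
    have h1 : IsClosed (Subtype.val '' (Glue.inl Rc ⁻¹' K)) :=
      isClosed_closure.isClosedMap_subtype_val _ hK1
    have h2 : IsClosed (Subtype.val '' (Glue.inr Rc ⁻¹' K)) :=
      isClosed_closure.isClosedMap_subtype_val _ hK2
    have h3 : IsClosed (F '' (pants T ∩ ψ ⁻¹' (Subtype.val '' (Glue.inr Rc ⁻¹' K)))) := by
      refine IsCompact.isClosed (IsCompact.image_of_continuousOn ?_ (hFW.mono inter_subset_left))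
      exact hW.of_isClosed_subset (hψ.preimage_isClosed_of_isClosed hW.isClosed h2)
        inter_subset_left
    have : a ⁻¹' K = Subtype.val ⁻¹' (Subtype.val '' (Glue.inl Rc ⁻¹' K) ∪
        F '' (pants T ∩ ψ ⁻¹' (Subtype.val '' (Glue.inr Rc ⁻¹' K)))) := by
      ext m
      constructor
      · intro hm
        rcases hcase m m.2 with hm0 | ⟨u, hu, hmu⟩
        · refine Or.inl ⟨⟨m, hm0⟩, ?_, rfl⟩
          rw [mem_preimage, ← ha1 m hm0]
          exact hm
        · refine Or.inr ⟨u, ⟨hu, ⟨ψ u, hψY0 u hu⟩, ?_, rfl⟩, hmu.symm⟩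
          rw [mem_preimage, ← ha2 m u hu hmu]
          exact hm
      · rintro (⟨p, hp, hpm⟩ | ⟨u, ⟨hu, y, hy, hyu⟩, hum⟩)
        · rw [mem_preimage, (hal m p).2 hpm.symm]
          exact hp
        · rw [mem_preimage, (har' m y).2 ⟨u, hu, hyu.symm, hum.symm⟩]
          exact hy
    rw [this]
    exact (h1.union h3).preimage continuous_subtype_val
  have hacl : IsClosedMap a := by
    intro K hK
    have h1 : IsClosed (Subtype.val '' K : Set M) := hX1c.isClosedMap_subtype_val _ hK
    rw [Glue.isClosed_iff]
    constructor
    · have : Glue.inl Rc ⁻¹' (a '' K) = Subtype.val ⁻¹' (Subtype.val '' K : Set M) := by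
        ext p
        constructor
        · rintro ⟨m, hm, hmp⟩
          exact ⟨m, hm, (hal m p).1 hmp⟩
        · rintro ⟨m, hm, hmp⟩
          exact ⟨m, hm, (hal m p).2 hmp⟩
      rw [this]
      exact h1.preimage continuous_subtype_val
    · have : Glue.inr Rc ⁻¹' (a '' K) =
          Subtype.val ⁻¹' (ψ '' (pants T ∩ F ⁻¹' (Subtype.val '' K : Set M))) := by
        ext y
        constructor
        · rintro ⟨m, hm, hmy⟩
          obtain ⟨u, hu, huy, hmu⟩ := (har' m y).1 hmy
          exact ⟨u, ⟨hu, m, hm, hmu⟩, huy⟩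
        · rintro ⟨u, ⟨hu, m, hm, hmu⟩, huy⟩
          exact ⟨m, hm, (har' m y).2 ⟨u, hu, huy, hmu⟩⟩
      rw [this]
      refine IsClosed.preimage continuous_subtype_val (IsCompact.isClosed
        (IsCompact.image_of_continuousOn ?_ (hψ.mono inter_subset_left)))
      exact hW.of_isClosed_subset (hFW.preimage_isClosed_of_isClosed hW.isClosed h1)
        inter_subset_left
  have hbc : Continuous fun q => Glue.inr Rc ⟨b q, hbY0 q⟩ :=
    (Glue.continuous_inr Rc).comp (hb.subtype_mk _)
  have hbcl : IsClosedMap fun q => Glue.inr Rc ⟨b q, hbY0 q⟩ := by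
    intro K hK
    rw [Glue.isClosed_iff]
    constructor
    · have : Glue.inl Rc ⁻¹' ((fun q => Glue.inr Rc ⟨b q, hbY0 q⟩) '' K) = ∅ := by
        rw [eq_empty_iff_forall_notMem]
        rintro p ⟨q, -, hq⟩
        exact hlb p q hq.symm
      rw [this]
      exact isClosed_empty
    · have : Glue.inr Rc ⁻¹' ((fun q => Glue.inr Rc ⟨b q, hbY0 q⟩) '' K) =
          Subtype.val ⁻¹' (b '' K) := by
        ext y
        constructor
        · rintro ⟨q, hq, hqy⟩
          exact ⟨q, hq, congrArg Subtype.val (hRc.inr_injective hqy)⟩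
        · rintro ⟨q, hq, hqy⟩
          exact ⟨q, hq, congrArg _ (Subtype.ext hqy)⟩
      rw [this]
      exact (hK.isCompact.image hb).isClosed.preimage continuous_subtype_val
  refine Glue.nonempty_homeomorph_of_isClosedMap (Z := Glue Rc) (a := a)
    (b := fun q => Glue.inr Rc ⟨b q, hbY0 q⟩) hac hbc hacl hbcl ?_ ?_ ?_ ?_
  · intro m m' hmm
    rcases hcase m' m'.2 with hm | ⟨u, hu, hmu⟩
    · rw [ha1 m' hm, hal] at hmm
      exact Subtype.ext hmm
    · rw [ha2 m' u hu hmu, har m u hu] at hmm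
      exact Subtype.ext (hmm.trans hmu.symm)
  · intro q q' hqq
    exact hbi (congrArg Subtype.val (hRc.inr_injective hqq))
  · intro m q
    rw [har']
    constructor
    · rintro ⟨u, hu, huq, hmu⟩
      obtain ⟨s, hs, hus⟩ := (hψb u hu q).1 huq
      exact ⟨s, hs, by rw [hmu, hus]; rfl⟩
    · rintro ⟨s, hs, hmq⟩
      exact ⟨T s q.2, hTW s q.2, (hψb _ (hTW s q.2) q).2 ⟨s, hs, rfl⟩, hmq⟩
  · refine Glue.ind (fun p => Or.inl ⟨⟨p, hX01 p p.2⟩, ?_⟩) fun y => ?_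
    · exact (hal _ p).2 rfl
    · rcases hsurj y ((hY0 _).1 y.2) with ⟨u, hu, huy⟩ | ⟨q, hq⟩
      · exact Or.inl ⟨⟨F u, hWX1 u hu⟩, (har' _ y).2 ⟨u, hu, huy, rfl⟩⟩
      · exact Or.inr ⟨q, congrArg _ (Subtype.ext hq)⟩

end Model

/-! ### Inversion in the unit sphere -/

section Inversion

/-- The inversion in the unit sphere. -/
def iv (x : E3) : E3 := (‖x‖ ^ 2)⁻¹ • x

theorem iv_zero : iv 0 = 0 := smul_zero _

theorem iv_eq_zero_iff {x : E3} : iv x = 0 ↔ x = 0 := by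
  simp [iv]

theorem norm_iv (x : E3) : ‖iv x‖ = ‖x‖⁻¹ := by
  rw [iv, norm_smul, norm_inv, norm_pow, norm_norm]
  by_cases hx : ‖x‖ = 0
  · simp [hx]
  · field_simp

theorem iv_iv (x : E3) : iv (iv x) = x := by
  by_cases hx : x = 0
  · rw [hx, iv_zero, iv_zero]
  · have : ‖x‖ ≠ 0 := norm_ne_zero_iff.2 hx
    rw [iv, norm_iv, iv, smul_smul]
    rw [show ((‖x‖⁻¹ ^ 2)⁻¹ * (‖x‖ ^ 2)⁻¹) = 1 by field_simp, one_smul]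

theorem iv_injective : Function.Injective iv := fun x y h => by
  rw [← iv_iv x, h, iv_iv]

theorem iv_of_norm_eq_one {x : E3} (hx : ‖x‖ = 1) : iv x = x := by
  rw [iv, hx]; simp

theorem iv_smul {c : ℝ} (hc : c ≠ 0) (x : E3) : iv (c • x) = c⁻¹ • iv x := by
  rw [iv, iv, norm_smul, smul_smul, smul_smul, mul_pow, Real.norm_eq_abs, sq_abs]
  congr 1
  field_simp

theorem iv_eq_inversion (x : E3) : iv x = EuclideanGeometry.inversion 0 1 x := by
  simp [iv, EuclideanGeometry.inversion]

theorem contDiffAt_iv {x : E3} (hx : x ≠ 0) : ContDiffAt ℝ ∞ iv x := by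
  have h1 : ContDiffAt ℝ ∞ (fun y : E3 => (‖y‖ ^ 2)⁻¹) x :=
    (contDiff_norm_sq ℝ).contDiffAt.inv (by simpa using hx)
  exact h1.smul contDiffAt_id

/-- `t` is a local diffeomorphism at `x`. -/
def IsLocalDiffeo (t : E3 → E3) (x : E3) : Prop :=
  ∃ L : E3 ≃L[ℝ] E3, HasStrictFDerivAt t (L : E3 →L[ℝ] E3) x

theorem IsLocalDiffeo.comp {s t : E3 → E3} {x : E3} (hs : IsLocalDiffeo s (t x))
    (ht : IsLocalDiffeo t x) : IsLocalDiffeo (s ∘ t) x := by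
  obtain ⟨L, hL⟩ := hs
  obtain ⟨L', hL'⟩ := ht
  exact ⟨L'.trans L, hL.comp x hL'⟩

theorem isLocalDiffeo_iv {x : E3} (hx : x ≠ 0) : IsLocalDiffeo iv x := by
  refine exists_equiv_hasStrictFDerivAt (contDiffAt_iv hx) ?_
  have h1 := (contDiffAt_iv hx).differentiableAt (by simp)
  have h2 := (contDiffAt_iv (iv_eq_zero_iff.not.2 hx)).differentiableAt (by simp)
  have h3 := (h2.hasFDerivAt.comp x h1.hasFDerivAt).unique
    ((hasFDerivAt_id x).congr_of_eventuallyEq (Eventually.of_forall iv_iv))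
  intro v w hvw
  have h5 := congrArg (fun L : E3 →L[ℝ] E3 => L v) h3
  have h6 := congrArg (fun L : E3 →L[ℝ] E3 => L w) h3
  simp only [ContinuousLinearMap.comp_apply, ContinuousLinearMap.id_apply] at h5 h6
  rw [← h5, ← h6]
  exact congrArg _ hvw

theorem hasStrictFDerivAt_smul_sub {c : ℝ} (hc : c ≠ 0) (a x : E3) :
    HasStrictFDerivAt (fun y : E3 => c • (y - a))
      ((ContinuousLinearEquiv.smulLeft (Units.mk0 c hc) : E3 ≃L[ℝ] E3) : E3 →L[ℝ] E3) x := by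
  have h := ((hasStrictFDerivAt_id (𝕜 := ℝ) x).sub_const a).const_smul c
  have hL : ((ContinuousLinearEquiv.smulLeft (Units.mk0 c hc) : E3 ≃L[ℝ] E3) : E3 →L[ℝ] E3) =
      c • ContinuousLinearMap.id ℝ E3 := by
    ext1 v
    rfl
  rw [hL]
  exact h

theorem isLocalDiffeo_smul_sub {c : ℝ} (hc : c ≠ 0) (a x : E3) :
    IsLocalDiffeo (fun y : E3 => c • (y - a)) x :=
  ⟨_, hasStrictFDerivAt_smul_sub hc a x⟩

end Inversion

/-! ### The two standard discs in the unit ball -/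

section ModelMaps

/-- A unit vector fixed by `rho`. -/
def poleQ : E3 := EuclideanSpace.single 1 1

theorem norm_poleQ : ‖poleQ‖ = 1 := by simp [poleQ]

theorem rho_poleQ : rho poleQ = poleQ := by
  ext i
  rw [rho_apply]
  fin_cases i <;> simp [poleQ]

/-- The large radius of the model. -/
def bigR : ℝ := Real.exp (Real.pi / 2)

theorem two_lt_bigR : 2 < bigR := by
  have h1 := Real.add_one_le_exp (Real.pi / 2)
  have h2 := Real.pi_gt_three
  rw [bigR]
  linarith

theorem bigR_pos : 0 < bigR := Real.exp_pos _

theorem inv_bigR_lt : bigR⁻¹ < 1 / 2 := by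
  rw [inv_lt_comm₀ bigR_pos (by norm_num)]
  have := two_lt_bigR
  norm_num
  linarith

/-- The inversion that maps the complement of the ball of radius `1 / 2` around `poleQ` to the unit
ball. -/
def toBall (v : E3) : E3 := iv ((2 : ℝ) • (v - poleQ))

/-- The inverse of `toBall`. -/
def ofBall (u : E3) : E3 := poleQ + (1 / 2 : ℝ) • iv u

theorem ofBall_toBall (v : E3) : ofBall (toBall v) = v := by
  rw [ofBall, toBall, iv_iv, smul_smul]
  norm_num

theorem toBall_ofBall (u : E3) : toBall (ofBall u) = u := by
  rw [ofBall, toBall, add_sub_cancel_left, smul_smul]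
  norm_num
  exact iv_iv u

theorem toBall_injective : Function.Injective toBall := fun v w h => by
  rw [← ofBall_toBall v, h, ofBall_toBall]

theorem ofBall_of_norm_eq_one {u : E3} (hu : ‖u‖ = 1) : ofBall u = poleQ + (1 / 2 : ℝ) • u := by
  rw [ofBall, iv_of_norm_eq_one hu]

theorem norm_toBall (v : E3) : ‖toBall v‖ = (2 * ‖v - poleQ‖)⁻¹ := by
  rw [toBall, norm_iv, norm_smul]
  norm_num

theorem isLocalDiffeo_toBall {v : E3} (hv : v ≠ poleQ) : IsLocalDiffeo toBall v := by
  refine IsLocalDiffeo.comp (s := iv) (t := fun y => (2 : ℝ) • (y - poleQ)) (isLocalDiffeo_iv ?_)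
    (isLocalDiffeo_smul_sub two_ne_zero _ _)
  exact smul_ne_zero two_ne_zero (sub_ne_zero.2 hv)

theorem continuousAt_ofBall {u : E3} (hu : u ≠ 0) : ContinuousAt ofBall u := by
  have h : ContinuousAt ((fun _ => (1 / 2 : ℝ)) • iv) u :=
    continuousAt_const.smul (contDiffAt_iv hu).continuousAt
  exact continuousAt_const.add (g := (fun _ => (1 / 2 : ℝ)) • iv) h

/-- The disc around the preimage of `0`. -/
def discPos (x : E3) : E3 := toBall (bigR⁻¹ • x)

/-- The disc around the preimage of infinity. -/
def discNeg (x : E3) : E3 :=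
  (2 * ‖x - bigR • poleQ‖ ^ 2)⁻¹ • (bigR • x - ‖x‖ ^ 2 • poleQ)

theorem norm_smul_sub_sq (c : ℝ) (x y : E3) :
    ‖c • x - y‖ ^ 2 = c ^ 2 * ‖x‖ ^ 2 - 2 * c * inner ℝ x y + ‖y‖ ^ 2 := by
  rw [norm_sub_sq_real, norm_smul, mul_pow, Real.norm_eq_abs, sq_abs, real_inner_smul_left]
  ring

/-- Away from `0` the disc parametrizes the exterior of the ball of radius `bigR`, followed by
`toBall`. The rational formula extends this over `x = 0`, which stands for infinity. -/
theorem discNeg_eq {x : E3} (hx : x ≠ 0) : discNeg x = toBall (bigR • iv x) := by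
  have hn : ‖x‖ ^ 2 ≠ 0 := by simpa using hx
  have hD : ‖bigR • iv x - poleQ‖ ^ 2 = ‖x - bigR • poleQ‖ ^ 2 / ‖x‖ ^ 2 := by
    have h1 : ‖x - bigR • poleQ‖ ^ 2 = ‖x‖ ^ 2 - 2 * bigR * inner ℝ x poleQ + bigR ^ 2 := by
      rw [norm_sub_sq_real, norm_smul, norm_poleQ, real_inner_smul_right, mul_one,
        Real.norm_eq_abs, sq_abs]
      ring
    have h2 : inner ℝ (iv x) poleQ = (‖x‖ ^ 2)⁻¹ * inner ℝ x poleQ := real_inner_smul_left _ _ _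
    rw [norm_smul_sub_sq, h1, h2, norm_iv, norm_poleQ]
    have hx' : ‖x‖ ≠ 0 := norm_ne_zero_iff.2 hx
    field_simp
    ring
  have hv : bigR • iv x - poleQ = (‖x‖ ^ 2)⁻¹ • (bigR • x - ‖x‖ ^ 2 • poleQ) := by
    rw [smul_sub, smul_smul, smul_smul, inv_mul_cancel₀ hn, one_smul, iv, smul_smul, mul_comm bigR]
  rw [toBall, iv_smul two_ne_zero, iv, hD, hv, smul_smul, smul_smul, discNeg]
  congr 1
  -- At this point, which lies outside the unit ball, both coefficients vanish because `0⁻¹ = 0`.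
  by_cases h0 : ‖x - bigR • poleQ‖ = 0
  · simp [h0]
  · field_simp

theorem discNeg_zero : discNeg 0 = 0 := by simp [discNeg]

theorem discPos_injective : Function.Injective discPos := fun x y h =>
  (smul_right_inj (inv_ne_zero bigR_pos.ne')).1 (toBall_injective h)

theorem norm_discPos_lt {x : E3} (hx : x ∈ ball3) : ‖discPos x‖ < 1 := by
  have hx : ‖x‖ ≤ 1 := mem_closedBall_zero_iff.1 hx
  have h1 : 1 / 2 < ‖bigR⁻¹ • x - poleQ‖ := by
    have h2 := norm_sub_norm_le poleQ (bigR⁻¹ • x)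
    rw [norm_poleQ, norm_smul, norm_inv, Real.norm_of_nonneg bigR_pos.le, norm_sub_rev] at h2
    have h3 : bigR⁻¹ * ‖x‖ ≤ bigR⁻¹ * 1 := by
      gcongr
      exact (inv_pos.2 bigR_pos).le
    linarith [inv_bigR_lt]
  rw [discPos, norm_toBall]
  exact inv_lt_one_of_one_lt₀ (by linarith)

theorem one_lt_norm_smul_iv_sub {x : E3} (hx : x ∈ ball3) (hx0 : x ≠ 0) :
    1 < ‖bigR • iv x - poleQ‖ := by
  have hx : ‖x‖ ≤ 1 := mem_closedBall_zero_iff.1 hx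
  have h2 := norm_sub_norm_le (bigR • iv x) poleQ
  rw [norm_poleQ, norm_smul, Real.norm_of_nonneg bigR_pos.le, norm_iv] at h2
  have h3 : bigR * 1 ≤ bigR * ‖x‖⁻¹ := by
    gcongr
    · exact bigR_pos.le
    · exact (one_le_inv₀ (norm_pos_iff.2 hx0)).2 hx
  linarith [two_lt_bigR]

theorem norm_discNeg_lt {x : E3} (hx : x ∈ ball3) : ‖discNeg x‖ < 1 := by
  by_cases hx0 : x = 0
  · rw [hx0, discNeg_zero, norm_zero]; exact one_pos
  · rw [discNeg_eq hx0, norm_toBall]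
    exact inv_lt_one_of_one_lt₀ (by linarith [one_lt_norm_smul_iv_sub hx hx0])

theorem discNeg_ne_zero {x : E3} (hx : x ∈ ball3) (hx0 : x ≠ 0) : discNeg x ≠ 0 := by
  rw [discNeg_eq hx0, ← norm_pos_iff, norm_toBall]
  have := one_lt_norm_smul_iv_sub hx hx0
  positivity

theorem discNeg_injOn : InjOn discNeg ball3 := by
  intro x hx y hy hxy
  by_cases hx0 : x = 0 <;> by_cases hy0 : y = 0
  · rw [hx0, hy0]
  · rw [hx0, discNeg_zero] at hxy
    exact absurd hxy.symm (discNeg_ne_zero hy hy0)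
  · rw [hy0, discNeg_zero] at hxy
    exact absurd hxy (discNeg_ne_zero hx hx0)
  · rw [discNeg_eq hx0, discNeg_eq hy0] at hxy
    exact iv_injective ((smul_right_inj bigR_pos.ne').1 (toBall_injective hxy))

theorem discPos_ne_zero {x : E3} (hx : x ∈ ball3) : discPos x ≠ 0 := by
  rw [discPos, ← norm_pos_iff, norm_toBall]
  have hx : ‖x‖ ≤ 1 := mem_closedBall_zero_iff.1 hx
  have hne : bigR⁻¹ • x ≠ poleQ := by
    intro h
    have h1 := congrArg norm h
    rw [norm_poleQ, norm_smul, norm_inv, Real.norm_of_nonneg bigR_pos.le] at h1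
    have h3 : bigR⁻¹ * ‖x‖ ≤ bigR⁻¹ * 1 := by
      gcongr
      exact (inv_pos.2 bigR_pos).le
    linarith [inv_bigR_lt]
  have := norm_pos_iff.2 (sub_ne_zero.2 hne)
  positivity

theorem discPos_ne_discNeg {x y : E3} (hx : x ∈ ball3) (hy : y ∈ ball3) :
    discPos x ≠ discNeg y := by
  intro h
  by_cases hy0 : y = 0
  · rw [hy0, discNeg_zero] at h
    exact discPos_ne_zero hx h
  · rw [discPos, discNeg_eq hy0] at h
    have h1 := congrArg norm (toBall_injective h)
    rw [norm_smul, norm_smul, norm_inv, Real.norm_of_nonneg bigR_pos.le, norm_iv] at h1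
    have hx : ‖x‖ ≤ 1 := mem_closedBall_zero_iff.1 hx
    have hy : ‖y‖ ≤ 1 := mem_closedBall_zero_iff.1 hy
    have h2 : bigR⁻¹ * ‖x‖ ≤ bigR⁻¹ * 1 := by
      gcongr
      exact (inv_pos.2 bigR_pos).le
    have h3 : bigR * 1 ≤ bigR * ‖y‖⁻¹ := by
      gcongr
      · exact bigR_pos.le
      · exact (one_le_inv₀ (norm_pos_iff.2 hy0)).2 hy
    linarith [two_lt_bigR, inv_bigR_lt]

theorem isLocalDiffeo_discPos {x : E3} (hx : x ∈ ball3) : IsLocalDiffeo discPos x := by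
  have hne : bigR⁻¹ • x ≠ poleQ := by
    intro h
    apply discPos_ne_zero hx
    rw [discPos, h, toBall, sub_self, smul_zero, iv_zero]
  refine IsLocalDiffeo.comp (s := toBall) (isLocalDiffeo_toBall hne) ?_
  simpa using isLocalDiffeo_smul_sub (inv_ne_zero bigR_pos.ne') 0 x

/-- The numerator vanishes at `0` and has derivative `bigR • id`, so only the value of the
denominator matters and the derivative is a positive multiple of the identity. Two inversions
preserve orientation, in contrast to `discPos`. -/
theorem hasStrictFDerivAt_discNeg_zero :
    ∃ L : E3 ≃L[ℝ] E3, HasStrictFDerivAt discNeg (L : E3 →L[ℝ] E3) 0 ∧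
      0 < (L : E3 →L[ℝ] E3).det := by
  have hq : bigR • poleQ ≠ 0 := smul_ne_zero bigR_pos.ne' (by
    rw [← norm_ne_zero_iff, norm_poleQ]; exact one_ne_zero)
  have hc0 : (2 * ‖(0 : E3) - bigR • poleQ‖ ^ 2) ≠ 0 := by
    rw [zero_sub, norm_neg]
    have := norm_pos_iff.2 hq
    positivity
  have h1 : ContDiffAt ℝ 1 (fun x : E3 => (2 * ‖x - bigR • poleQ‖ ^ 2)⁻¹) 0 := by
    refine ContDiffAt.inv ?_ hc0
    exact (contDiff_const.mul ((contDiff_norm_sq ℝ).comp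
      (contDiff_id.sub contDiff_const))).contDiffAt
  have h2 : HasStrictFDerivAt (fun x : E3 => bigR • x - ‖x‖ ^ 2 • poleQ)
      (bigR • ContinuousLinearMap.id ℝ E3) 0 := by
    have h3 : HasStrictFDerivAt (fun x : E3 => ‖x‖ ^ 2) (0 : E3 →L[ℝ] ℝ) 0 := by
      have := hasStrictFDerivAt_norm_sq (0 : E3)
      simpa using this
    have h4 := ((hasStrictFDerivAt_id (𝕜 := ℝ) (0 : E3)).const_smul bigR).sub
      (h3.smul_const poleQ)
    rw [ContinuousLinearMap.zero_smulRight, sub_zero] at h4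
    exact h4
  have h5 := (h1.hasStrictFDerivAt one_ne_zero).smul h2
  have h6 : 0 < (2 * ‖(0 : E3) - bigR • poleQ‖ ^ 2)⁻¹ * bigR :=
    mul_pos (inv_pos.2 (lt_of_le_of_ne (by positivity) hc0.symm)) bigR_pos
  have hL : ((ContinuousLinearEquiv.smulLeft (Units.mk0 _ h6.ne') : E3 ≃L[ℝ] E3) : E3 →L[ℝ] E3) =
      ((2 * ‖(0 : E3) - bigR • poleQ‖ ^ 2)⁻¹ * bigR) • ContinuousLinearMap.id ℝ E3 := by
    ext1 v
    rfl
  refine ⟨ContinuousLinearEquiv.smulLeft (Units.mk0 _ h6.ne'), ?_, ?_⟩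
  · have h7 : (bigR • (0 : E3) - ‖(0 : E3)‖ ^ 2 • poleQ) = 0 := by simp
    rw [h7, ContinuousLinearMap.smulRight_zero, add_zero, smul_smul] at h5
    rw [hL]
    exact h5
  · have h8 : ((((2 * ‖(0 : E3) - bigR • poleQ‖ ^ 2)⁻¹ * bigR) • ContinuousLinearMap.id ℝ E3 :
        E3 →L[ℝ] E3) : E3 →ₗ[ℝ] E3) =
        ((2 * ‖(0 : E3) - bigR • poleQ‖ ^ 2)⁻¹ * bigR) • LinearMap.id := rfl
    rw [hL, ContinuousLinearMap.det, h8, LinearMap.det_smul, LinearMap.det_id, mul_one]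
    exact pow_pos h6 _

theorem isLocalDiffeo_discNeg {x : E3} (hx : x ∈ ball3) : IsLocalDiffeo discNeg x := by
  by_cases hx0 : x = 0
  · rw [hx0]
    obtain ⟨L, hL, -⟩ := hasStrictFDerivAt_discNeg_zero
    exact ⟨L, hL⟩
  · have hne : bigR • iv x ≠ poleQ := by
      intro h
      have := one_lt_norm_smul_iv_sub hx hx0
      rw [h, sub_self, norm_zero] at this
      linarith
    have h1 : IsLocalDiffeo (fun y : E3 => bigR • y) (iv x) := by
      simpa using isLocalDiffeo_smul_sub bigR_pos.ne' 0 (iv x)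
    have h2 : IsLocalDiffeo ((fun y : E3 => bigR • y) ∘ iv) x := h1.comp (isLocalDiffeo_iv hx0)
    obtain ⟨L, hL⟩ := IsLocalDiffeo.comp (s := toBall) (t := (fun y : E3 => bigR • y) ∘ iv)
      (isLocalDiffeo_toBall hne) h2
    refine ⟨L, hL.congr_of_eventuallyEq ?_⟩
    filter_upwards [isOpen_compl_singleton.mem_nhds hx0] with y hy
    exact (discNeg_eq hy).symm

/-- The derivative of an inversion is a positive multiple of the reflection in a plane. -/
theorem hasStrictFDerivAt_discPos_zero :
    ∃ L : E3 ≃L[ℝ] E3, HasStrictFDerivAt discPos (L : E3 →L[ℝ] E3) 0 ∧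
      (L : E3 →L[ℝ] E3).det < 0 := by
  obtain ⟨L, hL⟩ := isLocalDiffeo_discPos (Metric.mem_closedBall_self zero_le_one)
  refine ⟨L, hL, ?_⟩
  have hc : (2 * bigR⁻¹) ≠ 0 := mul_ne_zero two_ne_zero (inv_ne_zero bigR_pos.ne')
  have hq0 : poleQ ≠ 0 := by rw [← norm_ne_zero_iff, norm_poleQ]; exact one_ne_zero
  have hne : (2 : ℝ) • (bigR⁻¹ • (0 : E3) - poleQ) ≠ 0 := by
    rw [smul_zero, zero_sub]
    exact smul_ne_zero two_ne_zero (neg_ne_zero.2 hq0)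
  have h1 : HasFDerivAt (fun x : E3 => (2 : ℝ) • (bigR⁻¹ • x - poleQ))
      ((2 * bigR⁻¹) • ContinuousLinearMap.id ℝ E3) 0 := by
    have := (((hasFDerivAt_id (𝕜 := ℝ) (0 : E3)).const_smul bigR⁻¹).sub_const poleQ).const_smul (2 : ℝ)
    rwa [smul_smul] at this
  have h2 := (EuclideanGeometry.hasFDerivAt_inversion (c := (0 : E3)) (R := 1) hne).comp 0 h1
  have h3 : EuclideanGeometry.inversion (0 : E3) 1 ∘
      (fun x : E3 => (2 : ℝ) • (bigR⁻¹ • x - poleQ)) = discPos :=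
    funext fun x => (iv_eq_inversion _).symm
  rw [h3] at h2
  rw [hL.hasFDerivAt.unique h2]
  set w : E3 := (2 : ℝ) • (bigR⁻¹ • (0 : E3) - poleQ) - 0 with hw
  set c : ℝ := (1 / dist ((2 : ℝ) • (bigR⁻¹ • (0 : E3) - poleQ)) 0) ^ 2 with hcdef
  have hcpos : 0 < c := by
    have : 0 < dist ((2 : ℝ) • (bigR⁻¹ • (0 : E3) - poleQ)) 0 := dist_pos.2 hne
    positivity
  have hdet : LinearMap.det ((ℝ ∙ w)ᗮ.reflection.toLinearEquiv : E3 →ₗ[ℝ] E3) = -1 := by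
    have h4 := (ℝ ∙ w)ᗮ.det_reflection
    have h5 : Module.finrank ℝ ((ℝ ∙ w)ᗮᗮ : Submodule ℝ E3) = 1 := by
      rw [Submodule.orthogonal_orthogonal]
      exact finrank_span_singleton (by rw [hw, sub_zero]; exact hne)
    rw [h5, pow_one] at h4
    exact h4
  have h6 : ((c • (((ℝ ∙ w)ᗮ.reflection : E3 ≃ₗᵢ[ℝ] E3) : E3 →L[ℝ] E3)).comp
      ((2 * bigR⁻¹) • ContinuousLinearMap.id ℝ E3)).det = -(c * (2 * bigR⁻¹)) ^ 3 := by
    have h7 : (((c • (((ℝ ∙ w)ᗮ.reflection : E3 ≃ₗᵢ[ℝ] E3) : E3 →L[ℝ] E3)).comp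
      ((2 * bigR⁻¹) • ContinuousLinearMap.id ℝ E3) : E3 →L[ℝ] E3) : E3 →ₗ[ℝ] E3) =
        (c * (2 * bigR⁻¹)) • ((ℝ ∙ w)ᗮ.reflection.toLinearEquiv : E3 →ₗ[ℝ] E3) := by
      ext1 v
      simp [smul_smul, mul_comm]
    rw [ContinuousLinearMap.det, h7, LinearMap.det_smul, hdet, finrank_E3]
    ring
  rw [h6]
  have := mul_pos hcpos (mul_pos two_pos (inv_pos.2 bigR_pos))
  have := pow_pos this 3
  linarith

end ModelMaps

/-! ### `S¹ × S²` as a quotient of punctured space -/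

section Wrap

/-- The radial projection to the unit sphere. -/
def toS2 (v : E3) : S2 :=
  if h : v = 0 then ⟨poleQ, by simp [norm_poleQ]⟩
  else ⟨‖v‖⁻¹ • v, by simp [norm_smul, h]⟩

theorem coe_toS2 {v : E3} (hv : v ≠ 0) : (toS2 v : E3) = ‖v‖⁻¹ • v := by
  rw [toS2, dif_neg hv]

theorem toS2_smul {c : ℝ} (hc : 0 < c) (x : S2) : toS2 (c • (x : E3)) = x := by
  have hx : ‖(x : E3)‖ = 1 := norm_eq_of_mem_sphere x
  have hx0 : (x : E3) ≠ 0 := norm_ne_zero_iff.1 (by rw [hx]; exact one_ne_zero)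
  apply Subtype.ext
  rw [coe_toS2 (smul_ne_zero hc.ne' hx0), norm_smul, hx, mul_one, Real.norm_of_nonneg hc.le,
    smul_smul, inv_mul_cancel₀ hc.ne', one_smul]

/-- The quotient map from the punctured space to its quotient by a dilation. -/
def wrap (v : E3) : S1xS2 := (Circle.exp (Real.log ‖v‖), toS2 v)

/-- A one-sided inverse of `wrap`. -/
def unwrap (p : S1xS2) : E3 := Real.exp (Complex.arg p.1) • (p.2 : E3)

theorem unwrap_wrap {v : E3} (hv : v ≠ 0) (h1 : -Real.pi < Real.log ‖v‖)
    (h2 : Real.log ‖v‖ ≤ Real.pi) : unwrap (wrap v) = v := by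
  have hn : 0 < ‖v‖ := norm_pos_iff.2 hv
  rw [unwrap, wrap, Circle.arg_exp h1 h2, Real.exp_log hn, coe_toS2 hv, smul_smul,
    mul_inv_cancel₀ hn.ne', one_smul]

theorem wrap_unwrap (p : S1xS2) : wrap (unwrap p) = p := by
  have hx : ‖(p.2 : E3)‖ = 1 := norm_eq_of_mem_sphere p.2
  have hn : ‖unwrap p‖ = Real.exp (Complex.arg p.1) := by
    rw [unwrap, norm_smul, hx, mul_one, Real.norm_of_nonneg (Real.exp_pos _).le]
  refine Prod.ext ?_ ?_
  · rw [wrap, hn, Real.log_exp, Circle.exp_arg]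
  · exact toS2_smul (Real.exp_pos _) _

theorem contDiffAt_log_norm {v : E3} (hv : v ≠ 0) :
    ContDiffAt ℝ ∞ (fun v : E3 => Real.log ‖v‖) v :=
  (contDiffAt_norm ℝ hv).log (norm_ne_zero_iff.2 hv)

theorem contMDiffAt_toS2 {v : E3} (hv : v ≠ 0) : ContMDiffAt 𝓘(ℝ, E3) (𝓡 2) ∞ toS2 v := by
  -- The smoothness criterion for maps into a sphere is global on the source, so the punctured space
  -- is treated as an open submanifold.
  let U : TopologicalSpace.Opens E3 := ⟨{0}ᶜ, isOpen_compl_singleton⟩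
  have h1 : ∀ w : E3, w ≠ 0 → ContDiffAt ℝ ∞ (fun v : E3 => ‖v‖⁻¹ • v) w := fun w hw =>
    ((contDiffAt_norm ℝ hw).inv (norm_ne_zero_iff.2 hw)).smul contDiffAt_id
  have h2 : ContMDiff 𝓘(ℝ, E3) 𝓘(ℝ, E3) ∞ (fun w : U => ‖(w : E3)‖⁻¹ • (w : E3)) := fun w =>
    contMDiffAt_subtype_iff.2 (h1 w w.2).contMDiffAt
  have h3 : ∀ w : U, ‖(w : E3)‖⁻¹ • (w : E3) ∈ Metric.sphere (0 : E3) 1 := fun w => by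
    have : (w : E3) ≠ 0 := w.2
    simp [norm_smul, this]
  have : Fact (Module.finrank ℝ E3 = 2 + 1) := ⟨by simp⟩
  have h4 := h2.codRestrict_sphere (n := 2) h3
  have h5 : Set.codRestrict _ _ h3 = fun w : U => toS2 w := by
    funext w
    exact Subtype.ext (coe_toS2 w.2).symm
  rw [h5] at h4
  exact contMDiffAt_subtype_iff.1 (h4 (⟨v, hv⟩ : U))

theorem contMDiffAt_wrap {v : E3} (hv : v ≠ 0) : ContMDiffAt 𝓘(ℝ, E3) modelS1xS2 ∞ wrap v :=
  ((contMDiff_circleExp (Real.log ‖v‖)).comp v (contDiffAt_log_norm hv).contMDiffAt).prodMk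
    (contMDiffAt_toS2 hv)

theorem contMDiffAt_unwrap {p : S1xS2} (hp : (p.1 : ℂ) ∈ Complex.slitPlane) :
    ContMDiffAt modelS1xS2 𝓘(ℝ, E3) ∞ unwrap p := by
  have h1 : ContDiffAt ℝ ∞ (fun z : ℂ => Real.exp (Complex.arg z)) p.1 := by
    have h2 : ContDiffAt ℝ ∞ Complex.log (p.1 : ℂ) := (Complex.contDiffAt_log hp).restrict_scalars ℝ
    simp only [← Complex.log_im]
    exact (Complex.imCLM.contDiff.contDiffAt.comp _ h2).exp
  have : Fact (Module.finrank ℝ E3 = 2 + 1) := ⟨by simp⟩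
  have : Fact (Module.finrank ℝ ℂ = 1 + 1) := ⟨Complex.finrank_real_complex⟩
  have h3 : ContMDiffAt modelS1xS2 𝓘(ℝ, ℂ) ∞ (fun p : S1xS2 => (p.1 : ℂ)) p :=
    (contMDiff_coe_sphere (E := ℂ) (n := 1) (p.1 : Metric.sphere (0 : ℂ) 1)).comp p contMDiffAt_fst
  have h4 : ContMDiffAt modelS1xS2 𝓘(ℝ, E3) ∞ (fun p : S1xS2 => (p.2 : E3)) p :=
    (contMDiff_coe_sphere (E := E3) (n := 2) p.2).comp p contMDiffAt_snd
  have h5 : ContMDiffAt modelS1xS2 𝓘(ℝ, ℝ) ∞ (fun p : S1xS2 => Real.exp (Complex.arg p.1)) p :=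
    ContMDiffAt.comp p (g := fun z : ℂ => Real.exp (Complex.arg z)) h1.contMDiffAt h3
  exact h5.smul h4

/-- The angle stays off the cut at `π`, so `unwrap` is a smooth local left inverse. -/
theorem isRegularAt_wrap {v : E3} (hv : v ≠ 0) (h1 : -Real.pi < Real.log ‖v‖)
    (h2 : Real.log ‖v‖ < Real.pi) : IsRegularAt modelS1xS2 wrap v := by
  refine isRegularAt_of_contMDiffAt (contMDiffAt_wrap hv) ?_
  have hp : ((wrap v).1 : ℂ) ∈ Complex.slitPlane := by
    rw [Complex.mem_slitPlane_iff_arg]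
    refine ⟨?_, Circle.coe_ne_zero _⟩
    rw [wrap, Circle.arg_exp h1 h2.le]
    exact h2.ne
  have h3 := (contMDiffAt_unwrap hp).mdifferentiableAt (by simp)
  have h4 := (contMDiffAt_wrap hv).mdifferentiableAt (by simp)
  have hc := (contDiffAt_log_norm hv).continuousAt
  have h5 : unwrap ∘ wrap =ᶠ[𝓝 v] id := by
    filter_upwards [isOpen_compl_singleton.mem_nhds hv, hc.eventually_const_lt h1,
      hc.eventually_lt_const h2] with w hw hw1 hw2
    exact unwrap_wrap hw hw1 hw2.le
  have h6 := mfderiv_comp v h3 h4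
  rw [h5.mfderiv_eq, mfderiv_id] at h6
  intro x y hxy
  have hx := congrArg (fun L : E3 →L[ℝ] E3 => L x) h6
  have hy := congrArg (fun L : E3 →L[ℝ] E3 => L y) h6
  exact hx.trans ((congrArg _ hxy).trans hy.symm)

theorem isRegularAt_id (x : E3) : IsRegularAt 𝓘(ℝ, E3) (id : E3 → E3) x :=
  isRegularAt_of_contMDiffAt contMDiffAt_id (by
    rw [mfderiv_id]
    exact fun _ _ h => h)

theorem IsLocalDiffeo.isRegularAt {t : E3 → E3} {x : E3} (ht : IsLocalDiffeo t x) :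
    IsRegularAt 𝓘(ℝ, E3) t x := by
  obtain ⟨L, hL⟩ := ht
  exact IsRegularAt.comp (f := id) (isRegularAt_id _) hL

end Wrap

/-! ### The unit ball without the two discs -/

section ModelDiscs

/-- The two discs in the unit ball. -/
def modelDisc (s : S0) : E3 → E3 := open Classical in if s = S0.pos then discPos else discNeg

theorem modelDisc_pos : modelDisc S0.pos = discPos := if_pos rfl

theorem modelDisc_neg : modelDisc S0.neg = discNeg := if_neg S0.pos_ne_neg.symm

theorem norm_modelDisc_lt (s : S0) {x : E3} (hx : x ∈ ball3) : ‖modelDisc s x‖ < 1 := by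
  obtain rfl | rfl := S0.eq_pos_or_eq_neg s
  · rw [modelDisc_pos]; exact norm_discPos_lt hx
  · rw [modelDisc_neg]; exact norm_discNeg_lt hx

theorem isLocalDiffeo_modelDisc (s : S0) {x : E3} (hx : x ∈ ball3) :
    IsLocalDiffeo (modelDisc s) x := by
  obtain rfl | rfl := S0.eq_pos_or_eq_neg s
  · rw [modelDisc_pos]; exact isLocalDiffeo_discPos hx
  · rw [modelDisc_neg]; exact isLocalDiffeo_discNeg hx

theorem modelDisc_injOn (s : S0) : InjOn (modelDisc s) ball3 := by
  obtain rfl | rfl := S0.eq_pos_or_eq_neg s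
  · rw [modelDisc_pos]; exact discPos_injective.injOn
  · rw [modelDisc_neg]; exact discNeg_injOn

theorem modelDisc_ne {s s' : S0} (hs : s ≠ s') {x y : E3} (hx : x ∈ ball3) (hy : y ∈ ball3) :
    modelDisc s x ≠ modelDisc s' y := by
  obtain rfl | rfl := S0.eq_pos_or_eq_neg s <;> obtain rfl | rfl := S0.eq_pos_or_eq_neg s'
  · exact absurd rfl hs
  · rw [modelDisc_pos, modelDisc_neg]; exact discPos_ne_discNeg hx hy
  · rw [modelDisc_pos, modelDisc_neg]; exact (discPos_ne_discNeg hy hx).symm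
  · exact absurd rfl hs

theorem isTameDisc_modelDisc (s : S0) : IsTameDisc (modelDisc s) :=
  isTameDisc_of_isRegularAt (J := 𝓘(ℝ, E3)) (ContinuousLinearEquiv.refl ℝ E3) (modelDisc_injOn s)
    fun _ hx => (isLocalDiffeo_modelDisc s hx).isRegularAt

theorem isCompact_pants_modelDisc : IsCompact (pants modelDisc) := by
  have h : pants modelDisc = ball3 ∩ ⋂ s, (modelDisc s '' Metric.ball 0 1)ᶜ := by
    ext u
    simp only [pants, mem_setOf_eq, mem_inter_iff, mem_iInter, mem_compl_iff]
  rw [h]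
  exact (isCompact_closedBall _ _).inter_right
    (isClosed_iInter fun s => (isTameDisc_modelDisc s).isOpen_image_ball.isClosed_compl)

theorem mem_image_discPos_iff {u : E3} :
    u ∈ discPos '' Metric.ball 0 1 ↔ ‖ofBall u‖ < bigR⁻¹ := by
  have hR := bigR_pos
  constructor
  · rintro ⟨x, hx, rfl⟩
    rw [mem_ball_zero_iff] at hx
    rw [discPos, ofBall_toBall, norm_smul, norm_inv, Real.norm_of_nonneg hR.le]
    exact mul_lt_of_lt_one_right (inv_pos.2 hR) hx
  · intro h
    refine ⟨bigR • ofBall u, ?_, ?_⟩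
    · rw [mem_ball_zero_iff, norm_smul, Real.norm_of_nonneg hR.le]
      calc bigR * ‖ofBall u‖ < bigR * bigR⁻¹ := by gcongr
        _ = 1 := mul_inv_cancel₀ hR.ne'
    · rw [discPos, smul_smul, inv_mul_cancel₀ hR.ne', one_smul, toBall_ofBall]

/-- The case `u = 0` stands for infinity and has to be listed apart: since `iv 0 = 0`, the value
`ofBall 0` is `poleQ`, of norm `1`. -/
theorem mem_image_discNeg_iff {u : E3} :
    u ∈ discNeg '' Metric.ball 0 1 ↔ u = 0 ∨ bigR < ‖ofBall u‖ := by
  have hR := bigR_pos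
  constructor
  · rintro ⟨x, hx, rfl⟩
    rw [mem_ball_zero_iff] at hx
    by_cases hx0 : x = 0
    · exact Or.inl (by rw [hx0, discNeg_zero])
    · right
      rw [discNeg_eq hx0, ofBall_toBall, norm_smul, norm_iv, Real.norm_of_nonneg hR.le]
      exact lt_mul_of_one_lt_right hR ((one_lt_inv₀ (norm_pos_iff.2 hx0)).2 hx)
  · rintro (rfl | h)
    · exact ⟨0, Metric.mem_ball_self one_pos, discNeg_zero⟩
    · have hv : ofBall u ≠ 0 := norm_pos_iff.1 (hR.trans h)
      have hv' : bigR⁻¹ • ofBall u ≠ 0 := smul_ne_zero (inv_ne_zero hR.ne') hv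
      refine ⟨iv (bigR⁻¹ • ofBall u), ?_, ?_⟩
      · rw [mem_ball_zero_iff, norm_iv, norm_smul, norm_inv, Real.norm_of_nonneg hR.le]
        refine inv_lt_one_of_one_lt₀ ?_
        calc 1 = bigR⁻¹ * bigR := (inv_mul_cancel₀ hR.ne').symm
          _ < bigR⁻¹ * ‖ofBall u‖ := by gcongr
      · rw [discNeg_eq (iv_eq_zero_iff.not.2 hv'), iv_iv, smul_smul, mul_inv_cancel₀ hR.ne',
          one_smul, toBall_ofBall]

/-- In the coordinate `ofBall u` this is the closed annulus between the radii `bigR⁻¹` and `bigR`,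
without the open ball of radius `1 / 2` around `poleQ`. -/
theorem mem_pants_modelDisc_iff {u : E3} : u ∈ pants modelDisc ↔
    u ∈ ball3 ∧ u ≠ 0 ∧ bigR⁻¹ ≤ ‖ofBall u‖ ∧ ‖ofBall u‖ ≤ bigR := by
  have h1 : (∀ s, u ∉ modelDisc s '' Metric.ball 0 1) ↔
      u ∉ discPos '' Metric.ball 0 1 ∧ u ∉ discNeg '' Metric.ball 0 1 := by
    constructor
    · intro h
      exact ⟨modelDisc_pos ▸ h S0.pos, modelDisc_neg ▸ h S0.neg⟩
    · rintro ⟨hp, hn⟩ s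
      obtain rfl | rfl := S0.eq_pos_or_eq_neg s
      · rwa [modelDisc_pos]
      · rwa [modelDisc_neg]
  rw [pants, mem_setOf_eq, h1, mem_image_discPos_iff, mem_image_discNeg_iff, not_or, not_lt, not_lt]
  tauto

end ModelDiscs

/-! ### The standard ball in `S¹ × S²` and its reflection -/

section ModelBall

/-- The standard ball in `S¹ × S²`. -/
def modelBall (x : E3) : S1xS2 := wrap (poleQ + (1 / 2 : ℝ) • x)

theorem norm_poleQ_add_mem {x : E3} (hx : x ∈ ball3) :
    bigR⁻¹ < ‖poleQ + (1 / 2 : ℝ) • x‖ ∧ ‖poleQ + (1 / 2 : ℝ) • x‖ < bigR := by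
  have hx : ‖x‖ ≤ 1 := mem_closedBall_zero_iff.1 hx
  have h1 : ‖(1 / 2 : ℝ) • x‖ ≤ 1 / 2 := by
    rw [norm_smul]
    norm_num
    linarith
  have h2 := norm_add_le poleQ ((1 / 2 : ℝ) • x)
  have h3 := norm_sub_norm_le poleQ (-((1 / 2 : ℝ) • x))
  rw [norm_neg, sub_neg_eq_add] at h3
  rw [norm_poleQ] at h2 h3
  have := inv_bigR_lt
  have := two_lt_bigR
  constructor <;> linarith

theorem neg_half_pi_le_log {v : E3} (h : bigR⁻¹ ≤ ‖v‖) : -(Real.pi / 2) ≤ Real.log ‖v‖ := by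
  rw [Real.le_log_iff_exp_le ((inv_pos.2 bigR_pos).trans_le h), Real.exp_neg]
  exact h

theorem neg_half_pi_lt_log {v : E3} (h : bigR⁻¹ < ‖v‖) : -(Real.pi / 2) < Real.log ‖v‖ := by
  rw [Real.lt_log_iff_exp_lt ((inv_pos.2 bigR_pos).trans h), Real.exp_neg]
  exact h

theorem log_le_half_pi {v : E3} (hv : v ≠ 0) (h : ‖v‖ ≤ bigR) : Real.log ‖v‖ ≤ Real.pi / 2 :=
  (Real.log_le_iff_le_exp (norm_pos_iff.2 hv)).2 h

theorem log_lt_half_pi {v : E3} (hv : v ≠ 0) (h : ‖v‖ < bigR) : Real.log ‖v‖ < Real.pi / 2 :=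
  (Real.log_lt_iff_lt_exp (norm_pos_iff.2 hv)).2 h

theorem ne_zero_of_inv_bigR_le {v : E3} (h : bigR⁻¹ ≤ ‖v‖) : v ≠ 0 :=
  norm_pos_iff.1 ((inv_pos.2 bigR_pos).trans_le h)

/-- The logarithm of the radius stays in `[-π / 2, π / 2]`, so the principal argument recovers it.
-/
theorem wrap_injOn : InjOn wrap {v | bigR⁻¹ ≤ ‖v‖ ∧ ‖v‖ ≤ bigR} := by
  have key : ∀ v : E3, bigR⁻¹ ≤ ‖v‖ ∧ ‖v‖ ≤ bigR → unwrap (wrap v) = v := by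
    rintro v ⟨h1, h2⟩
    have h0 := ne_zero_of_inv_bigR_le h1
    have := Real.pi_pos
    exact unwrap_wrap h0 (by linarith [neg_half_pi_le_log h1]) (by linarith [log_le_half_pi h0 h2])
  intro v hv w hw h
  rw [← key v hv, h, key w hw]

theorem modelBall_injOn : InjOn modelBall ball3 := by
  intro x hx y hy h
  have hx' := norm_poleQ_add_mem hx
  have hy' := norm_poleQ_add_mem hy
  have := wrap_injOn ⟨hx'.1.le, hx'.2.le⟩ ⟨hy'.1.le, hy'.2.le⟩ h
  exact (smul_right_inj (show (1 / 2 : ℝ) ≠ 0 by norm_num)).1 (add_left_cancel this)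

theorem isRegularAt_modelBall {x : E3} (hx : x ∈ ball3) :
    IsRegularAt modelS1xS2 modelBall x := by
  have hx' := norm_poleQ_add_mem hx
  have h0 := ne_zero_of_inv_bigR_le hx'.1.le
  have hpi := Real.pi_pos
  have h1 : IsLocalDiffeo (fun y : E3 => poleQ + (1 / 2 : ℝ) • y) x := by
    have h2 := isLocalDiffeo_smul_sub (show (1 / 2 : ℝ) ≠ 0 by norm_num) (-((2 : ℝ) • poleQ)) x
    have h3 : (fun y : E3 => (1 / 2 : ℝ) • (y - -((2 : ℝ) • poleQ))) =
        fun y : E3 => poleQ + (1 / 2 : ℝ) • y := by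
      funext y
      rw [sub_neg_eq_add, smul_add, smul_smul, add_comm]
      norm_num
    rwa [h3] at h2
  obtain ⟨L, hL⟩ := h1
  refine IsRegularAt.comp (f := wrap) (isRegularAt_wrap h0 ?_ ?_) hL
  · linarith [neg_half_pi_lt_log hx'.1]
  · linarith [log_lt_half_pi h0 hx'.2]

/-- The model space of `S¹ × S²` is three-dimensional. -/
def modelS1xS2Equiv : (EuclideanSpace ℝ (Fin 1) × EuclideanSpace ℝ (Fin 2)) ≃L[ℝ] E3 :=
  ContinuousLinearEquiv.ofFinrankEq (by simp)

theorem isTameDisc_modelBall : IsTameDisc modelBall :=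
  isTameDisc_of_isRegularAt modelS1xS2Equiv modelBall_injOn fun _ => isRegularAt_modelBall

/-- The centre `poleQ` is fixed by `rho`, so reflecting the parametrization amounts to a
homeomorphism of `S¹ × S²`. -/
theorem modelBall_rho (x : E3) :
    modelBall (rho x) = ((modelBall x).1, ⟨rho (modelBall x).2, by simp⟩) := by
  have h1 : poleQ + (1 / 2 : ℝ) • rho x = rho (poleQ + (1 / 2 : ℝ) • x) := by
    rw [map_add, map_smul, rho_poleQ]
  rw [modelBall, h1, modelBall]
  set v := poleQ + (1 / 2 : ℝ) • x
  refine Prod.ext ?_ (Subtype.ext ?_)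
  · simp [wrap]
  · change (toS2 (rho v) : E3) = rho (toS2 v)
    by_cases hv : v = 0
    · rw [hv, map_zero, toS2, dif_pos rfl, rho_poleQ]
    · rw [coe_toS2 hv, coe_toS2 (by simpa using hv), map_smul, LinearIsometryEquiv.norm_map]

/-- The reflection of `S¹ × S²` in the second factor. -/
def reflectS2 : S1xS2 ≃ₜ S1xS2 where
  toFun p := (p.1, ⟨rho p.2, by simp⟩)
  invFun p := (p.1, ⟨rho p.2, by simp⟩)
  left_inv p := by
    refine Prod.ext rfl (Subtype.ext ?_)
    exact rho_rho _
  right_inv p := by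
    refine Prod.ext rfl (Subtype.ext ?_)
    exact rho_rho _
  continuous_toFun := by fun_prop
  continuous_invFun := by fun_prop

theorem modelBall_comp_rho : modelBall ∘ rho = reflectS2 ∘ modelBall :=
  funext modelBall_rho

end ModelBall

/-! ### Decomposition of `S¹ × S²` without a ball -/

section ModelSurgery

/-- The tube `D¹ × S²` in `S¹ × S²` around the complement of a fundamental annulus of `wrap`. -/
def modelTube (q : D1 × S2) : S1xS2 :=
  (Circle.exp (Real.pi + Real.pi / 2 * (q.1 : ℝ)), q.2)

theorem continuous_modelTube : Continuous modelTube := by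
  unfold modelTube
  fun_prop

theorem D1.neg_one_le_and_le_one (d : D1) : -1 ≤ (d : ℝ) ∧ (d : ℝ) ≤ 1 := by
  have := d.2
  rw [mem_closedBall_zero_iff, Real.norm_eq_abs] at this
  exact abs_le.1 this

theorem modelTube_injective : Function.Injective modelTube := by
  rintro ⟨d, x⟩ ⟨d', x'⟩ h
  have h1 := congrArg Prod.fst h
  have h2 : x = x' := congrArg Prod.snd h
  have hd := D1.neg_one_le_and_le_one d
  have hd' := D1.neg_one_le_and_le_one d'
  have hpi := Real.pi_pos
  refine Prod.ext (Subtype.ext ?_) h2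
  have h3 := Circle.exp_injOn_Icc (a := Real.pi / 2) (b := 3 * Real.pi / 2) (by linarith)
    (⟨by nlinarith, by nlinarith⟩ : Real.pi + Real.pi / 2 * (d : ℝ) ∈ Icc _ _)
    (⟨by nlinarith, by nlinarith⟩ : Real.pi + Real.pi / 2 * (d' : ℝ) ∈ Icc _ _) h1
  have h4 : Real.pi / 2 * (d : ℝ) = Real.pi / 2 * (d' : ℝ) := by linarith
  exact mul_left_cancel₀ (by positivity) h4

/-- The tube occupies the angles `[π / 2, 3π / 2]` and the annulus `[-π / 2, π / 2]`; modulo `2π`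
these share only their ends. -/
theorem exp_eq_exp_tube {l : ℝ} {d : D1} (h1 : -(Real.pi / 2) ≤ l) (h2 : l ≤ Real.pi / 2)
    (h : Circle.exp l = Circle.exp (Real.pi + Real.pi / 2 * (d : ℝ))) :
    l = Real.pi / 2 ∧ (d : ℝ) = -1 ∨ l = -(Real.pi / 2) ∧ (d : ℝ) = 1 := by
  have hd := D1.neg_one_le_and_le_one d
  have hpi := Real.pi_pos
  obtain ⟨m, hm⟩ := Circle.exp_eq_exp.1 h.symm
  have hm0 : -1 < m := by
    have : (-1 : ℝ) < m := by
      by_contra hc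
      push Not at hc
      nlinarith
    exact_mod_cast this
  have hm1 : m < 2 := by
    have : (m : ℝ) < 2 := by
      by_contra hc
      push Not at hc
      nlinarith
    exact_mod_cast this
  obtain rfl | rfl : m = 0 ∨ m = 1 := by omega
  · left
    have hl : l = Real.pi / 2 := by
      rw [Int.cast_zero] at hm
      nlinarith
    refine ⟨hl, mul_left_cancel₀ (show Real.pi / 2 ≠ 0 by positivity) ?_⟩
    rw [hl, Int.cast_zero] at hm
    linarith
  · right
    have hl : l = -(Real.pi / 2) := by
      rw [Int.cast_one] at hm
      nlinarith
    refine ⟨hl, mul_left_cancel₀ (show Real.pi / 2 ≠ 0 by positivity) ?_⟩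
    rw [hl, Int.cast_one] at hm
    linarith

theorem S0.coe_pos : ((S0.pos : S0) : ℝ) = 1 := rfl

theorem S0.coe_neg : ((S0.neg : S0) : ℝ) = -1 := rfl

theorem discPos_sphere (x : S2) : ofBall (discPos x) = bigR⁻¹ • (x : E3) := ofBall_toBall _

theorem discNeg_sphere (x : S2) : ofBall (discNeg x) = bigR • (x : E3) := by
  have hx : ‖(x : E3)‖ = 1 := norm_eq_of_mem_sphere x
  have hx0 : (x : E3) ≠ 0 := norm_ne_zero_iff.1 (by rw [hx]; exact one_ne_zero)
  rw [discNeg_eq hx0, ofBall_toBall, iv_of_norm_eq_one hx]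

/-- The pants meet the tube in two spheres. The outer one, of radius `bigR`, is the end `-1` and
bounds `discNeg`; the inner one is the end `1` and bounds `discPos`. -/
theorem wrap_ofBall_eq_modelTube_iff {u : E3} (hu : u ∈ pants modelDisc) (q : D1 × S2) :
    wrap (ofBall u) = modelTube q ↔ ∃ s : S0, (s : ℝ) = q.1 ∧ u = modelDisc s q.2 := by
  obtain ⟨-, -, h1, h2⟩ := mem_pants_modelDisc_iff.1 hu
  have h0 := ne_zero_of_inv_bigR_le h1
  have hR := bigR_pos
  obtain ⟨d, x⟩ := q
  have hx : ‖(x : E3)‖ = 1 := norm_eq_of_mem_sphere x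
  constructor
  · intro h
    have hx : toS2 (ofBall u) = x := congrArg Prod.snd h
    have hv : ofBall u = ‖ofBall u‖ • (x : E3) := by
      rw [← hx, coe_toS2 h0, smul_smul, mul_inv_cancel₀ (norm_ne_zero_iff.2 h0), one_smul]
    obtain ⟨hl, hd⟩ | ⟨hl, hd⟩ := exp_eq_exp_tube (neg_half_pi_le_log h1) (log_le_half_pi h0 h2)
      (congrArg Prod.fst h)
    · refine ⟨S0.neg, by rw [S0.coe_neg, hd], ?_⟩
      have hn : ‖ofBall u‖ = bigR := by
        rw [← Real.exp_log (norm_pos_iff.2 h0), hl, bigR]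
      rw [← toBall_ofBall u, hv, hn, modelDisc_neg, ← discNeg_sphere, toBall_ofBall]
    · refine ⟨S0.pos, by rw [S0.coe_pos, hd], ?_⟩
      have hn : ‖ofBall u‖ = bigR⁻¹ := by
        rw [← Real.exp_log (norm_pos_iff.2 h0), hl, bigR, Real.exp_neg]
      rw [← toBall_ofBall u, hv, hn, modelDisc_pos, ← discPos_sphere, toBall_ofBall]
  · rintro ⟨s, hs, rfl⟩
    obtain rfl | rfl := S0.eq_pos_or_eq_neg s
    · rw [modelDisc_pos, discPos_sphere]
      refine Prod.ext ?_ (toS2_smul (inv_pos.2 hR) x)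
      have hs' : (d : ℝ) = 1 := hs.symm
      rw [modelTube, wrap, norm_smul, hx, norm_inv, Real.norm_of_nonneg hR.le, mul_one,
        Real.log_inv, bigR, Real.log_exp]
      refine Circle.exp_eq_exp.2 ⟨-1, ?_⟩
      dsimp only
      rw [hs']
      push_cast
      ring
    · rw [modelDisc_neg, discNeg_sphere]
      refine Prod.ext ?_ (toS2_smul hR x)
      have hs' : (d : ℝ) = -1 := hs.symm
      rw [modelTube, wrap, norm_smul, hx, Real.norm_of_nonneg hR.le, mul_one, bigR, Real.log_exp]
      dsimp only
      rw [hs']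
      congr 1
      ring

theorem modelTube_notMem (q : D1 × S2) : modelTube q ∉ modelBall '' ball3 := by
  rintro ⟨x, hx, h⟩
  have hx' := norm_poleQ_add_mem hx
  have h0 := ne_zero_of_inv_bigR_le hx'.1.le
  have h1 := neg_half_pi_lt_log hx'.1
  have h2 := log_lt_half_pi h0 hx'.2
  obtain ⟨hl, -⟩ | ⟨hl, -⟩ := exp_eq_exp_tube h1.le h2.le (congrArg Prod.fst h)
  · exact h2.ne hl
  · exact h1.ne' hl

theorem wrap_ofBall_notMem {u : E3} (hu : u ∈ pants modelDisc) :
    wrap (ofBall u) ∉ modelBall '' Metric.ball 0 1 := by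
  obtain ⟨hb, hu0, h1, h2⟩ := mem_pants_modelDisc_iff.1 hu
  rintro ⟨x, hx, h⟩
  have hx' := norm_poleQ_add_mem (Metric.ball_subset_closedBall hx)
  have h3 : poleQ + (1 / 2 : ℝ) • x = ofBall u :=
    wrap_injOn ⟨hx'.1.le, hx'.2.le⟩ ⟨h1, h2⟩ h
  have h4 : x = iv u := (smul_right_inj (show (1 / 2 : ℝ) ≠ 0 by norm_num)).1 (add_left_cancel h3)
  rw [mem_ball_zero_iff, h4, norm_iv] at hx
  have h5 : ‖u‖ ≤ 1 := mem_closedBall_zero_iff.1 hb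
  exact absurd hx (not_lt.2 ((one_le_inv₀ (norm_pos_iff.2 hu0)).2 h5))

theorem exists_pants_or_exists_tube {p : S1xS2} (hp : p ∉ modelBall '' Metric.ball 0 1) :
    (∃ u ∈ pants modelDisc, wrap (ofBall u) = p) ∨ ∃ q, modelTube q = p := by
  have hpi := Real.pi_pos
  have ha1 := Complex.neg_pi_lt_arg (p.1 : ℂ)
  have ha2 := Complex.arg_le_pi (p.1 : ℂ)
  set a := Complex.arg (p.1 : ℂ) with ha
  have hpa : p.1 = Circle.exp a := (Circle.exp_arg p.1).symm
  by_cases h1 : Real.pi / 2 < a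
  · right
    refine ⟨(⟨2 / Real.pi * (a - Real.pi), ?_⟩, p.2), Prod.ext ?_ rfl⟩
    · rw [mem_closedBall_zero_iff, Real.norm_eq_abs, abs_le]
      constructor
      · rw [div_mul_eq_mul_div, le_div_iff₀ hpi]; linarith
      · rw [div_mul_eq_mul_div, div_le_iff₀ hpi]; linarith
    · have h3 : Real.pi + Real.pi / 2 * (2 / Real.pi * (a - Real.pi)) = a := by
        field_simp
        ring
      rw [modelTube, hpa]
      exact congrArg Circle.exp h3
  by_cases h2 : a < -(Real.pi / 2)
  · right
    -- In the tube this point has angle `a + 2π`, hence the sign in the witness.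
    refine ⟨(⟨2 / Real.pi * (a + Real.pi), ?_⟩, p.2), Prod.ext ?_ rfl⟩
    · rw [mem_closedBall_zero_iff, Real.norm_eq_abs, abs_le]
      constructor
      · rw [div_mul_eq_mul_div, le_div_iff₀ hpi]; linarith
      · rw [div_mul_eq_mul_div, div_le_iff₀ hpi]; linarith
    · rw [modelTube, hpa]
      refine Circle.exp_eq_exp.2 ⟨1, ?_⟩
      field_simp
      push_cast
      ring
  left
  push Not at h1 h2
  have hn : ‖unwrap p‖ = Real.exp a := by
    rw [unwrap, norm_smul, norm_eq_of_mem_sphere, mul_one, Real.norm_of_nonneg (Real.exp_pos _).le]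
  have hv : 1 / 2 ≤ ‖unwrap p - poleQ‖ := by
    by_contra hc
    push Not at hc
    refine hp ⟨(2 : ℝ) • (unwrap p - poleQ), ?_, ?_⟩
    · rw [mem_ball_zero_iff, norm_smul]
      norm_num
      linarith
    · rw [modelBall, smul_smul]
      norm_num
      exact wrap_unwrap p
  refine ⟨toBall (unwrap p), mem_pants_modelDisc_iff.2 ⟨?_, ?_, ?_, ?_⟩, ?_⟩
  · rw [mem_closedBall_zero_iff, norm_toBall]
    exact inv_le_one_of_one_le₀ (by linarith)
  · rw [← norm_pos_iff, norm_toBall]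
    positivity
  · rw [ofBall_toBall, hn, bigR, ← Real.exp_neg]
    exact Real.exp_le_exp.2 h2
  · rw [ofBall_toBall, hn, bigR]
    exact Real.exp_le_exp.2 h1
  · rw [ofBall_toBall, wrap_unwrap]

theorem continuousAt_wrap {v : E3} (hv : v ≠ 0) : ContinuousAt wrap v :=
  (contMDiffAt_wrap hv).continuousAt

variable {M : Type*} [TopologicalSpace M] [T2Space M]

/-- The surgery along the two standard discs in a ball is a connected sum with `S¹ × S²`. -/
theorem zeroSurgery_modelDisc {F : E3 → M} (hF : IsTameDisc F)
    (hh : IsFramedEmbedding fun s => F ∘ modelDisc s) :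
    Nonempty (ZeroSurgery (fun s => F ∘ modelDisc s) ≃ₜ ConnectedSum F modelBall) := by
  refine zeroSurgery_homeomorph_connectedSum hF isTameDisc_modelBall
    (fun s x hx => mem_ball_zero_iff.2 (norm_modelDisc_lt s hx)) hh isCompact_pants_modelDisc
    (ψ := wrap ∘ ofBall) ?_ ?_ ?_ (fun u hu => wrap_ofBall_notMem hu) continuous_modelTube
    modelTube_injective modelTube_notMem (fun u hu q => wrap_ofBall_eq_modelTube_iff hu q)
    (fun p hp => exists_pants_or_exists_tube hp)
  · intro u hu
    obtain ⟨-, hu0, h1, -⟩ := mem_pants_modelDisc_iff.1 hu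
    exact ((continuousAt_wrap (ne_zero_of_inv_bigR_le h1)).comp
      (continuousAt_ofBall hu0)).continuousWithinAt
  · intro u hu u' hu' h
    obtain ⟨-, -, h1⟩ := mem_pants_modelDisc_iff.1 hu
    obtain ⟨-, -, h1'⟩ := mem_pants_modelDisc_iff.1 hu'
    rw [← toBall_ofBall u, wrap_injOn h1 h1' h, toBall_ofBall]
  · intro x
    rw [Function.comp_apply, ofBall_of_norm_eq_one (norm_eq_of_mem_sphere x), modelBall]

end ModelSurgery

/-! ### Normal form of a smooth framed embedding -/

section SmoothSurgery

theorem IsTameDisc.comp_rho {N : Type*} [TopologicalSpace N] {f : E3 → N} (hf : IsTameDisc f) :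
    IsTameDisc (f ∘ rho) := by
  obtain ⟨U, hU, hbU, hf⟩ := hf
  refine ⟨rho ⁻¹' U, hU.preimage rho.continuous, fun x hx => hbU ?_, ?_⟩
  · rw [← image_rho_ball3]
    exact mem_image_of_mem _ hx
  · exact hf.comp (rho.toHomeomorph.subtype (p := fun x => x ∈ rho ⁻¹' U) (q := fun x => x ∈ U)
      fun _ => Iff.rfl).isOpenEmbedding

variable {M : Type*} [TopologicalSpace M] [T2Space M] [ChartedSpace E3 M]
  [IsManifold 𝓘(ℝ, E3) ∞ M]

theorem isFramedEmbedding_comp_modelDisc {F : E3 → M} (hF : IsSmoothDisc 𝓘(ℝ, E3) F) :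
    IsFramedEmbedding fun s => F ∘ modelDisc s := by
  have hb : ∀ s, ∀ x ∈ ball3, modelDisc s x ∈ ball3 := fun s x hx =>
    mem_closedBall_zero_iff.2 (norm_modelDisc_lt s hx).le
  constructor
  · intro s
    refine isTameDisc_of_isRegularAt (J := 𝓘(ℝ, E3)) (ContinuousLinearEquiv.refl ℝ E3) ?_ ?_
    · exact hF.2.1.comp (modelDisc_injOn s) (hb s)
    · intro x hx
      obtain ⟨L, hL⟩ := isLocalDiffeo_modelDisc s hx
      exact IsRegularAt.comp (hF.isRegularAt (hb s x hx)) hL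
  · intro s t hst
    rw [disjoint_left]
    rintro _ ⟨x, hx, rfl⟩ ⟨y, hy, hxy⟩
    exact modelDisc_ne hst hx hy (hF.2.1 (hb t y hy) (hb s x hx) hxy).symm

variable [ConnectedSpace M]

/-- The germs are moved one at a time. `H₂` takes the first one to `F ∘ discPos` and is the identity
near `F 0`; this is where orientations enter. Then `H₁` takes `F` to `F ∘ discNeg` and is the
identity near `F (discPos 0)`. -/
theorem zeroSurgery_homeomorph_comp_modelDisc {h : S0 → E3 → M} (hh : IsFramedEmbedding h)
    (hs : ∀ s, IsSmoothDisc 𝓘(ℝ, E3) (h s)) (ho : RespectsOrientation h) :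
    Nonempty (ZeroSurgery h ≃ₜ ZeroSurgery fun s => h S0.neg ∘ modelDisc s) := by
  have hz : (0 : E3) ∈ ball3 := Metric.mem_closedBall_self zero_le_one
  set F := h S0.neg with hF
  have hFr : IsRegularAt 𝓘(ℝ, E3) F 0 := (hs S0.neg).isRegularAt hz
  have hp1 : discPos 0 ∈ Metric.ball (0 : E3) 1 := mem_ball_zero_iff.2 (norm_discPos_lt hz)
  have hne : F 0 ≠ F (discPos 0) := fun hc =>
    discPos_ne_zero hz ((hs S0.neg).2.1 hz (Metric.ball_subset_closedBall hp1) hc).symm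
  obtain ⟨L, hL, hLd⟩ := hasStrictFDerivAt_discPos_zero
  obtain ⟨H₂, hH₂, hH₂'⟩ :=
    germEquiv_of_respectsOrientation hh hs ho hL hLd (discPos_ne_zero hz) hp1
  obtain ⟨e, he, hFe⟩ := hFr.exists_openPartialHomeomorph (ContinuousLinearEquiv.refl ℝ E3)
  obtain ⟨L', hL', hLd'⟩ := hasStrictFDerivAt_discNeg_zero
  have hd : Tendsto discNeg (𝓝 0) (𝓝 0) := by
    have := hL'.continuousAt.tendsto
    rwa [discNeg_zero] at this
  obtain ⟨H₁, hH₁, hH₁'⟩ := (germEquiv_of_det_pos e (isClosed_singleton (x := F (discPos 0))) hL'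
    hLd' (by rwa [discNeg_zero]) (by rw [discNeg_zero, ← hFe.self_of_nhds]; exact hne)).symm
  rw [nhdsSet_singleton] at hH₁ hH₂
  obtain ⟨H, hH⟩ := hh.exists_homeomorph (isFramedEmbedding_comp_modelDisc (hs S0.neg))
    (H₂.trans H₁) (by
      intro s
      obtain rfl | rfl := S0.eq_pos_or_eq_neg s
      · have hc : Tendsto (F ∘ discPos) (𝓝 0) (𝓝 (F (discPos 0))) :=
          (((hs S0.neg).isRegularAt (Metric.ball_subset_closedBall hp1)).1).comp hL.continuousAt
        filter_upwards [hH₂', hc.eventually hH₁] with x hx hx'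
        rw [Homeomorph.trans_apply, hx, modelDisc_pos]
        exact hx'
      · filter_upwards [hFr.1.eventually hH₂, hH₁', hFe, hd.eventually hFe] with x hx hx' h3 h4
        rw [Homeomorph.trans_apply, ← hF, hx, modelDisc_neg, Function.comp_apply, h4, h3]
        rw [discNeg_zero, zero_add] at hx'
        exact hx')
  exact zeroSurgery_congr H hH

/-- Discs are unique up to a homeomorphism and a reflection. In `S¹ × S²` the reflection of
`modelBall` is realised by `reflectS2`; in `M` it is traded for one in `S¹ × S²` by reflecting both
discs. -/
theorem connectedSum_modelBall {i F : E3 → M} {j : E3 → S1xS2} (hi : IsSmoothDisc 𝓘(ℝ, E3) i)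
    (hF : IsSmoothDisc 𝓘(ℝ, E3) F) (hj : IsSmoothDisc modelS1xS2 j) :
    Nonempty (ConnectedSum F modelBall ≃ₜ ConnectedSum i j) := by
  have hz : (0 : E3) ∈ ball3 := Metric.mem_closedBall_self zero_le_one
  have hi' := hi.isTameDisc (ContinuousLinearEquiv.refl ℝ E3)
  have hF' := hF.isTameDisc (ContinuousLinearEquiv.refl ℝ E3)
  have hj' := hj.isTameDisc modelS1xS2Equiv
  have hrefl : ∀ k : E3 → M, Nonempty (ConnectedSum k modelBall ≃ₜ
      ConnectedSum k (modelBall ∘ rho)) := fun k =>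
    connectedSum_congr (Homeomorph.refl M) reflectS2 (fun _ _ => rfl)
      fun x _ => (congrFun modelBall_comp_rho x).symm
  have hi2 : (∃ H : M ≃ₜ M, ∀ x ∈ ball3, H (F x) = i x) ∨
      ∃ H : M ≃ₜ M, ∀ x ∈ ball3, H (F (rho x)) = i x := by
    obtain h | h := germEquiv_or_germEquiv_comp_rho (ContinuousLinearEquiv.refl ℝ E3)
      isClosed_empty (by rw [compl_empty]; exact isPreconnected_univ) (hi.isRegularAt hz)
      (hF.isRegularAt hz) (notMem_empty _) (notMem_empty _)
    · exact Or.inl (hF'.exists_homeomorph hi' h.symm)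
    · exact Or.inr (hF'.comp_rho.exists_homeomorph hi' h.symm)
  have hj2 : (∃ H : S1xS2 ≃ₜ S1xS2, ∀ x ∈ ball3, H (modelBall x) = j x) ∨
      ∃ H : S1xS2 ≃ₜ S1xS2, ∀ x ∈ ball3, H (modelBall (rho x)) = j x := by
    obtain h | h := germEquiv_or_germEquiv_comp_rho modelS1xS2Equiv
      isClosed_empty (by rw [compl_empty]; exact isPreconnected_univ) (hj.isRegularAt hz)
      (isRegularAt_modelBall hz) (notMem_empty _) (notMem_empty _)
    · exact Or.inl (isTameDisc_modelBall.exists_homeomorph hj' h.symm)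
    · exact Or.inr (isTameDisc_modelBall.comp_rho.exists_homeomorph hj' h.symm)
  obtain ⟨K, hK⟩ : ∃ H : S1xS2 ≃ₜ S1xS2, ∀ x ∈ ball3, H (modelBall x) = j x := by
    obtain h | ⟨K, hK⟩ := hj2
    · exact h
    · refine ⟨reflectS2.trans K, fun x hx => ?_⟩
      rw [← hK x hx]
      exact congrArg K (congrFun modelBall_comp_rho x).symm
  obtain ⟨H, hH⟩ | ⟨H, hH⟩ := hi2
  · exact connectedSum_congr H K hH hK
  · obtain ⟨A⟩ := connectedSum_comp_rho F modelBall
    obtain ⟨B⟩ := hrefl (F ∘ rho)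
    obtain ⟨D⟩ := connectedSum_congr (i := F ∘ rho) H K hH hK
    exact ⟨A.trans (B.symm.trans D)⟩

/-- A surgery that respects orientations is a connected sum with `S¹ × S²`. -/
theorem nonempty_zeroSurgery_homeomorph_connectedSum {h : S0 → E3 → M} (hh : IsFramedEmbedding h)
    (hs : ∀ s, IsSmoothDisc 𝓘(ℝ, E3) (h s)) (ho : RespectsOrientation h) {i : E3 → M}
    {j : E3 → S1xS2} (hi : IsSmoothDisc 𝓘(ℝ, E3) i) (hj : IsSmoothDisc modelS1xS2 j) :
    Nonempty (ZeroSurgery h ≃ₜ ConnectedSum i j) := by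
  obtain ⟨A⟩ := zeroSurgery_homeomorph_comp_modelDisc hh hs ho
  obtain ⟨B⟩ := zeroSurgery_modelDisc (hh.tame S0.neg)
    (isFramedEmbedding_comp_modelDisc (hs S0.neg))
  obtain ⟨D⟩ := connectedSum_modelBall hi (hs S0.neg) hj
  exact ⟨A.trans (B.trans D)⟩

end SmoothSurgery

end Surgery

end

theorem mainTheorem2 {M : Type*} [TopologicalSpace M] [T2Space M] [SecondCountableTopology M]
    [ConnectedSpace M] [ChartedSpace Surgery.E3 M]
    (h : Surgery.S0 → Surgery.E3 → M) (hh : Surgery.IsFramedEmbedding h) :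
    -- `χ(M)` is homeomorphic to `M # (S¹ × S²)`, whatever discs are used to form the connected sum
    (IsManifold 𝓘(ℝ, Surgery.E3) ∞ M →
      (∀ s, Surgery.IsSmoothDisc 𝓘(ℝ, Surgery.E3) (h s)) →
      Surgery.RespectsOrientation h →
      ∀ (i : Surgery.E3 → M) (j : Surgery.E3 → Surgery.S1xS2),
        Surgery.IsSmoothDisc 𝓘(ℝ, Surgery.E3) i → Surgery.IsSmoothDisc Surgery.modelS1xS2 j →
        Nonempty (Surgery.ZeroSurgery h ≃ₜ Surgery.ConnectedSum i j)) ∧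
    -- `π₁(χ(M)) ≅ π₁(M) * ℤ`
    (∀ (x : Surgery.ZeroSurgery h) (m : M),
      Nonempty (FundamentalGroup (Surgery.ZeroSurgery h) x ≃*
        Monoid.Coprod (FundamentalGroup M m) (Multiplicative ℤ))) ∧
    -- `π₁(χ(M)) ≅ π₁(M # (S¹ × S²)) ≅ π₁(M) * π₁(S¹ × S²) ≅ π₁(M) * (π₁(S¹) × π₁(S²))`
    (∀ (i : Surgery.E3 → M) (j : Surgery.E3 → Surgery.S1xS2),
      Surgery.IsTameDisc i → Surgery.IsTameDisc j →
      ∀ (x : Surgery.ZeroSurgery h) (y : Surgery.ConnectedSum i j) (m : M)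
        (a : Circle) (b : Surgery.S2),
        Nonempty (FundamentalGroup (Surgery.ZeroSurgery h) x ≃*
          FundamentalGroup (Surgery.ConnectedSum i j) y) ∧
        Nonempty (FundamentalGroup (Surgery.ConnectedSum i j) y ≃*
          Monoid.Coprod (FundamentalGroup M m) (FundamentalGroup Surgery.S1xS2 (a, b))) ∧
        Nonempty (Monoid.Coprod (FundamentalGroup M m) (FundamentalGroup Surgery.S1xS2 (a, b)) ≃*
          Monoid.Coprod (FundamentalGroup M m)
            (FundamentalGroup Circle a × FundamentalGroup Surgery.S2 b))) := by
  -- The charts enter the statements on fundamental groups only through local path connectedness.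
  have : LocallyPathConnectedSpace M := ChartedSpace.locallyPathConnectedSpace Surgery.E3 M
  exact ⟨fun _ hs ho _ _ hi hj =>
      Surgery.nonempty_zeroSurgery_homeomorph_connectedSum hh hs ho hi hj,
    Surgery.nonempty_fundamentalGroup_zeroSurgery_mulEquiv hh,
    fun i j hi hj => Surgery.fundamentalGroup_zeroSurgery_connectedSum hh hi hj⟩
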